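/- Let $M$ be the MacLane $8_3$ configuration, i.e. the simple matroid of rank three on $\{1,\dots,8\}$ whose lines are $\{3,4,6\},\{2,6,7\},\{1,5,6\},\{2,3,5\},\{1,4,7\},\{1,2,8\},\{3,7,8\},\{4,5,8\}$ (a set is dependent if and only if it has at least four elements or consists of three points of a line). All varieties live in the affine space $\mathbb C^{3\cdot 8}$ of $8$-tuples $\gamma=(\gamma_1,\dots,\gamma_8)$ of vectors in $\mathbb C^3$ with its Zariski topology. For a matroid $N$ on $\{1,\dots,8\}$ let $V_N$, the matroid variety, be the Zariski closure of the set of $\gamma$ such that, for every $S\subseteq\{1,\dots,8\}$, the family $(\gamma_i)_{i\in S}$ is linearly dependent if and only if $S$ is dependent in $N$; let $V_{\mathcal C(N)}$, the circuit variety, be the set of $\gamma$ such that $(\gamma_i)_{i\in S}$ is linearly dependent for every dependent set $S$ of $N$. Let * $U_{2,8}$ be the uniform matroid of rank two on $\{1,\dots,8\}$; * $M(i)$, $1\le i\le 8$, be the matroid obtained from $M$ by making $i$ a loop; * $D_1,\dots,D_4$ be the matroids obtained from $M$ by making both points of a pair on no common line loops; these pairs are $\{1,3\},\{2,4\},\{5,7\},\{6,8\}$;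 * $B_k$, $1\le k\le 8$, be the loopless matroid of rank three in which, for each of the three lines $\{k,y,z\}$ of $M$ through $k$, the points $y$ and $z$ are parallel, and the resulting four distinct points other than $k$ (three double points and one simple point) lie on one line that does not contain $k$, with no further dependencies. Then $V_M$ has exactly two irreducible components $V_M^+$ and $V_M^-$, and $$V_{\mathcal C(M)}=V_M^+\cup V_M^-\cup V_{U_{2,8}}\cup\bigcup_{i=1}^{8}V_{M(i)}\cup\bigcup_{i=1}^{4}V_{D_i}\cup\bigcup_{k=1}^{8}V_{B_k}.$$ This is the irreducible decomposition of $V_{\mathcal C(M)}$: the $23$ varieties on the right-hand side are pairwise distinct, and they are exactly the irreducible components of $V_{\mathcal C(M)}$. -/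

import Mathlib

/-! ### Matroids and point-line configurations -/

/-- The uniform matroid `U_{n,d}`: the independent sets are those with at most `n` elements. -/
def uniformMatroid (n d : ℕ) : Matroid (Fin d) :=
  (IndepMatroid.ofFinite Set.finite_univ (fun I : Set (Fin d) => I.ncard ≤ n)
    (by simp)
    (fun _ J hJ hIJ => (Set.ncard_le_ncard hIJ J.toFinite).trans hJ)
    (fun I J _ hJ hlt => by
      obtain ⟨e, he, heI⟩ := Set.exists_mem_notMem_of_ncard_lt_ncard hlt I.toFinite
      exact ⟨e, he, heI, by rw [Set.ncard_insert_of_notMem heI I.toFinite]; omega⟩)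
    (fun _ _ => Set.subset_univ _)).matroid

/-- A point-line configuration on `d` points: every line has at least three points, and
two different lines share at most one point. -/
structure PointLineConfig (d : ℕ) where
  lines : Finset (Finset (Fin d))
  three_le_card : ∀ l ∈ lines, 3 ≤ l.card
  inter_card_le : ∀ l ∈ lines, ∀ m ∈ lines, l ≠ m → (l ∩ m).card ≤ 1

/-- Independence in the simple matroid of rank at most three of a point-line configuration:
at most three points, and not three points of one line. -/
def PointLineConfig.IndepSet {d : ℕ} (C : PointLineConfig d) (I : Finset (Fin d)) : Prop :=
  I.card ≤ 3 ∧ (I.card = 3 → ∀ l ∈ C.lines, ¬ I ⊆ l)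

theorem PointLineConfig.indepSet_of_card_le_two {d : ℕ} (C : PointLineConfig d)
    {I : Finset (Fin d)} (h : I.card ≤ 2) : C.IndepSet I :=
  ⟨by omega, fun h3 => by omega⟩

theorem PointLineConfig.indepSet_subset {d : ℕ} (C : PointLineConfig d) ⦃I J : Finset (Fin d)⦄
    (hJ : C.IndepSet J) (hIJ : I ⊆ J) : C.IndepSet I :=
  ⟨(Finset.card_le_card hIJ).trans hJ.1, fun h3 l hl hIl => by
    have hJ1 := hJ.1
    have hEq : I = J := Finset.eq_of_subset_of_card_le hIJ (by omega)
    subst hEq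
    exact hJ.2 h3 l hl hIl⟩

theorem PointLineConfig.indepSet_aug {d : ℕ} (C : PointLineConfig d) ⦃I J : Finset (Fin d)⦄
    (_ : C.IndepSet I) (hJ : C.IndepSet J) (hlt : I.card < J.card) :
    ∃ e ∈ J, e ∉ I ∧ C.IndepSet (insert e I) := by
  have hJ3 := hJ.1
  by_cases h1 : I.card ≤ 1
  · obtain ⟨e, he, heI⟩ := Finset.exists_mem_notMem_of_card_lt_card hlt
    exact ⟨e, he, heI, C.indepSet_of_card_le_two (by
      rw [Finset.card_insert_of_notMem heI]; omega)⟩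
  · have hI2 : I.card = 2 := by omega
    have hJc : J.card = 3 := by omega
    by_contra! hcon
    have key : ∀ e ∈ J, e ∉ I → ∃ l ∈ C.lines, insert e I ⊆ l := by
      intro e he heI
      by_contra! hl
      exact hcon e he heI
        ⟨by rw [Finset.card_insert_of_notMem heI]; omega, fun _ l hlC => hl l hlC⟩
    obtain ⟨e, he, heI⟩ := Finset.exists_mem_notMem_of_card_lt_card hlt
    obtain ⟨l, hlC, hl⟩ := key e he heI
    refine hJ.2 hJc l hlC (fun x hx => ?_)
    by_cases hxI : x ∈ I
    · exact hl (Finset.mem_insert_of_mem hxI)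
    · obtain ⟨m, hmC, hm⟩ := key x hx hxI
      have hlm : l = m := by
        by_contra hne
        have hsub : I ⊆ l ∩ m := Finset.subset_inter
          ((Finset.subset_insert _ _).trans hl) ((Finset.subset_insert _ _).trans hm)
        have := Finset.card_le_card hsub
        have := C.inter_card_le l hlC m hmC hne
        omega
      rw [hlm]
      exact hm (Finset.mem_insert_self _ _)

/-- The simple matroid of rank at most three of a point-line configuration. -/
def PointLineConfig.matroid {d : ℕ} (C : PointLineConfig d) : Matroid (Fin d) :=
  (IndepMatroid.ofFinset Set.univ C.IndepSet
    (C.indepSet_of_card_le_two (by simp))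
    C.indepSet_subset
    C.indepSet_aug
    (fun _ _ => Set.subset_univ _)).matroid

/-- The matroid on the ground set of `M` in which the elements of `S` are made loops and which
restricts to `M` outside `S`. -/
def makeLoops {α : Type*} (M : Matroid α) (S : Set α) : Matroid α :=
  (M.restrict (M.E \ S)).restrict M.E

/-! ### Affine space of vector configurations, matroid varieties and circuit varieties -/

/-- Configurations of `d` vectors in `ℂⁿ`, i.e. the points of the affine space `ℂ^{nd}`. -/
def VecConfig (n d : ℕ) : Type := Fin d → Fin n → ℂ

/-- The value at a configuration of a polynomial in its `nd` coordinates. -/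
noncomputable def evalAt {n d : ℕ} (γ : VecConfig n d) (p : MvPolynomial (Fin d × Fin n) ℂ) : ℂ :=
  MvPolynomial.eval (fun ij => γ ij.1 ij.2) p

/-- The Zariski topology on `ℂ^{nd}`, generated by the principal open sets. -/
instance VecConfig.zariskiTopology (n d : ℕ) : TopologicalSpace (VecConfig n d) :=
  TopologicalSpace.generateFrom
    (Set.range fun p : MvPolynomial (Fin d × Fin n) ℂ => {γ : VecConfig n d | evalAt γ p ≠ 0})

/-- The vectors of `γ` indexed by `S` are linearly dependent (as an indexed family). -/
def LinDep {n d : ℕ} (γ : VecConfig n d) (S : Set (Fin d)) : Prop :=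
  ¬ LinearIndepOn ℂ (γ : Fin d → Fin n → ℂ) S

/-- Realizations of `M` by vectors of `ℂⁿ`. -/
def realizationSpace (n : ℕ) {d : ℕ} (M : Matroid (Fin d)) : Set (VecConfig n d) :=
  {γ | ∀ S : Set (Fin d), LinDep γ S ↔ M.Dep S}

/-- The matroid variety in `ℂ^{nd}`: the Zariski closure of the realization space. -/
def matroidVariety (n : ℕ) {d : ℕ} (M : Matroid (Fin d)) : Set (VecConfig n d) :=
  closure (realizationSpace n M)

/-- The circuit variety in `ℂ^{nd}`: all configurations that include the dependencies of `M`. -/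
def circuitVariety (n : ℕ) {d : ℕ} (M : Matroid (Fin d)) : Set (VecConfig n d) :=
  {γ | ∀ S : Set (Fin d), M.Dep S → LinDep γ S}

/-- The irreducible components of a subset `X` of a topological space: the maximal irreducible
subsets of `X`. -/
def irredComponentsOf {T : Type*} [TopologicalSpace T] (X : Set T) : Set (Set T) :=
  {Z | Maximal (fun Y => IsIrreducible Y ∧ Y ⊆ X) Z}

/-! ### The MacLane configuration and the matroids in the decomposition -/

set_option maxRecDepth 100000 in
/-- The MacLane `8_3` configuration, on the points `1, …, 8`; in `Fin 8` the point `8` is `0`. -/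
def macLane : PointLineConfig 8 where
  lines := {{6, 3, 4}, {6, 2, 7}, {6, 1, 5}, {2, 3, 5}, {1, 4, 7}, {0, 1, 2}, {0, 3, 7}, {0, 4, 5}}
  three_le_card := by decide
  inter_card_le := by decide

/-- `M(i)`: the point `i` of the MacLane configuration is made a loop. -/
def macLaneLoop (i : Fin 8) : Matroid (Fin 8) := makeLoops macLane.matroid {i}

/-- The four pairs of points of the MacLane configuration that lie on no common line:
`{1,3}`, `{2,4}`, `{5,7}`, `{6,8}`. -/
def macLanePair : Fin 4 → Set (Fin 8) := ![{1, 3}, {2, 4}, {5, 7}, {6, 0}]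

/-- `D_i`: two points of the MacLane configuration on no common line are made loops. -/
def macLaneD (i : Fin 4) : Matroid (Fin 8) := makeLoops macLane.matroid (macLanePair i)

/-- The configuration on eight points whose only line consists of all points except `x`. -/
def lineAvoiding (x : Fin 8) : PointLineConfig 8 where
  lines := {{x}ᶜ}
  three_le_card := by simp [Finset.card_compl]
  inter_card_le := by
    intro l hl m hm hne
    exact absurd ((Finset.mem_singleton.1 hl).trans (Finset.mem_singleton.1 hm).symm) hne

/-- The points that become parallel to `y` in `B_x`: `y` itself, and the point `z` such that
`x, y, z` form a line of the MacLane configuration (if there is one). -/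
def macLaneClass (x y : Fin 8) : Finset (Fin 8) :=
  Finset.univ.filter fun z => z = y ∨ ({x, y, z} : Finset (Fin 8)) ∈ macLane.lines

/-- The least element of the class of `y`. -/
def macLaneRep (x y : Fin 8) : Fin 8 :=
  (macLaneClass x y).min' ⟨y, by simp [macLaneClass]⟩

/-- `B_x`: the seven points other than `x` lie on a line that avoids `x`; for each MacLane line
`{x, y, z}` the points `y` and `z` are identified. So the line carries three double points and
one simple point, and `x` is a free point. -/
def macLaneB (x : Fin 8) : Matroid (Fin 8) := (lineAvoiding x).matroid.comap (macLaneRep x)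

/-!
Let `X` be the circuit variety of the MacLane configuration: the zero set in `ℂ²⁴` of the eight
determinants of its lines. Each of the matroid varieties in the decomposition is the closure of the
image of a polynomial map with an affine space as its source, up to a relabelling by an automorphism
of the configuration (`matroidVariety_uniform`, `matroidVariety_macLaneLoop_six`,
`matroidVariety_macLaneD_three`, `matroidVariety_macLaneB_six`), hence irreducible. The matroid
variety of the MacLane matroid itself is the union of two such closures
(`matroidVariety_macLane`): completing lines from a basis of three-space gives coordinates in which
all incidences amount to `t ^ 2 + t + 1 = 0`, and each root `t` contributes one map.

That these closures cover `X` is a dimension count. Let `γ` be a point of `X`, and `P` a minimal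
prime over the ideal of the eight determinants that is contained in the ideal of `γ`. By Krull's
height theorem `P` has height at most `8`, so the function field of the zero set of `P` has
transcendence degree at least `24 - 8 = 16` (`MvPolynomial.card_le_of_mem_minimalPrimes`). The eight
points with generic coordinates over this field satisfy the same eight incidences, and an analysis of
the possible coincidences among them (`SatMacLane.classify`) shows that either they lie in the image
of one of the polynomial maps over this field, or their coordinates are generated by at most `15`
elements, which is impossible. In the former case every polynomial that vanishes on the image over
`ℂ` lies in `P`, hence vanishes at `γ` (`mem_closure_image_of_genericConfig`), so that `γ` lies in the
closure of the image.

That no closure contains another mostly follows from the matroids: if a realization of `N` lies in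
the circuit variety of `N'`, then independent sets of `N` are independent in `N'`
(`indep_of_mem_circuitVariety`). The remaining cases are settled by explicit polynomials. The two
parts of the matroid variety of the MacLane matroid have different cross ratios
(`crossRatioDen_map`), and relations of the form `x ^ 2 ± x y + y ^ 2 = 0`, with `x` and `y` products
of determinants, hold on both of them but fail on `U_{2,8}`, `M(i)` and `B_k`. The
concurrence of the three lines through a point persists when the antipodal point moves to the
origin, but not when the point itself does; this separates `D_i` from the `M(b)` with `b` a loop of
`D_i`, and from the MacLane matroid (`concurrent_of_satMacLane`).
-/

/-! ### The Zariski topology -/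

theorem evalAt_mul {n d : ℕ} (γ : VecConfig n d) (p q : MvPolynomial (Fin d × Fin n) ℂ) :
    evalAt γ (p * q) = evalAt γ p * evalAt γ q := by
  simp [evalAt]

theorem isTopologicalBasis_zariski (n d : ℕ) :
    TopologicalSpace.IsTopologicalBasis (Set.range fun p : MvPolynomial (Fin d × Fin n) ℂ =>
      {γ : VecConfig n d | evalAt γ p ≠ 0}) where
  exists_subset_inter := by
    rintro _ ⟨p, rfl⟩ _ ⟨q, rfl⟩ γ hγ
    refine ⟨_, ⟨p * q, rfl⟩, ?_, ?_⟩
    · simpa [evalAt_mul] using hγ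
    · intro δ hδ
      simpa [evalAt_mul] using hδ
  sUnion_eq := by
    refine Set.eq_univ_of_forall fun γ => ⟨_, ⟨1, rfl⟩, ?_⟩
    simp [evalAt]
  eq_generateFrom := rfl

theorem mem_closure_iff_evalAt {n d : ℕ} {R : Set (VecConfig n d)} {γ : VecConfig n d} :
    γ ∈ closure R ↔ ∀ p, (∀ δ ∈ R, evalAt δ p = 0) → evalAt γ p = 0 := by
  rw [(isTopologicalBasis_zariski n d).mem_closure_iff]
  constructor
  · intro h p hp
    by_contra hne
    obtain ⟨δ, hδ, hδR⟩ := h _ ⟨p, rfl⟩ hne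
    exact hδ (hp δ hδR)
  · rintro h _ ⟨p, rfl⟩ hγ
    by_contra hempty
    refine hγ (h p fun δ hδ => ?_)
    by_contra hne
    exact hempty ⟨δ, hne, hδ⟩

/-- Functions on the affine space of configurations that are given by a polynomial. -/
def IsPolyFun {n d : ℕ} (F : VecConfig n d → ℂ) : Prop := ∃ p, ∀ γ, evalAt γ p = F γ

namespace IsPolyFun

variable {n d : ℕ} {F G : VecConfig n d → ℂ}

theorem coord (i : Fin d) (j : Fin n) : IsPolyFun fun γ : VecConfig n d => γ i j :=
  ⟨MvPolynomial.X (i, j), fun γ => by simp [evalAt]⟩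

theorem const (c : ℂ) : IsPolyFun fun _ : VecConfig n d => c :=
  ⟨MvPolynomial.C c, fun γ => by simp [evalAt]⟩

theorem add (hF : IsPolyFun F) (hG : IsPolyFun G) : IsPolyFun fun γ => F γ + G γ := by
  obtain ⟨p, hp⟩ := hF
  obtain ⟨q, hq⟩ := hG
  exact ⟨p + q, fun γ => by simp only [← hp, ← hq]; simp [evalAt]⟩

theorem mul (hF : IsPolyFun F) (hG : IsPolyFun G) : IsPolyFun fun γ => F γ * G γ := by
  obtain ⟨p, hp⟩ := hF
  obtain ⟨q, hq⟩ := hG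
  exact ⟨p * q, fun γ => by simp only [← hp, ← hq, evalAt_mul]⟩

theorem sub (hF : IsPolyFun F) (hG : IsPolyFun G) : IsPolyFun fun γ => F γ - G γ := by
  obtain ⟨p, hp⟩ := hF
  obtain ⟨q, hq⟩ := hG
  exact ⟨p - q, fun γ => by simp only [← hp, ← hq]; simp [evalAt]⟩

theorem sum {ι : Type*} (s : Finset ι) {F : ι → VecConfig n d → ℂ} (hF : ∀ i, IsPolyFun (F i)) :
    IsPolyFun fun γ => ∑ i ∈ s, F i γ := by
  choose p hp using hF
  exact ⟨∑ i ∈ s, p i, fun γ => by simp only [← hp]; simp [evalAt]⟩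

theorem prod {ι : Type*} (s : Finset ι) {F : ι → VecConfig n d → ℂ} (hF : ∀ i, IsPolyFun (F i)) :
    IsPolyFun fun γ => ∏ i ∈ s, F i γ := by
  choose p hp using hF
  exact ⟨∏ i ∈ s, p i, fun γ => by simp only [← hp]; simp [evalAt]⟩

theorem det {ι : Type*} [Fintype ι] [DecidableEq ι] {M : VecConfig n d → Matrix ι ι ℂ}
    (hM : ∀ i j, IsPolyFun fun γ => M γ i j) : IsPolyFun fun γ => (M γ).det := by
  simp only [Matrix.det_apply']
  exact sum _ fun σ => (const _).mul (prod _ fun i => hM _ _)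

theorem isOpen_ne (hF : IsPolyFun F) : IsOpen {γ | F γ ≠ 0} := by
  obtain ⟨p, hp⟩ := hF
  simp only [← hp]
  exact TopologicalSpace.isOpen_generateFrom_of_mem ⟨p, rfl⟩

theorem isClosed_eq (hF : IsPolyFun F) : IsClosed {γ | F γ = 0} := by
  rw [← isOpen_compl_iff]
  exact hF.isOpen_ne

end IsPolyFun

/-- A family of vectors is linearly independent if and only if some linear map sends it to a
family of the right dimension with nonzero determinant; for a fixed linear map this is a polynomial
condition. -/
theorem isOpen_linearIndepOn {n d : ℕ} (S : Set (Fin d)) :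
    IsOpen {γ : VecConfig n d | LinearIndepOn ℂ (γ : Fin d → Fin n → ℂ) S} := by
  classical
  have key : {γ : VecConfig n d | LinearIndepOn ℂ (γ : Fin d → Fin n → ℂ) S} =
      ⋃ B : Matrix (Fin n) S ℂ,
        {γ | (Matrix.of fun i j : S => ∑ k, γ i k * B k j).det ≠ 0} := by
    ext γ
    simp only [Set.mem_ofPred_eq, Set.mem_iUnion]
    have hrw : ∀ B : Matrix (Fin n) S ℂ, (Matrix.of fun i j : S => ∑ k, γ i k * B k j) =
        (Matrix.of fun (i : S) (k : Fin n) => γ i k) * B := fun B => by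
      ext i j; simp [Matrix.mul_apply]
    simp only [hrw]
    constructor
    · intro h
      have h' : LinearIndependent ℂ (fun i : S => (γ : Fin d → Fin n → ℂ) i) := h
      obtain ⟨g, hg⟩ := (Fintype.linearCombination ℂ (fun i : S =>
        (γ : Fin d → Fin n → ℂ) i)).exists_leftInverse_of_injective
          (LinearMap.ker_eq_bot.2 h'.fintypeLinearCombination_injective)
      refine ⟨(LinearMap.toMatrix' g).transpose, ?_⟩
      have h1 : (Matrix.of fun (i : S) (k : Fin n) => γ i k) * (LinearMap.toMatrix' g).transpose
          = 1 := by
        ext i j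
        have h2 : g ((γ : Fin d → Fin n → ℂ) i) = Pi.single i 1 := by
          have := LinearMap.congr_fun hg (Pi.single i 1)
          simpa using this
        have h3 : (LinearMap.toMatrix' g).mulVec ((γ : Fin d → Fin n → ℂ) i) j =
            (1 : Matrix S S ℂ) i j := by
          rw [LinearMap.toMatrix'_mulVec, h2, Matrix.one_apply, Pi.single_apply]
          simp only [eq_comm]
        rw [← h3]
        simp [Matrix.mul_apply, Matrix.mulVec, dotProduct, mul_comm]
      rw [h1]
      simp
    · rintro ⟨B, hB⟩
      have h1 : LinearIndependent ℂ ((Matrix.of fun (i : S) (k : Fin n) => γ i k) * B).row :=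
        Matrix.linearIndependent_rows_of_det_ne_zero hB
      have h2 : ((Matrix.of fun (i : S) (k : Fin n) => γ i k) * B).row =
          B.vecMulLinear ∘ (fun i : S => (γ : Fin d → Fin n → ℂ) i) := by
        ext i j
        simp [Matrix.mul_apply, Matrix.vecMul, dotProduct]
      rw [h2] at h1
      exact h1.of_comp
  rw [key]
  refine isOpen_iUnion fun B => IsPolyFun.isOpen_ne (IsPolyFun.det fun i j => ?_)
  exact IsPolyFun.sum Finset.univ fun k => (IsPolyFun.coord i.1 k).mul (IsPolyFun.const (B k j))

theorem isClosed_circuitVariety (n : ℕ) {d : ℕ} (N : Matroid (Fin d)) :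
    IsClosed (circuitVariety n N) := by
  have : circuitVariety n N = ⋂ (S : Set (Fin d)) (_ : N.Dep S), {γ | LinDep γ S} := by
    ext γ; simp [circuitVariety]
  rw [this]
  refine isClosed_iInter fun S => isClosed_iInter fun _ => ?_
  rw [← isOpen_compl_iff]
  simpa [LinDep, Set.compl_ofPred] using isOpen_linearIndepOn S

/-- The configurations in which all independent sets of `N` are linearly independent. -/
def independenceLocus (n : ℕ) {d : ℕ} (N : Matroid (Fin d)) : Set (VecConfig n d) :=
  {γ | ∀ S : Set (Fin d), N.Indep S → LinearIndepOn ℂ (γ : Fin d → Fin n → ℂ) S}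

theorem isOpen_independenceLocus (n : ℕ) {d : ℕ} (N : Matroid (Fin d)) :
    IsOpen (independenceLocus n N) := by
  have : independenceLocus n N = ⋂ (S : Set (Fin d)) (_ : N.Indep S),
      {γ : VecConfig n d | LinearIndepOn ℂ (γ : Fin d → Fin n → ℂ) S} := by
    ext γ; simp [independenceLocus]
  rw [this]
  exact isOpen_iInter_of_finite fun S => isOpen_iInter_of_finite fun _ => isOpen_linearIndepOn S

theorem realizationSpace_eq_inter (n : ℕ) {d : ℕ} {N : Matroid (Fin d)} (hN : N.E = Set.univ) :
    realizationSpace n N = circuitVariety n N ∩ independenceLocus n N := by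
  ext γ
  have hdep : ∀ S, N.Dep S ↔ ¬ N.Indep S := fun S => by
    rw [Matroid.Dep, hN]
    exact and_iff_left (Set.subset_univ S)
  simp only [realizationSpace, circuitVariety, independenceLocus, Set.mem_inter_iff,
    Set.mem_ofPred_eq, LinDep, hdep]
  constructor
  · exact fun h => ⟨fun S hS => (h S).2 hS, fun S hS => not_not.1 fun h' => (h S).1 h' hS⟩
  · exact fun h S => ⟨fun h1 h2 => h1 (h.2 S h2), h.1 S⟩

/-! ### Images of polynomial maps -/

/-- A polynomial map from an affine space to the space of configurations, as a rule that makes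
sense over every `ℂ`-algebra. The parameters are a family of vectors indexed by `α` and a family of
scalars indexed by `β`. -/
structure PolyParam (n d : ℕ) (α β : Type) where
  /-- The configuration with given parameters. -/
  map : ∀ (A : Type) [CommRing A] [Algebra ℂ A],
    (α → Fin n → A) → (β → A) → Fin d → Fin n → A
  natural : ∀ {A B : Type} [CommRing A] [CommRing B] [Algebra ℂ A] [Algebra ℂ B] (f : A →ₐ[ℂ] B)
    (v : α → Fin n → A) (s : β → A) (i : Fin d) (j : Fin n),
    f (map A v s i j) = map B (fun a k => f (v a k)) (fun b => f (s b)) i j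

namespace PolyParam

variable {n d : ℕ} {α β : Type} (φ : PolyParam n d α β)

/-- The configurations over `A` in the image of a polynomial map. -/
def range (A : Type) [CommRing A] [Algebra ℂ A] : Set (Fin d → Fin n → A) :=
  {γ | ∃ v s, γ = φ.map A v s}

/-- The image of a polynomial map in the affine space of configurations. -/
def image : Set (VecConfig n d) := φ.range ℂ

/-- The pullback of a polynomial function along a polynomial map. -/
noncomputable def pullback (p : MvPolynomial (Fin d × Fin n) ℂ) :
    MvPolynomial ((α × Fin n) ⊕ β) ℂ :=
  MvPolynomial.aeval (fun ij => φ.map (MvPolynomial ((α × Fin n) ⊕ β) ℂ)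
    (fun a k => MvPolynomial.X (Sum.inl (a, k))) (fun b => MvPolynomial.X (Sum.inr b))
    ij.1 ij.2) p

theorem aeval_pullback (p : MvPolynomial (Fin d × Fin n) ℂ) {A : Type} [CommRing A] [Algebra ℂ A]
    (x : (α × Fin n) ⊕ β → A) :
    MvPolynomial.aeval x (φ.pullback p) = MvPolynomial.aeval (fun ij => φ.map A
      (fun a k => x (Sum.inl (a, k))) (fun b => x (Sum.inr b)) ij.1 ij.2) p := by
  rw [pullback, ← AlgHom.comp_apply, MvPolynomial.comp_aeval]
  congr 2
  funext ij
  rw [φ.natural]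
  simp

theorem forall_evalAt_eq_zero_iff (p : MvPolynomial (Fin d × Fin n) ℂ) :
    (∀ γ ∈ φ.image, evalAt γ p = 0) ↔ φ.pullback p = 0 := by
  constructor
  · intro h
    refine MvPolynomial.funext fun x => ?_
    have := φ.aeval_pullback p x
    rw [MvPolynomial.aeval_eq_eval] at this
    rw [map_zero]
    change MvPolynomial.eval x _ = _ at this
    rw [this]
    exact h _ ⟨_, _, rfl⟩
  · rintro h _ ⟨v, s, rfl⟩
    have := φ.aeval_pullback p (Sum.elim (fun a => v a.1 a.2) s)
    rw [h, map_zero] at this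
    exact this.symm

/-- A polynomial that vanishes on the image of a polynomial map over `ℂ` vanishes on its image
over every `ℂ`-algebra. -/
theorem aeval_eq_zero_of_mem_range {p : MvPolynomial (Fin d × Fin n) ℂ}
    (hp : ∀ γ ∈ φ.image, evalAt γ p = 0) {A : Type} [CommRing A] [Algebra ℂ A]
    {γ : Fin d → Fin n → A} (hγ : γ ∈ φ.range A) :
    MvPolynomial.aeval (fun ij => γ ij.1 ij.2) p = 0 := by
  obtain ⟨v, s, rfl⟩ := hγ
  have := φ.aeval_pullback p (Sum.elim (fun a => v a.1 a.2) s)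
  rw [(φ.forall_evalAt_eq_zero_iff p).1 hp, map_zero] at this
  exact this.symm

theorem isIrreducible_image : IsIrreducible φ.image := by
  refine ⟨⟨_, 0, 0, rfl⟩, ?_⟩
  rintro U V hU hV ⟨γ, hγ, hγU⟩ ⟨δ, hδ, hδV⟩
  obtain ⟨_, ⟨p, rfl⟩, hγp, hpU⟩ := (isTopologicalBasis_zariski n d).exists_subset_of_mem_open hγU hU
  obtain ⟨_, ⟨q, rfl⟩, hδq, hqV⟩ := (isTopologicalBasis_zariski n d).exists_subset_of_mem_open hδV hV
  have hp : φ.pullback p ≠ 0 := fun h => hγp ((φ.forall_evalAt_eq_zero_iff p).2 h γ hγ)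
  have hq : φ.pullback q ≠ 0 := fun h => hδq ((φ.forall_evalAt_eq_zero_iff q).2 h δ hδ)
  have hpq : φ.pullback (p * q) ≠ 0 := by
    rw [pullback, map_mul]
    exact mul_ne_zero hp hq
  rw [Ne, ← φ.forall_evalAt_eq_zero_iff] at hpq
  push Not at hpq
  obtain ⟨ε, hε, hne⟩ := hpq
  rw [evalAt_mul] at hne
  exact ⟨ε, hε, hpU (left_ne_zero_of_mul hne), hqV (right_ne_zero_of_mul hne)⟩

end PolyParam

theorem IsPreirreducible.subset_closure_inter {T : Type*} [TopologicalSpace T] {S O : Set T}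
    (hS : IsPreirreducible S) (hO : IsOpen O) (hne : (S ∩ O).Nonempty) : S ⊆ closure (S ∩ O) := by
  intro x hx
  rw [mem_closure_iff]
  intro U hU hxU
  obtain ⟨y, hyS, hyU, hyO⟩ := hS U O hU hO ⟨x, hx, hxU⟩ hne
  exact ⟨y, hyU, hyS, hyO⟩

/-- If a polynomial map takes values in the circuit variety of `N` and some value realizes `N`,
then the closure of its image lies in the matroid variety of `N`. -/
theorem PolyParam.closure_image_subset_matroidVariety {n d : ℕ} {α β : Type}
    (φ : PolyParam n d α β) {N : Matroid (Fin d)} (hN : N.E = Set.univ)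
    (hφ : φ.image ⊆ circuitVariety n N) (hne : (φ.image ∩ independenceLocus n N).Nonempty) :
    closure φ.image ⊆ matroidVariety n N := by
  refine closure_minimal ((φ.isIrreducible_image.2.subset_closure_inter
    (isOpen_independenceLocus n N) hne).trans (closure_mono ?_)) isClosed_closure
  rw [realizationSpace_eq_inter n hN]
  exact Set.inter_subset_inter_left _ hφ

/-- The irreducible components of a finite union of irreducible closed sets none of which
contains another. -/
theorem irredComponentsOf_iUnion {T J : Type*} [TopologicalSpace T] [Finite J] (W : J → Set T)
    (hirr : ∀ j, IsIrreducible (W j)) (hcl : ∀ j, IsClosed (W j))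
    (hW : ∀ i j, W i ⊆ W j → i = j) : irredComponentsOf (⋃ j, W j) = Set.range W := by
  have hmem : ∀ Z : Set T, IsIrreducible Z → Z ⊆ ⋃ j, W j → ∃ j, Z ⊆ W j := by
    intro Z hZ hsub
    have hfin : (Set.range W).Finite := Set.finite_range W
    obtain ⟨z, hz, hZz⟩ := isIrreducible_iff_sUnion_isClosed.1 hZ hfin.toFinset (by simpa using hcl)
      (by simpa [Set.sUnion_range] using hsub)
    simp only [Set.Finite.mem_toFinset, Set.mem_range] at hz
    obtain ⟨j, rfl⟩ := hz
    exact ⟨j, hZz⟩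
  ext Z
  constructor
  · rintro ⟨⟨hZ, hsub⟩, hmax⟩
    obtain ⟨j, hj⟩ := hmem Z hZ hsub
    exact ⟨j, (hmax ⟨hirr j, Set.subset_iUnion W j⟩ hj).antisymm hj⟩
  · rintro ⟨j, rfl⟩
    refine ⟨⟨hirr j, Set.subset_iUnion W j⟩, fun Y hY hjY => ?_⟩
    obtain ⟨k, hk⟩ := hmem Y hY.1 hY.2
    have := hW j k (hjY.trans hk)
    subst this
    exact hk

/-! ### Transcendence degree and height in polynomial rings -/

/-- Passing from a prime `p` of `S` to a prime `P` of `S[X]` above it raises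
`height + transcendence degree of the residue ring` by at least one: if `P = p S[X]` the residue
ring gains a variable, and otherwise the height goes up by going-down. -/
theorem Polynomial.height_add_trdeg_succ_le {k S : Type} [Field k] [CommRing S] [IsNoetherianRing S]
    [Algebra k S] (P : Ideal (Polynomial S)) [P.IsPrime] (p : Ideal S) [p.IsPrime] [P.LiesOver p] :
    p.height + Cardinal.toENat (Algebra.trdeg k (S ⧸ p)) + 1 ≤
      P.height + Cardinal.toENat (Algebra.trdeg k (Polynomial S ⧸ P)) := by
  have htower : IsScalarTower k (S ⧸ p) (Polynomial S ⧸ P) := by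
    refine IsScalarTower.of_algebraMap_eq fun x => ?_
    rfl
  have hadd := trdeg_add_le (R := k) (S := S ⧸ p) (A := Polynomial S ⧸ P)
  have hht := Ideal.height_eq_height_add_of_liesOver_of_hasGoingDown p P
  by_cases hP : P = p.map Polynomial.C
  · have htr : Transcendental (S ⧸ p) (Ideal.Quotient.mk P Polynomial.X) := by
      rw [transcendental_iff]
      intro f hf
      obtain ⟨g, rfl⟩ := Polynomial.map_surjective (Ideal.Quotient.mk p)
        Ideal.Quotient.mk_surjective f
      have hg : Ideal.Quotient.mk P g = 0 := by
        rw [← hf, Polynomial.aeval_def, Polynomial.eval₂_map]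
        have : ((algebraMap (S ⧸ p) (Polynomial S ⧸ P)).comp (Ideal.Quotient.mk p)) =
            (Ideal.Quotient.mk P).comp Polynomial.C := by
          ext x; rfl
        rw [this, ← Polynomial.hom_eval₂, Polynomial.eval₂_C_X]
      rw [Ideal.Quotient.eq_zero_iff_mem, hP, Ideal.mem_map_C_iff] at hg
      ext n
      simpa [Polynomial.coeff_map] using Ideal.Quotient.eq_zero_iff_mem.2 (hg n)
    have hT : Algebra.Transcendental (S ⧸ p) (Polynomial S ⧸ P) := ⟨_, htr⟩
    have hpos : 1 ≤ Algebra.trdeg (S ⧸ p) (Polynomial S ⧸ P) :=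
      Cardinal.one_le_iff_pos.2 (trdeg_pos _ _)
    have h1 : Algebra.trdeg k (S ⧸ p) + 1 ≤ Algebra.trdeg k (Polynomial S ⧸ P) :=
      (add_le_add_right hpos _).trans hadd
    have h2 := Cardinal.toENat.monotone' h1
    have h3 : p.height ≤ P.height := hht ▸ le_self_add
    rw [add_assoc]
    exact add_le_add h3 (by simpa [Cardinal.toENat] using h2)
  · have hne : P.map (Ideal.Quotient.mk (p.map (algebraMap S (Polynomial S)))) ≠ ⊥ := by
      intro h
      apply hP
      rw [Ideal.map_eq_bot_iff_le_ker, Ideal.mk_ker] at h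
      refine le_antisymm h ?_
      rw [Ideal.map_le_iff_le_comap]
      exact (Ideal.LiesOver.over (P := P) (p := p)).le
    have hdom : (p.map (algebraMap S (Polynomial S))).IsPrime :=
      Ideal.isPrime_map_C_of_isPrime
    have h1 : 1 ≤ (P.map (Ideal.Quotient.mk (p.map (algebraMap S (Polynomial S))))).height := by
      rw [Order.one_le_iff_ne_zero, Ne, Ideal.height_eq_zero_iff_eq_bot]
      exact hne
    have h2 : Algebra.trdeg k (S ⧸ p) ≤ Algebra.trdeg k (Polynomial S ⧸ P) :=
      le_self_add.trans hadd
    have h3 := Cardinal.toENat.monotone' h2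
    calc p.height + Cardinal.toENat (Algebra.trdeg k (S ⧸ p)) + 1
        = (p.height + 1) + Cardinal.toENat (Algebra.trdeg k (S ⧸ p)) := by ring
      _ ≤ P.height + Cardinal.toENat (Algebra.trdeg k (Polynomial S ⧸ P)) := by
          rw [hht]
          exact add_le_add (add_le_add_right h1 _) (by simpa using h3)

/-- The half of the dimension formula for affine space that bounds the dimension of a variety from
below by its codimension. -/
theorem MvPolynomial.card_le_height_add_trdeg {k : Type} [Field k] {ι : Type} [Finite ι]
    (P : Ideal (MvPolynomial ι k)) [P.IsPrime] :
    (Nat.card ι : ℕ∞) ≤ P.height + Cardinal.toENat (Algebra.trdeg k (MvPolynomial ι k ⧸ P)) := by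
  induction ι using Finite.induction_empty_option with
  | of_equiv e H =>
    let E := MvPolynomial.renameEquiv k e
    have h := H (P.comap E.toRingEquiv)
    rw [RingEquiv.height_comap, Nat.card_congr e] at h
    have hEq : Algebra.trdeg k (MvPolynomial _ k ⧸ P.comap E.toRingEquiv) =
        Algebra.trdeg k (MvPolynomial _ k ⧸ P) :=
      (Ideal.quotientEquivAlg (P.comap E.toRingEquiv) P E
        (Ideal.map_comap_of_surjective E.toRingEquiv E.surjective P).symm).trdeg_eq
    rwa [hEq] at h
  | h_empty => simp
  | @h_option ι _ IH =>
    let E := MvPolynomial.optionEquivLeft k ι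
    let Q : Ideal (Polynomial (MvPolynomial ι k)) := P.comap E.symm.toRingEquiv
    let q : Ideal (MvPolynomial ι k) := Q.comap Polynomial.C
    have hq : Q.LiesOver q := ⟨rfl⟩
    have h := IH q
    have h2 := Polynomial.height_add_trdeg_succ_le (k := k) Q q
    have hEq : Algebra.trdeg k (Polynomial (MvPolynomial ι k) ⧸ Q) =
        Algebra.trdeg k (MvPolynomial _ k ⧸ P) :=
      (Ideal.quotientEquivAlg Q P E.symm
        (Ideal.map_comap_of_surjective E.symm.toRingEquiv E.symm.surjective P).symm).trdeg_eq
    rw [hEq, RingEquiv.height_comap] at h2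
    refine le_trans ?_ h2
    rw [Nat.card_eq_fintype_card, Fintype.card_option, ← Nat.card_eq_fintype_card, Nat.cast_add,
      Nat.cast_one]
    exact add_le_add_left h 1

/-- The function field of a component of a variety cut out by `r` equations in affine `N`-space
is not generated by fewer than `N - r` elements. -/
theorem MvPolynomial.card_le_of_mem_minimalPrimes {k : Type} [Field k] {ι : Type} [Finite ι]
    {I P : Ideal (MvPolynomial ι k)} [P.IsPrime] (hP : P ∈ I.minimalPrimes)
    (s : Finset (MvPolynomial ι k)) (hI : I = Ideal.span s)
    (T : Finset (FractionRing (MvPolynomial ι k ⧸ P)))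
    (hT : ∀ i, algebraMap (MvPolynomial ι k ⧸ P) (FractionRing (MvPolynomial ι k ⧸ P))
      (Ideal.Quotient.mk P (X i)) ∈ IntermediateField.adjoin k (T : Set _)) :
    Nat.card ι ≤ s.card + T.card := by
  let A := MvPolynomial ι k ⧸ P
  let K := FractionRing A
  have h1 := MvPolynomial.card_le_height_add_trdeg P
  have h2 : P.height ≤ s.card :=
    Ideal.height_le_card_of_mem_minimalPrimes_span_finset (hI ▸ hP)
  have h3 : Algebra.trdeg k A ≤ Algebra.trdeg k K :=
    trdeg_le_of_injective (IsScalarTower.toAlgHom k A K) (IsFractionRing.injective A K)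
  have hmem : ∀ a : A, algebraMap A K a ∈ IntermediateField.adjoin k (T : Set K) := by
    intro a
    obtain ⟨q, rfl⟩ := Ideal.Quotient.mk_surjective a
    induction q using MvPolynomial.induction_on with
    | C c => exact (IntermediateField.adjoin k (T : Set K)).algebraMap_mem c
    | add p q hp hq => rw [map_add, map_add]; exact add_mem hp hq
    | mul_X p i hp => rw [map_mul, map_mul]; exact mul_mem hp (hT i)
  have hall : ∀ x : K, x ∈ IntermediateField.adjoin k (T : Set K) := by
    intro x
    obtain ⟨a, b, _, rfl⟩ := IsFractionRing.div_surjective (A := A) x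
    exact div_mem (hmem a) (hmem b)
  have halg : Algebra.IsAlgebraic (Algebra.adjoin k (T : Set K)) K := by
    refine ⟨fun x => ?_⟩
    obtain ⟨r, hr, t, ht, rfl⟩ := IntermediateField.mem_adjoin_iff_div.1 (hall x)
    rw [div_eq_mul_inv]
    exact (isAlgebraic_algebraMap (⟨r, hr⟩ : Algebra.adjoin k (T : Set K))).mul
      (isAlgebraic_algebraMap (⟨t, ht⟩ : Algebra.adjoin k (T : Set K))).inv
  have h4 : Algebra.trdeg k K ≤ T.card :=
    (Algebra.IsAlgebraic.trdeg_le_cardinalMk k (A := K) (T : Set K)).trans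
      (Cardinal.mk_coe_finset (s := T)).le
  have h5 := Cardinal.toENat.monotone' (h3.trans h4)
  have h6 : (Nat.card ι : ℕ∞) ≤ (s.card : ℕ∞) + T.card :=
    h1.trans (add_le_add h2 (by simpa using h5))
  exact_mod_cast h6

open Matrix

/-! ### Linear algebra in three-space -/

/-- The determinant of three vectors of three-space. -/
def det3 {A : Type*} [CommRing A] (u v w : Fin 3 → A) : A := u ⬝ᵥ (v ⨯₃ w)

section ThreeSpace

variable {K : Type*} [Field K] {a b c d n u v w : Fin 3 → K}

theorem det3_apply {A : Type*} [CommRing A] (u v w : Fin 3 → A) : det3 u v w =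
    u 0 * (v 1 * w 2 - v 2 * w 1) + u 1 * (v 2 * w 0 - v 0 * w 2)
      + u 2 * (v 0 * w 1 - v 1 * w 0) := by
  simp [det3, cross_apply, dotProduct, Fin.sum_univ_three]

theorem det3_rotate {A : Type*} [CommRing A] (u v w : Fin 3 → A) : det3 u v w = det3 v w u := by
  simp only [det3_apply]; ring

theorem cross_eq_zero_comm : u ⨯₃ v = 0 ↔ v ⨯₃ u = 0 := by
  rw [← cross_anticomm, neg_eq_zero]

theorem vec3_ne_zero_iff : u ≠ 0 ↔ u 0 ≠ 0 ∨ u 1 ≠ 0 ∨ u 2 ≠ 0 := by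
  rw [Ne, funext_iff, Fin.forall_fin_succ, Fin.forall_fin_two]
  simp only [Pi.zero_apply, not_and_or]
  rfl

theorem cross_eq_zero_iff : u ⨯₃ v = 0 ↔
    u 1 * v 2 - u 2 * v 1 = 0 ∧ u 2 * v 0 - u 0 * v 2 = 0 ∧ u 0 * v 1 - u 1 * v 0 = 0 := by
  simp [cross_apply]

theorem exists_eq_smul_of_cross_eq_zero (hu : u ≠ 0) (h : u ⨯₃ v = 0) : ∃ c : K, v = c • u := by
  obtain ⟨h0, h1, h2⟩ := cross_eq_zero_iff.1 h
  rcases vec3_ne_zero_iff.1 hu with hk | hk | hk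
  · refine ⟨v 0 / u 0, ?_⟩
    ext i; fin_cases i <;> simp <;> field_simp
    · linear_combination h2
    · linear_combination -h1
  · refine ⟨v 1 / u 1, ?_⟩
    ext i; fin_cases i <;> simp <;> field_simp
    · linear_combination -h2
    · linear_combination h0
  · refine ⟨v 2 / u 2, ?_⟩
    ext i; fin_cases i <;> simp <;> field_simp
    · linear_combination h1
    · linear_combination -h0

theorem cross_eq_zero_trans (hu : u ≠ 0) (h1 : u ⨯₃ v = 0) (h2 : u ⨯₃ w = 0) : v ⨯₃ w = 0 := by
  obtain ⟨c, rfl⟩ := exists_eq_smul_of_cross_eq_zero hu h1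
  obtain ⟨d, rfl⟩ := exists_eq_smul_of_cross_eq_zero hu h2
  simp

/-- Cramer's rule in the plane spanned by `u` and `v`. -/
theorem exists_eq_add_of_det3_eq_zero (h : u ⨯₃ v ≠ 0) (hd : det3 u v w = 0) :
    ∃ s t : K, w = s • u + t • v := by
  rw [det3_apply] at hd
  rw [Ne, cross_eq_zero_iff] at h
  simp only [not_and_or] at h
  rcases h with h | h | h
  · obtain ⟨D, hD⟩ : ∃ D, D = u 1 * v 2 - u 2 * v 1 := ⟨_, rfl⟩
    rw [← hD] at h
    refine ⟨(w 1 * v 2 - w 2 * v 1) / D, (u 1 * w 2 - u 2 * w 1) / D, ?_⟩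
    ext i; fin_cases i <;> simp <;> field_simp
    · linear_combination w 0 * hD + hd
    · linear_combination w 1 * hD
    · linear_combination w 2 * hD
  · obtain ⟨D, hD⟩ : ∃ D, D = u 2 * v 0 - u 0 * v 2 := ⟨_, rfl⟩
    rw [← hD] at h
    refine ⟨(w 2 * v 0 - w 0 * v 2) / D, (u 2 * w 0 - u 0 * w 2) / D, ?_⟩
    ext i; fin_cases i <;> simp <;> field_simp
    · linear_combination w 0 * hD
    · linear_combination w 1 * hD + hd
    · linear_combination w 2 * hD
  · obtain ⟨D, hD⟩ : ∃ D, D = u 0 * v 1 - u 1 * v 0 := ⟨_, rfl⟩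
    rw [← hD] at h
    refine ⟨(w 0 * v 1 - w 1 * v 0) / D, (u 0 * w 1 - u 1 * w 0) / D, ?_⟩
    ext i; fin_cases i <;> simp <;> field_simp
    · linear_combination w 0 * hD
    · linear_combination w 1 * hD
    · linear_combination w 2 * hD + hd

/-- Two different planes meet in the line spanned by the vector product of their normals. -/
theorem exists_eq_smul_cross (h : (a ⨯₃ b) ⨯₃ (c ⨯₃ d) ≠ 0) (h1 : det3 a b w = 0)
    (h2 : det3 c d w = 0) : ∃ r : K, w = r • ((a ⨯₃ b) ⨯₃ (c ⨯₃ d)) := by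
  refine exists_eq_smul_of_cross_eq_zero h ?_
  rw [det3_rotate, det3_rotate, det3] at h1 h2
  have key : ∀ n m : Fin 3 → K, w ⬝ᵥ n = 0 → w ⬝ᵥ m = 0 → (n ⨯₃ m) ⨯₃ w = 0 := by
    intro n m hn hm
    simp only [dotProduct, Fin.sum_univ_three] at hn hm
    rw [cross_eq_zero_iff]
    simp only [cross_apply]
    simp only [Matrix.cons_val]
    refine ⟨?_, ?_, ?_⟩
    · linear_combination m 0 * hn - n 0 * hm
    · linear_combination m 1 * hn - n 1 * hm
    · linear_combination m 2 * hn - n 2 * hm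
  exact key _ _ h1 h2

theorem dotProduct_eq_zero_of_det3 (ha : n ⬝ᵥ a = 0) (hb : n ⬝ᵥ b = 0) (h : a ⨯₃ b ≠ 0)
    (hd : det3 a b c = 0) : n ⬝ᵥ c = 0 := by
  obtain ⟨s, t, rfl⟩ := exists_eq_add_of_det3_eq_zero h hd
  simp [ha, hb]

theorem dotProduct_eq_zero_of_cross (hu : u ≠ 0) (hn : n ⬝ᵥ u = 0) (h : u ⨯₃ v = 0) :
    n ⬝ᵥ v = 0 := by
  obtain ⟨c, rfl⟩ := exists_eq_smul_of_cross_eq_zero hu h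
  simp [hn]

/-- If `b` and `c` lie on a plane that misses `a`, then `a, b, c` can only be dependent when
`b` and `c` are parallel. -/
theorem cross_eq_zero_of_det3 (ha : n ⬝ᵥ a ≠ 0) (hb : n ⬝ᵥ b = 0) (hc : n ⬝ᵥ c = 0)
    (hd : det3 a b c = 0) : b ⨯₃ c = 0 := by
  by_contra h
  rw [det3_rotate] at hd
  exact ha (dotProduct_eq_zero_of_det3 hb hc h hd)

theorem dot_cross_left : (u ⨯₃ v) ⬝ᵥ u = 0 := by
  rw [dotProduct_comm]; exact dot_self_cross u v

theorem dot_cross_right : (u ⨯₃ v) ⬝ᵥ v = 0 := by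
  rw [dotProduct_comm]; exact dot_cross_self u v

theorem exists_span_of_normal (hn : n ≠ 0) :
    ∃ e f : Fin 3 → K, ∀ w, n ⬝ᵥ w = 0 → ∃ s t : K, w = s • e + t • f := by
  simp only [dotProduct, Fin.sum_univ_three]
  rcases vec3_ne_zero_iff.1 hn with hk | hk | hk
  · refine ⟨![-n 1 / n 0, 1, 0], ![-n 2 / n 0, 0, 1], fun w hw => ⟨w 1, w 2, ?_⟩⟩
    ext i; fin_cases i <;> simp
    field_simp
    linear_combination hw
  · refine ⟨![1, -n 0 / n 1, 0], ![0, -n 2 / n 1, 1], fun w hw => ⟨w 0, w 2, ?_⟩⟩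
    ext i; fin_cases i <;> simp
    field_simp
    linear_combination hw
  · refine ⟨![1, 0, -n 0 / n 2], ![0, 1, -n 1 / n 2], fun w hw => ⟨w 0, w 1, ?_⟩⟩
    ext i; fin_cases i <;> simp
    field_simp
    linear_combination hw

/-- Three dependent vectors lie on a plane through the origin. -/
theorem exists_normal_of_det3_eq_zero (h : det3 a b c = 0) :
    ∃ n : Fin 3 → K, n ≠ 0 ∧ n ⬝ᵥ a = 0 ∧ n ⬝ᵥ b = 0 ∧ n ⬝ᵥ c = 0 := by
  have hdet : (Matrix.of ![a, b, c]).det = 0 := by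
    rw [Matrix.det_fin_three]
    rw [det3_apply] at h
    simp only [Matrix.of_apply, Matrix.cons_val]
    linear_combination h
  obtain ⟨n, hn, hn0⟩ := Matrix.exists_mulVec_eq_zero_iff.2 hdet
  refine ⟨n, hn, ?_, ?_, ?_⟩
  · rw [dotProduct_comm]; exact congrFun hn0 0
  · rw [dotProduct_comm]; exact congrFun hn0 1
  · rw [dotProduct_comm]; exact congrFun hn0 2

end ThreeSpace

/-! ### Counting parameters of a configuration over an extension field -/

section GenBy

variable {K : Type} [Field K] [Algebra ℂ K] {γ : Fin 8 → Fin 3 → K} {s : Finset (Fin 8)} {n : ℕ}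
  {i j k l m : Fin 8}

/-- The coordinates of the vectors of `γ` indexed by `s` lie in an extension of `ℂ` that is
generated by at most `n` elements. -/
def GenBy (γ : Fin 8 → Fin 3 → K) (s : Finset (Fin 8)) (n : ℕ) : Prop :=
  ∃ T : Finset K, T.card ≤ n ∧ ∀ i ∈ s, ∀ j, γ i j ∈ IntermediateField.adjoin ℂ (T : Set K)

namespace GenBy

theorem empty (γ : Fin 8 → Fin 3 → K) : GenBy γ ∅ 0 := ⟨∅, by simp, by simp⟩

theorem step (h : GenBy γ s n) (U : Finset K) {m : ℕ} (hU : U.card ≤ m)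
    (hi : ∀ F : IntermediateField ℂ K, (∀ i ∈ s, ∀ j, γ i j ∈ F) → (∀ x ∈ U, x ∈ F) →
      ∀ j, γ i j ∈ F) : GenBy γ (insert i s) (n + m) := by
  classical
  obtain ⟨T, hT, hs⟩ := h
  have hsub : IntermediateField.adjoin ℂ (T : Set K) ≤
      IntermediateField.adjoin ℂ ((T ∪ U : Finset K) : Set K) :=
    IntermediateField.adjoin.mono _ _ _ (by simp)
  have hs' : ∀ i ∈ s, ∀ j, γ i j ∈ IntermediateField.adjoin ℂ ((T ∪ U : Finset K) : Set K) :=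
    fun i hi j => hsub (hs i hi j)
  refine ⟨T ∪ U, (Finset.card_union_le _ _).trans (by omega), fun i' hi' => ?_⟩
  rcases Finset.mem_insert.1 hi' with rfl | hi'
  · exact hi _ hs' fun x hx => IntermediateField.subset_adjoin _ _ (by simp [hx])
  · exact hs' i' hi'

theorem free (h : GenBy γ s n) (i : Fin 8) : GenBy γ (insert i s) (n + 3) := by
  classical
  refine h.step (Finset.univ.image (γ i)) (Finset.card_image_le.trans (by simp)) ?_
  exact fun F _ hU j => hU _ (by simp)

theorem zero (h : GenBy γ s n) (hi : γ i = 0) : GenBy γ (insert i s) n := by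
  refine h.step (m := 0) ∅ (by simp) fun F _ _ j => ?_
  rw [hi]; exact F.zero_mem

theorem par (h : GenBy γ s n) (hj : j ∈ s) (hj0 : γ j ≠ 0) (hc : γ j ⨯₃ γ i = 0) :
    GenBy γ (insert i s) (n + 1) := by
  obtain ⟨c, hc⟩ := exists_eq_smul_of_cross_eq_zero hj0 hc
  refine h.step {c} (by simp) fun F hF hU x => ?_
  rw [hc]
  exact mul_mem (hU c (by simp)) (hF j hj x)

theorem span (h : GenBy γ s n) (hj : j ∈ s) (hk : k ∈ s) (hjk : γ j ⨯₃ γ k ≠ 0)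
    (hd : det3 (γ j) (γ k) (γ i) = 0) : GenBy γ (insert i s) (n + 2) := by
  classical
  obtain ⟨a, b, hab⟩ := exists_eq_add_of_det3_eq_zero hjk hd
  refine h.step {a, b} Finset.card_le_two fun F hF hU x => ?_
  rw [hab]
  exact add_mem (mul_mem (hU a (by simp)) (hF j hj x)) (mul_mem (hU b (by simp)) (hF k hk x))

theorem meet (h : GenBy γ s n) (hj : j ∈ s) (hk : k ∈ s) (hl : l ∈ s) (hm : m ∈ s)
    (hne : (γ j ⨯₃ γ k) ⨯₃ (γ l ⨯₃ γ m) ≠ 0) (h1 : det3 (γ j) (γ k) (γ i) = 0)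
    (h2 : det3 (γ l) (γ m) (γ i) = 0) : GenBy γ (insert i s) (n + 1) := by
  obtain ⟨c, hc⟩ := exists_eq_smul_cross hne h1 h2
  refine h.step {c} (by simp) fun F hF hU x => ?_
  have hcross : ∀ u v : Fin 3 → K, (∀ x, u x ∈ F) → (∀ x, v x ∈ F) → ∀ x, (u ⨯₃ v) x ∈ F := by
    intro u v hu hv x
    rw [cross_apply]
    fin_cases x
    · exact sub_mem (mul_mem (hu 1) (hv 2)) (mul_mem (hu 2) (hv 1))
    · exact sub_mem (mul_mem (hu 2) (hv 0)) (mul_mem (hu 0) (hv 2))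
    · exact sub_mem (mul_mem (hu 0) (hv 1)) (mul_mem (hu 1) (hv 0))
  rw [hc]
  exact mul_mem (hU c (by simp))
    (hcross _ _ (hcross _ _ (hF j hj) (hF k hk)) (hcross _ _ (hF l hl) (hF m hm)) x)

theorem mono (h : GenBy γ s n) {n' : ℕ} (hn : n ≤ n') : GenBy γ s n' := by
  obtain ⟨T, hT, hs⟩ := h
  exact ⟨T, hT.trans hn, hs⟩

/-- Two vectors that are dependent on a given nonzero one have five parameters. -/
theorem pencil (h : GenBy γ s n) (hj : j ∈ s) (hj0 : γ j ≠ 0) (k i : Fin 8)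
    (hd : det3 (γ j) (γ k) (γ i) = 0) : GenBy γ (insert i (insert k s)) (n + 5) := by
  by_cases hc : γ j ⨯₃ γ k = 0
  · exact ((h.par hj hj0 hc).free i).mono (by omega)
  · exact (h.free k).span (Finset.mem_insert_of_mem hj) (Finset.mem_insert_self _ _) hc hd

/-- Three dependent vectors have eight parameters. -/
theorem line (h : GenBy γ s n) (j k i : Fin 8) (hd : det3 (γ j) (γ k) (γ i) = 0) :
    GenBy γ (insert i (insert k (insert j s))) (n + 8) := by
  by_cases hj0 : γ j = 0
  · exact (((h.zero hj0).free k).free i).mono (by omega)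
  · exact (h.free j).pencil (Finset.mem_insert_self _ _) hj0 k i hd

end GenBy

end GenBy

/-! ### Symmetries of the MacLane configuration -/

/-- The point antipodal to a given point: the only one that is on no common line with it. -/
def antipode : Fin 8 → Fin 8 := ![6, 3, 4, 1, 2, 7, 0, 5]

/-- The third point on the line through two points that are neither equal nor antipodal
(in the other cases the value is the first point). -/
def thirdPoint : Fin 8 → Fin 8 → Fin 8 :=
  ![![0, 2, 1, 7, 5, 4, 0, 3], ![2, 1, 0, 1, 7, 6, 5, 4], ![1, 0, 2, 5, 2, 3, 7, 6],
    ![7, 3, 5, 3, 6, 2, 4, 0], ![5, 7, 4, 6, 4, 0, 3, 1], ![4, 6, 3, 2, 0, 5, 1, 5],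
    ![6, 5, 7, 4, 3, 1, 6, 2], ![3, 4, 6, 0, 1, 7, 2, 7]]

theorem mem_lines_iff (i j k : Fin 8) : {i, j, k} ∈ macLane.lines ↔
    i ≠ j ∧ j ≠ antipode i ∧ k = thirdPoint i j := by
  revert i j k
  decide +kernel

/-- The permutations of the points that map lines to lines. -/
def IsMacLaneAut (σ : Equiv.Perm (Fin 8)) : Prop :=
  ∀ i j k, {σ i, σ j, σ k} ∈ macLane.lines ↔ {i, j, k} ∈ macLane.lines

/-- The relabelling of the points that sends `6` to `i` and `1` to `j`; the other points are found
by completing lines. -/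
def frameLabel (i j : Fin 8) : Fin 8 → Fin 8 :=
  let q := antipode i
  let h₁ := thirdPoint q j
  let h₂ := thirdPoint i h₁
  let h₃ := thirdPoint q h₂
  let h₄ := thirdPoint i h₃
  let h₅ := thirdPoint q h₄
  ![q, j, h₁, h₃, h₄, h₅, i, h₂]

theorem frameLabel_injective : ∀ i j, j ≠ i → j ≠ antipode i →
    ∀ a b, frameLabel i j a = frameLabel i j b → a = b := by
  decide +kernel

theorem frameLabel_compat : ∀ i j, j ≠ i → j ≠ antipode i →
    ∀ a, frameLabel i j (antipode a) = antipode (frameLabel i j a) ∧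
      ∀ b, frameLabel i j (thirdPoint a b) = thirdPoint (frameLabel i j a) (frameLabel i j b) := by
  decide +kernel

/-- The automorphism group acts transitively on ordered pairs of distinct points on a line. -/
theorem exists_aut (i j : Fin 8) (hij : j ≠ i) (hij' : j ≠ antipode i) :
    ∃ σ : Equiv.Perm (Fin 8), IsMacLaneAut σ ∧ ∀ a, σ a = frameLabel i j a := by
  have hinj : Function.Injective (frameLabel i j) := fun a b => frameLabel_injective i j hij hij' a b
  refine ⟨Equiv.ofBijective _ (Finite.injective_iff_bijective.1 hinj), fun a b c => ?_,
    fun a => rfl⟩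
  simp only [Equiv.ofBijective_apply, mem_lines_iff]
  obtain ⟨h1, h2⟩ := frameLabel_compat i j hij hij' a
  rw [← h1, ← h2, hinj.ne_iff, hinj.ne_iff, hinj.eq_iff]

theorem exists_aut_six (i : Fin 8) : ∃ σ : Equiv.Perm (Fin 8), IsMacLaneAut σ ∧ σ 6 = i := by
  obtain ⟨j, h1, h2⟩ : ∃ j, j ≠ i ∧ j ≠ antipode i := by revert i; decide
  obtain ⟨σ, hσ, h⟩ := exists_aut i j h1 h2
  exact ⟨σ, hσ, h 6⟩

theorem IsMacLaneAut.antipode_apply {σ : Equiv.Perm (Fin 8)} (hσ : IsMacLaneAut σ) (i : Fin 8) :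
    σ (antipode i) = antipode (σ i) := by
  -- the antipode is characterized by being on no common line
  have key : ∀ a b : Fin 8, b = antipode a ↔ a ≠ b ∧ ∀ c, {a, b, c} ∉ macLane.lines := by
    simp only [mem_lines_iff]; decide +kernel
  rw [key]
  obtain ⟨h1, h2⟩ := (key i (antipode i)).1 rfl
  refine ⟨σ.injective.ne h1, fun c hc => ?_⟩
  rw [← σ.apply_symm_apply c, hσ] at hc
  exact h2 _ hc

/-! ### Configurations with the dependencies of the MacLane configuration -/

/-- The points of each line of the MacLane configuration are dependent. -/
def SatMacLane {A : Type*} [CommRing A] (γ : Fin 8 → Fin 3 → A) : Prop :=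
  ∀ i j k, {i, j, k} ∈ macLane.lines → det3 (γ i) (γ j) (γ k) = 0

theorem SatMacLane.comp {A : Type*} [CommRing A] {γ : Fin 8 → Fin 3 → A} (h : SatMacLane γ)
    {σ : Equiv.Perm (Fin 8)} (hσ : IsMacLaneAut σ) : SatMacLane (γ ∘ σ) :=
  fun i j k hl => h _ _ _ ((hσ i j k).2 hl)

section Classify

variable {K : Type} [Field K] {γ : Fin 8 → Fin 3 → K}

/-- The vectors of `γ` do not all lie on a plane. -/
def SpansSpace (γ : Fin 8 → Fin 3 → K) : Prop := ∀ n, n ≠ 0 → ∃ i, n ⬝ᵥ γ i ≠ 0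

theorem SpansSpace.comp (hr : SpansSpace γ) (σ : Equiv.Perm (Fin 8)) : SpansSpace (γ ∘ σ) := by
  intro n hn
  obtain ⟨i, hi⟩ := hr n hn
  exact ⟨σ.symm i, by simpa using hi⟩

theorem SpansSpace.false (hr : SpansSpace γ) {n : Fin 3 → K} (hn : n ≠ 0) (h0 : n ⬝ᵥ γ 0 = 0)
    (h1 : n ⬝ᵥ γ 1 = 0) (h2 : n ⬝ᵥ γ 2 = 0) (h3 : n ⬝ᵥ γ 3 = 0) (h4 : n ⬝ᵥ γ 4 = 0)
    (h5 : n ⬝ᵥ γ 5 = 0) (h6 : n ⬝ᵥ γ 6 = 0) (h7 : n ⬝ᵥ γ 7 = 0) : False := by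
  obtain ⟨i, hi⟩ := hr n hn
  fin_cases i <;> contradiction

/-- If the point `6` vanishes, the planes `⟨2, 3⟩` and `⟨0, 4⟩` are different. -/
theorem SatMacLane.cross_ne_zero_of_loop (h : SatMacLane γ) (hr : SpansSpace γ) (h6 : γ 6 = 0)
    (h02 : γ 0 ⨯₃ γ 2 ≠ 0) (h03 : γ 0 ⨯₃ γ 3 ≠ 0) (h04 : γ 0 ⨯₃ γ 4 ≠ 0) (h23 : γ 2 ⨯₃ γ 3 ≠ 0) :
    (γ 0 ⨯₃ γ 4) ⨯₃ (γ 2 ⨯₃ γ 3) ≠ 0 := by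
  intro hc
  obtain ⟨c, hc⟩ := exists_eq_smul_of_cross_eq_zero h04 hc
  have n2 : (γ 2 ⨯₃ γ 3) ⬝ᵥ γ 2 = 0 := dot_cross_left
  have n3 : (γ 2 ⨯₃ γ 3) ⬝ᵥ γ 3 = 0 := dot_cross_right
  have n0 : (γ 2 ⨯₃ γ 3) ⬝ᵥ γ 0 = 0 := by rw [hc, smul_dotProduct, dot_cross_left, smul_zero]
  have n4 : (γ 2 ⨯₃ γ 3) ⬝ᵥ γ 4 = 0 := by rw [hc, smul_dotProduct, dot_cross_right, smul_zero]
  exact hr.false h23 n0 (dotProduct_eq_zero_of_det3 n0 n2 h02 (h 0 2 1 (by decide))) n2 n3 n4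
    (dotProduct_eq_zero_of_det3 n0 n4 h04 (h 0 4 5 (by decide))) (by simp [h6])
    (dotProduct_eq_zero_of_det3 n0 n3 h03 (h 0 3 7 (by decide)))

/-- If no point vanishes and the points `6`, `0` are parallel, some further point is parallel to
them. -/
theorem SatMacLane.exists_par_of_antipodal_par (h : SatMacLane γ) (hr : SpansSpace γ)
    (h60 : γ 6 ⨯₃ γ 0 = 0) (hne : ∀ i, γ i ≠ 0) : ∃ i, i ≠ 6 ∧ i ≠ 0 ∧ γ 6 ⨯₃ γ i = 0 := by
  by_contra! hcon
  have hcon0 : ∀ i, i ≠ 6 → i ≠ 0 → γ 0 ⨯₃ γ i ≠ 0 := fun i hi hi0 hc =>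
    hcon i hi hi0 (cross_eq_zero_trans (hne 0) (cross_eq_zero_comm.1 h60) hc)
  have h61 := hcon 1 (by decide) (by decide)
  have n6 : (γ 6 ⨯₃ γ 1) ⬝ᵥ γ 6 = 0 := dot_cross_left
  have n1 : (γ 6 ⨯₃ γ 1) ⬝ᵥ γ 1 = 0 := dot_cross_right
  have n0 := dotProduct_eq_zero_of_cross (hne 6) n6 h60
  have n2 := dotProduct_eq_zero_of_det3 n0 n1 (hcon0 1 (by decide) (by decide)) (h 0 1 2 (by decide))
  have n7 := dotProduct_eq_zero_of_det3 n6 n2 (hcon 2 (by decide) (by decide)) (h 6 2 7 (by decide))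
  have n3 := dotProduct_eq_zero_of_det3 n0 n7 (hcon0 7 (by decide) (by decide)) (h 0 7 3 (by decide))
  have n4 := dotProduct_eq_zero_of_det3 n6 n3 (hcon 3 (by decide) (by decide)) (h 6 3 4 (by decide))
  have n5 := dotProduct_eq_zero_of_det3 n0 n4 (hcon0 4 (by decide) (by decide)) (h 0 4 5 (by decide))
  exact hr.false h61 n0 n1 n2 n3 n4 n5 n6 n7

variable [Algebra ℂ K]

/-- The field generated by the coordinates of `γ` is not generated by `15` elements or fewer. -/
def HasLargeDim (γ : Fin 8 → Fin 3 → K) : Prop := ∀ n, GenBy γ Finset.univ n → 16 ≤ n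

theorem HasLargeDim.comp (hd : HasLargeDim γ) (σ : Equiv.Perm (Fin 8)) : HasLargeDim (γ ∘ σ) := by
  rintro n ⟨T, hT, h⟩
  exact hd n ⟨T, hT, fun i _ j => by simpa using h (σ.symm i) (Finset.mem_univ _) j⟩

theorem HasLargeDim.false (hd : HasLargeDim γ) {s : Finset (Fin 8)} {n : ℕ} (h : GenBy γ s n)
    (hn : n ≤ 15) (hs : s = Finset.univ) : False := by
  have := hd n (hs ▸ h)
  omega

/-- Two vanishing points that are not antipodal leave too few parameters. -/
theorem SatMacLane.false_of_two_loops (h : SatMacLane γ) (hd : HasLargeDim γ) (h6 : γ 6 = 0)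
    (h1 : γ 1 = 0) (h0 : γ 0 ≠ 0) : False := by
  have e := ((GenBy.empty γ).zero h6).zero h1
  by_cases h3 : γ 3 = 0
  · exact hd.false ((((e.zero h3).line 0 4 5 (h _ _ _ (by decide))).free 2).free 7)
      (by norm_num) (by decide)
  by_cases h5 : γ 5 = 0
  · exact hd.false ((((e.zero h5).line 0 7 3 (h _ _ _ (by decide))).free 2).free 4)
      (by norm_num) (by decide)
  by_cases h03 : γ 0 ⨯₃ γ 3 = 0
  · exact hd.false (((((e.free 0).par (by decide) h0 h03).pencil (j := 3) (by decide) h3 2 5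
      (h _ _ _ (by decide))).free 4).free 7) (by norm_num) (by decide)
  by_cases h05 : γ 0 ⨯₃ γ 5 = 0
  · exact hd.false (((((e.free 0).par (by decide) h0 h05).pencil (j := 5) (by decide) h5 2 3
      (h _ _ _ (by decide))).free 4).free 7) (by norm_num) (by decide)
  by_cases h35 : γ 3 ⨯₃ γ 5 = 0
  · exact hd.false (((((e.free 3).par (by decide) h3 h35).pencil (j := 3) (by decide) h3 0 7
      (h _ _ _ (by decide))).free 4).free 2) (by norm_num) (by decide)
  · exact hd.false ((((((e.free 0).free 3).free 5).span (i := 7) (j := 0) (k := 3) (by decide)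
      (by decide) h03 (h _ _ _ (by decide))).span (i := 4) (j := 0) (k := 5) (by decide) (by decide)
      h05 (h _ _ _ (by decide))).span (i := 2) (j := 3) (k := 5) (by decide) (by decide) h35
      (h _ _ _ (by decide))) (by norm_num) (by decide)

/-- If the point `6` vanishes, then the point `0` is not parallel to the point `1`. -/
theorem SatMacLane.false_of_loop_of_par (h : SatMacLane γ) (hd : HasLargeDim γ)
    (hr : SpansSpace γ) (h6 : γ 6 = 0) (hne : ∀ i, i ≠ 6 → γ i ≠ 0) (h01 : γ 0 ⨯₃ γ 1 = 0) :
    False := by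
  have h0 := hne 0 (by decide)
  have h1 := hne 1 (by decide)
  have e := (((GenBy.empty γ).zero h6).free 0).par (i := 1) (by decide) h0 h01
  by_cases h07 : γ 0 ⨯₃ γ 7 = 0
  · have e := e.par (i := 7) (j := 0) (by decide) h0 h07
    by_cases h04 : γ 0 ⨯₃ γ 4 = 0
    · exact hd.false ((e.par (i := 4) (j := 0) (by decide) h0 h04).line 2 3 5
        (h _ _ _ (by decide))) (by norm_num) (by decide)
    · exact hd.false (((e.free 4).span (i := 5) (j := 0) (k := 4) (by decide) (by decide) h04
        (h _ _ _ (by decide))).pencil (j := 5) (by decide) (hne 5 (by decide)) 2 3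
        (h _ _ _ (by decide))) (by norm_num) (by decide)
  by_cases h04 : γ 0 ⨯₃ γ 4 = 0
  · have e := (e.par (i := 4) (j := 0) (by decide) h0 h04).pencil (j := 0) (by decide) h0 7 3
      (h _ _ _ (by decide))
    by_cases h32 : γ 3 ⨯₃ γ 2 = 0
    · exact hd.false ((e.par (i := 2) (j := 3) (by decide) (hne 3 (by decide)) h32).free 5)
        (by norm_num) (by decide)
    · exact hd.false ((e.free 2).span (i := 5) (j := 3) (k := 2) (by decide) (by decide) h32
        (h _ _ _ (by decide))) (by norm_num) (by decide)
  · have h17 : γ 1 ⨯₃ γ 7 ≠ 0 := fun h17 =>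
      h07 (cross_eq_zero_trans h1 (cross_eq_zero_comm.1 h01) h17)
    have n0 : (γ 0 ⨯₃ γ 7) ⬝ᵥ γ 0 = 0 := dot_cross_left
    have n7 : (γ 0 ⨯₃ γ 7) ⬝ᵥ γ 7 = 0 := dot_cross_right
    have n1 := dotProduct_eq_zero_of_cross h0 n0 h01
    have n4 := dotProduct_eq_zero_of_det3 n1 n7 h17 (h 1 7 4 (by decide))
    have n3 := dotProduct_eq_zero_of_det3 n0 n7 h07 (h 0 7 3 (by decide))
    have n5 := dotProduct_eq_zero_of_det3 n0 n4 h04 (h 0 4 5 (by decide))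
    have n2 : (γ 0 ⨯₃ γ 7) ⬝ᵥ γ 2 ≠ 0 := fun n2 =>
      hr.false h07 n0 n1 n2 n3 n4 n5 (by simp [h6]) n7
    have h35 := cross_eq_zero_of_det3 n2 n3 n5 (h 2 3 5 (by decide))
    exact hd.false (((((e.free 7).span (i := 4) (j := 1) (k := 7) (by decide) (by decide) h17
      (h _ _ _ (by decide))).span (i := 3) (j := 0) (k := 7) (by decide) (by decide) h07
      (h _ _ _ (by decide))).par (i := 5) (j := 3) (by decide) (hne 3 (by decide)) h35).free 2)
      (by norm_num) (by decide)

/-- If the point `6` vanishes, then the points `1` and `7` are not parallel. -/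
theorem SatMacLane.false_of_loop_of_par' (h : SatMacLane γ) (hd : HasLargeDim γ)
    (hr : SpansSpace γ) (h6 : γ 6 = 0) (hpar : ∀ i, i ≠ 6 → i ≠ 0 → γ 0 ⨯₃ γ i ≠ 0)
    (hne : ∀ i, i ≠ 6 → γ i ≠ 0) (h17 : γ 1 ⨯₃ γ 7 = 0) : False := by
  have e := (((((GenBy.empty γ).zero h6).free 0).free 1).par (i := 7) (j := 1) (by decide)
    (hne 1 (by decide)) h17).span (i := 2) (j := 0) (k := 1) (by decide) (by decide)
    (hpar 1 (by decide) (by decide)) (h _ _ _ (by decide))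
  have h04 := hpar 4 (by decide) (by decide)
  by_cases h23 : γ 2 ⨯₃ γ 3 = 0
  · exact hd.false (((e.par (i := 3) (j := 2) (by decide) (hne 2 (by decide)) h23).free 4).span
      (i := 5) (j := 0) (k := 4) (by decide) (by decide) h04 (h _ _ _ (by decide)))
      (by norm_num) (by decide)
  · exact hd.false (((e.span (i := 3) (j := 0) (k := 7) (by decide) (by decide)
      (hpar 7 (by decide) (by decide)) (h _ _ _ (by decide))).free 4).meet (i := 5) (j := 0)
      (k := 4) (l := 2) (m := 3) (by decide) (by decide) (by decide) (by decide)
      (h.cross_ne_zero_of_loop hr h6 (hpar 2 (by decide) (by decide))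
        (hpar 3 (by decide) (by decide)) h04 h23)
      (h _ _ _ (by decide)) (h _ _ _ (by decide))) (by norm_num) (by decide)

/-- If no point vanishes, the points `6`, `0`, `1` are not parallel to each other. -/
theorem SatMacLane.false_of_antipodal_par (h : SatMacLane γ) (hd : HasLargeDim γ)
    (hr : SpansSpace γ) (hne : ∀ i, γ i ≠ 0) (h60 : γ 6 ⨯₃ γ 0 = 0) (h61 : γ 6 ⨯₃ γ 1 = 0) :
    False := by
  have h0 : ∀ i, γ 6 ⨯₃ γ i ≠ 0 → γ 0 ⨯₃ γ i ≠ 0 := fun i hi hc =>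
    hi (cross_eq_zero_trans (hne 0) (cross_eq_zero_comm.1 h60) hc)
  have h1 : ∀ i, γ 6 ⨯₃ γ i ≠ 0 → γ 1 ⨯₃ γ i ≠ 0 := fun i hi hc =>
    hi (cross_eq_zero_trans (hne 1) (cross_eq_zero_comm.1 h61) hc)
  have e := (((GenBy.empty γ).free 6).par (i := 0) (by decide) (hne 6) h60).par (i := 1) (j := 6)
    (by decide) (hne 6) h61
  by_cases h67 : γ 6 ⨯₃ γ 7 = 0
  · have e := e.par (i := 7) (j := 6) (by decide) (hne 6) h67
    by_cases h64 : γ 6 ⨯₃ γ 4 = 0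
    · exact hd.false ((e.par (i := 4) (j := 6) (by decide) (hne 6) h64).line 2 3 5
        (h _ _ _ (by decide))) (by norm_num) (by decide)
    · have e := (e.free 4).span (i := 3) (j := 6) (k := 4) (by decide) (by decide) h64
        (h _ _ _ (by decide))
      by_cases h35 : γ 3 ⨯₃ γ 5 = 0
      · exact hd.false ((e.par (i := 5) (j := 3) (by decide) (hne 3) h35).free 2)
          (by norm_num) (by decide)
      · exact hd.false ((e.span (i := 5) (j := 0) (k := 4) (by decide) (by decide) (h0 4 h64)
          (h _ _ _ (by decide))).span (i := 2) (j := 3) (k := 5) (by decide) (by decide) h35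
          (h _ _ _ (by decide))) (by norm_num) (by decide)
  by_cases h64 : γ 6 ⨯₃ γ 4 = 0
  · have e := ((e.par (i := 4) (j := 6) (by decide) (hne 6) h64).free 7).span (i := 2) (j := 6)
      (k := 7) (by decide) (by decide) h67 (h _ _ _ (by decide))
    by_cases h23 : γ 2 ⨯₃ γ 3 = 0
    · exact hd.false ((e.par (i := 3) (j := 2) (by decide) (hne 2) h23).free 5)
        (by norm_num) (by decide)
    · exact hd.false ((e.span (i := 3) (j := 0) (k := 7) (by decide) (by decide) (h0 7 h67)
        (h _ _ _ (by decide))).span (i := 5) (j := 2) (k := 3) (by decide) (by decide) h23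
        (h _ _ _ (by decide))) (by norm_num) (by decide)
  · have n6 : (γ 6 ⨯₃ γ 7) ⬝ᵥ γ 6 = 0 := dot_cross_left
    have n7 : (γ 6 ⨯₃ γ 7) ⬝ᵥ γ 7 = 0 := dot_cross_right
    have n0 := dotProduct_eq_zero_of_cross (hne 6) n6 h60
    have n1 := dotProduct_eq_zero_of_cross (hne 6) n6 h61
    have n4 := dotProduct_eq_zero_of_det3 n1 n7 (h1 7 h67) (h 1 7 4 (by decide))
    exact hr.false h67 n0 n1 (dotProduct_eq_zero_of_det3 n6 n7 h67 (h 6 7 2 (by decide)))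
      (dotProduct_eq_zero_of_det3 n0 n7 (h0 7 h67) (h 0 7 3 (by decide))) n4
      (dotProduct_eq_zero_of_det3 n0 n4 (h0 4 h64) (h 0 4 5 (by decide))) n6 n7

end Classify

/-! ### Parametrizations of the components -/

/-- Eight vectors on a plane. -/
def coplanarParam : PolyParam 3 8 (Fin 2) (Fin 8 × Fin 2) where
  map A _ _ v s i := s (i, 0) • v 0 + s (i, 1) • v 1
  natural f v s i j := by simp

/-- The points `6` and `0` vanish, and the points of each of the two lines of the MacLane
configuration that avoid them lie on a plane. -/
def twoPlanesParam : PolyParam 3 8 (Fin 4) (Fin 8 × Fin 2) where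
  map A _ _ v s i := if i = 6 ∨ i = 0 then 0 else
    if i = 1 ∨ i = 4 ∨ i = 7 then s (i, 0) • v 0 + s (i, 1) • v 1
    else s (i, 0) • v 2 + s (i, 1) • v 3
  natural f v s i j := by fin_cases i <;> simp

/-- One representative from each pair of points that form a line with `6`. -/
def pencilRep : Fin 8 → Fin 8 := ![0, 1, 2, 3, 3, 1, 6, 2]

/-- The point `6` is free, the others lie on a plane, and the two other points of each line
through `6` are multiples of the same vector. -/
def pencilParam : PolyParam 3 8 (Fin 3) (Fin 8 × Fin 3) where
  map A _ _ v s i := if i = 6 then v 0 else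
    s (i, 2) • (s (pencilRep i, 0) • v 1 + s (pencilRep i, 1) • v 2)
  natural f v s i j := by
    by_cases h : i = 6 <;> simp [h]

theorem map_cross_apply {A B : Type*} [CommRing A] [CommRing B] (f : A →+* B) (u v : Fin 3 → A)
    (j : Fin 3) : f ((u ⨯₃ v) j) = ((fun k => f (u k)) ⨯₃ (fun k => f (v k))) j := by
  fin_cases j <;> simp [cross_apply]

/-- The point `6` vanishes, the points `0`, `1`, `7` are free, and the others are found by
completing lines. -/
def loopParam : PolyParam 3 8 (Fin 3) (Fin 7) where
  map A _ _ v s :=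
    let c₄ := s 0 • v 1 + s 1 • v 2
    let c₂ := s 2 • v 0 + s 3 • v 1
    let c₃ := s 4 • v 0 + s 5 • v 2
    ![v 0, v 1, c₂, c₃, c₄, s 6 • ((v 0 ⨯₃ c₄) ⨯₃ (c₂ ⨯₃ c₃)), 0, v 2]
  natural f v s i j := by
    have hcross : ∀ (u w : Fin 3 → _) (k : Fin 3), f ((u ⨯₃ w) k) =
      ((fun k => f (u k)) ⨯₃ (fun k => f (w k))) k := map_cross_apply f.toRingHom
    fin_cases i
    · rfl
    · rfl
    · simp
    · simp
    · simp
    · simp only [Fin.reduceFinMk, Matrix.cons_val, Pi.smul_apply, smul_eq_mul, map_mul f, hcross]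
      simp only [Pi.add_apply, Pi.smul_apply, smul_eq_mul, map_mul f, map_add f]
      rfl
    · simp
    · rfl

/-- The points of the MacLane configuration in terms of a basis of three-space, for a root `t` of
`t ^ 2 + t + 1`. -/
def macLaneVec {A : Type*} [CommRing A] (t : A) (v : Fin 3 → Fin 3 → A) : Fin 8 → Fin 3 → A :=
  ![v 0, v 1, v 0 + v 1, v 0 + v 2, v 1 + t • v 2, (1 + t) • v 0 + v 1 + t • v 2,
    v 0 + v 1 + (1 + t) • v 2, v 2]

/-- Multiples of the points of the MacLane configuration. -/
noncomputable def macLaneParam (t : ℂ) : PolyParam 3 8 (Fin 3) (Fin 8) where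
  map A _ _ v s i := s i • macLaneVec (algebraMap ℂ A t) v i
  natural f v s i j := by
    fin_cases i <;> simp [macLaneVec]

theorem exists_sq_add_self_add_one_eq_zero : ∃ t : ℂ, t ^ 2 + t + 1 = 0 := by
  obtain ⟨s, hs⟩ := IsAlgClosed.exists_eq_mul_self (-3 : ℂ)
  exact ⟨(-1 + s) / 2, by linear_combination -hs / 4⟩

section Range

variable {K : Type} [Field K] [Algebra ℂ K] {γ : Fin 8 → Fin 3 → K}

theorem mem_range_coplanarParam {n : Fin 3 → K} (hn : n ≠ 0) (h : ∀ i, n ⬝ᵥ γ i = 0) :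
    γ ∈ coplanarParam.range K := by
  obtain ⟨e, f, hef⟩ := exists_span_of_normal hn
  choose s t hst using fun i => hef (γ i) (h i)
  exact ⟨![e, f], fun x => if x.2 = 0 then s x.1 else t x.1, funext fun i => by
    simp [coplanarParam, hst i]⟩

theorem mem_range_twoPlanesParam (h6 : γ 6 = 0) (h0 : γ 0 = 0)
    (h1 : det3 (γ 1) (γ 4) (γ 7) = 0) (h2 : det3 (γ 2) (γ 3) (γ 5) = 0) :
    γ ∈ twoPlanesParam.range K := by
  obtain ⟨n, hn, n1, n4, n7⟩ := exists_normal_of_det3_eq_zero h1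
  obtain ⟨m, hm, m2, m3, m5⟩ := exists_normal_of_det3_eq_zero h2
  obtain ⟨e, f, hef⟩ := exists_span_of_normal hn
  obtain ⟨g, k, hgk⟩ := exists_span_of_normal hm
  obtain ⟨s1, t1, h1⟩ := hef _ n1
  obtain ⟨s4, t4, h4⟩ := hef _ n4
  obtain ⟨s7, t7, h7⟩ := hef _ n7
  obtain ⟨s2, t2, h2⟩ := hgk _ m2
  obtain ⟨s3, t3, h3⟩ := hgk _ m3
  obtain ⟨s5, t5, h5⟩ := hgk _ m5
  refine ⟨![e, f, g, k], fun x => if x.2 = 0 then ![0, s1, s2, s3, s4, s5, 0, s7] x.1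
    else ![0, t1, t2, t3, t4, t5, 0, t7] x.1, funext fun i => ?_⟩
  fin_cases i <;> simp [twoPlanesParam, *]

theorem mem_range_pencilParam {n : Fin 3 → K} (hn : n ≠ 0) (h : ∀ i, i ≠ 6 → n ⬝ᵥ γ i = 0)
    (h1 : γ 1 ≠ 0) (h2 : γ 2 ≠ 0) (h3 : γ 3 ≠ 0) (h15 : γ 1 ⨯₃ γ 5 = 0) (h27 : γ 2 ⨯₃ γ 7 = 0)
    (h34 : γ 3 ⨯₃ γ 4 = 0) : γ ∈ pencilParam.range K := by
  obtain ⟨e, f, hef⟩ := exists_span_of_normal hn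
  obtain ⟨s0, t0, e0⟩ := hef _ (h 0 (by decide))
  obtain ⟨s1, t1, e1⟩ := hef _ (h 1 (by decide))
  obtain ⟨s2, t2, e2⟩ := hef _ (h 2 (by decide))
  obtain ⟨s3, t3, e3⟩ := hef _ (h 3 (by decide))
  obtain ⟨c5, e5⟩ := exists_eq_smul_of_cross_eq_zero h1 h15
  obtain ⟨c7, e7⟩ := exists_eq_smul_of_cross_eq_zero h2 h27
  obtain ⟨c4, e4⟩ := exists_eq_smul_of_cross_eq_zero h3 h34
  rw [e1] at e5
  rw [e2] at e7
  rw [e3] at e4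
  refine ⟨![γ 6, e, f], fun x => if x.2 = 0 then ![s0, s1, s2, s3, 0, 0, 0, 0] x.1 else
    if x.2 = 1 then ![t0, t1, t2, t3, 0, 0, 0, 0] x.1 else ![1, 1, 1, 1, c4, c5, 0, c7] x.1,
    funext fun i => ?_⟩
  fin_cases i
  · simpa [pencilParam, pencilRep] using e0
  · simpa [pencilParam, pencilRep] using e1
  · simpa [pencilParam, pencilRep] using e2
  · simpa [pencilParam, pencilRep] using e3
  · simpa [pencilParam, pencilRep] using e4
  · simpa [pencilParam, pencilRep] using e5
  · simp [pencilParam]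
  · simpa [pencilParam, pencilRep] using e7

theorem SatMacLane.mem_range_loopParam (h : SatMacLane γ) (h6 : γ 6 = 0) (h17 : γ 1 ⨯₃ γ 7 ≠ 0)
    (h01 : γ 0 ⨯₃ γ 1 ≠ 0) (h07 : γ 0 ⨯₃ γ 7 ≠ 0)
    (hne : (γ 0 ⨯₃ γ 4) ⨯₃ (γ 2 ⨯₃ γ 3) ≠ 0) : γ ∈ loopParam.range K := by
  obtain ⟨s0, s1, e4⟩ := exists_eq_add_of_det3_eq_zero h17 (h 1 7 4 (by decide))
  obtain ⟨s2, s3, e2⟩ := exists_eq_add_of_det3_eq_zero h01 (h 0 1 2 (by decide))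
  obtain ⟨s4, s5, e3⟩ := exists_eq_add_of_det3_eq_zero h07 (h 0 7 3 (by decide))
  obtain ⟨s6, e5⟩ := exists_eq_smul_cross hne (h 0 4 5 (by decide)) (h 2 3 5 (by decide))
  rw [e4, e2, e3] at e5
  refine ⟨![γ 0, γ 1, γ 7], ![s0, s1, s2, s3, s4, s5, s6], funext fun i => ?_⟩
  fin_cases i
  · rfl
  · rfl
  · exact e2
  · exact e3
  · exact e4
  · exact e5
  · exact h6
  · rfl

/-- The coordinates of the eight points in a suitable basis are found by completing lines; the last
two incidences force the parameter `t` of the point `4` to be a root of `t ^ 2 + t + 1`. -/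
theorem SatMacLane.mem_range_macLaneParam (h : SatMacLane γ)
    (hpar : ∀ i j, i ≠ j → γ i ⨯₃ γ j ≠ 0) (hb : det3 (γ 0) (γ 1) (γ 7) ≠ 0) :
    ∃ t : ℂ, t ^ 2 + t + 1 = 0 ∧ γ ∈ (macLaneParam t).range K := by
  obtain ⟨a, b, e2⟩ := exists_eq_add_of_det3_eq_zero (hpar 0 1 (by decide)) (h 0 1 2 (by decide))
  obtain ⟨c, d, e3⟩ := exists_eq_add_of_det3_eq_zero (hpar 0 7 (by decide)) (h 0 7 3 (by decide))
  obtain ⟨e, f, e4⟩ := exists_eq_add_of_det3_eq_zero (hpar 1 7 (by decide)) (h 1 7 4 (by decide))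
  obtain ⟨x, y, e5⟩ := exists_eq_add_of_det3_eq_zero (hpar 0 4 (by decide)) (h 0 4 5 (by decide))
  obtain ⟨z, w, e6⟩ := exists_eq_add_of_det3_eq_zero (hpar 2 7 (by decide)) (h 2 7 6 (by decide))
  have ha : a ≠ 0 := fun h0 => hpar 1 2 (by decide) (by rw [e2, h0]; simp)
  have hb' : b ≠ 0 := fun h0 => hpar 0 2 (by decide) (by rw [e2, h0]; simp)
  have hc : c ≠ 0 := fun h0 => hpar 7 3 (by decide) (by rw [e3, h0]; simp)
  have hd : d ≠ 0 := fun h0 => hpar 0 3 (by decide) (by rw [e3, h0]; simp)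
  have he : e ≠ 0 := fun h0 => hpar 7 4 (by decide) (by rw [e4, h0]; simp)
  have hy : y ≠ 0 := fun h0 => hpar 0 5 (by decide) (by rw [e5, h0]; simp)
  have hz : z ≠ 0 := fun h0 => hpar 7 6 (by decide) (by rw [e6, h0]; simp)
  -- the coefficients in the basis `a • γ 0`, `b • γ 1`, `(a * d / c) • γ 7`
  obtain ⟨t, ht⟩ : ∃ t, t = (f * c * b) / (a * d * e) := ⟨_, rfl⟩
  obtain ⟨r, hr⟩ : ∃ r, r = (x * b) / (a * y * e) := ⟨_, rfl⟩
  obtain ⟨q, hq⟩ : ∃ q, q = (w * c) / (z * a * d) := ⟨_, rfl⟩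
  obtain ⟨E0, hE0⟩ : ∃ E0, E0 = a • γ 0 := ⟨_, rfl⟩
  obtain ⟨E1, hE1⟩ : ∃ E1, E1 = b • γ 1 := ⟨_, rfl⟩
  obtain ⟨E2, hE2⟩ : ∃ E2, E2 = (a * d / c) • γ 7 := ⟨_, rfl⟩
  have g0 : γ 0 = a⁻¹ • E0 := by rw [hE0, smul_smul, inv_mul_cancel₀ ha, one_smul]
  have g1 : γ 1 = b⁻¹ • E1 := by rw [hE1, smul_smul, inv_mul_cancel₀ hb', one_smul]
  have g7 : γ 7 = (c / (a * d)) • E2 := by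
    rw [hE2, smul_smul]
    have : c / (a * d) * (a * d / c) = 1 := by field_simp
    rw [this, one_smul]
  have g2 : γ 2 = E0 + E1 := by rw [e2, hE0, hE1]
  have g3 : γ 3 = (c / a) • (E0 + E2) := by
    rw [e3, hE0, hE2]
    ext i; simp; field_simp
  have g4 : γ 4 = (e / b) • (E1 + t • E2) := by
    rw [e4, hE1, hE2, ht]
    ext i; simp; field_simp
  have g5 : γ 5 = (y * e / b) • (r • E0 + E1 + t • E2) := by
    rw [e5, e4, hE0, hE1, hE2, ht, hr]
    ext i; simp; field_simp; ring
  have g6 : γ 6 = z • (E0 + E1 + q • E2) := by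
    rw [e6, e2, hE0, hE1, hE2, hq]
    ext i; simp; field_simp
  have hD : det3 E0 E1 E2 ≠ 0 := by
    have : det3 (γ 0) (γ 1) (γ 7) = a⁻¹ * b⁻¹ * (c / (a * d)) * det3 E0 E1 E2 := by
      rw [g0, g1, g7]; simp only [det3_apply, Pi.smul_apply, smul_eq_mul]; ring
    exact right_ne_zero_of_mul (this ▸ hb)
  have hr1 : r = 1 + t := by
    have h235 := h 2 3 5 (by decide)
    have : det3 (γ 2) (γ 3) (γ 5) = (c / a) * (y * e / b) * (r - 1 - t) * det3 E0 E1 E2 := by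
      rw [g2, g3, g5]; simp only [det3_apply, Pi.smul_apply, Pi.add_apply, smul_eq_mul]; ring
    rw [this] at h235
    have : r - 1 - t = 0 := by simpa [ha, hb', hc, hy, he, hD] using h235
    linear_combination this
  have hq1 : q = 1 + t := by
    have h634 := h 6 3 4 (by decide)
    have : det3 (γ 6) (γ 3) (γ 4) = z * (c / a) * (e / b) * (q - 1 - t) * det3 E0 E1 E2 := by
      rw [g6, g3, g4]; simp only [det3_apply, Pi.smul_apply, Pi.add_apply, smul_eq_mul]; ring
    rw [this] at h634
    have : q - 1 - t = 0 := by simpa [ha, hb', hc, hz, he, hD] using h634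
    linear_combination this
  have ht1 : t ^ 2 + t + 1 = 0 := by
    have h651 := h 6 5 1 (by decide)
    have : det3 (γ 6) (γ 5) (γ 1) = z * (y * e / b) * b⁻¹ * (q * r - t) * det3 E0 E1 E2 := by
      rw [g6, g5, g1]; simp only [det3_apply, Pi.smul_apply, Pi.add_apply, smul_eq_mul]; ring
    rw [this] at h651
    have : q * r - t = 0 := by simpa [ha, hb', hc, hz, he, hD, hy] using h651
    rw [hr1, hq1] at this
    linear_combination this
  obtain ⟨τ, hτ, rfl⟩ : ∃ τ : ℂ, τ ^ 2 + τ + 1 = 0 ∧ algebraMap ℂ K τ = t := by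
    obtain ⟨u, hu⟩ := exists_sq_add_self_add_one_eq_zero
    have hu' : algebraMap ℂ K u ^ 2 + algebraMap ℂ K u + 1 = 0 := by
      have := congrArg (algebraMap ℂ K) hu
      simpa using this
    have hprod : (t - algebraMap ℂ K u) * (t - algebraMap ℂ K (-1 - u)) = 0 := by
      simp only [map_sub, map_neg, map_one]
      linear_combination ht1 - hu'
    rcases mul_eq_zero.1 hprod with h0 | h0
    · exact ⟨u, hu, (sub_eq_zero.1 h0).symm⟩
    · exact ⟨-1 - u, by linear_combination hu, (sub_eq_zero.1 h0).symm⟩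
  refine ⟨τ, hτ, ![E0, E1, E2],
    ![a⁻¹, b⁻¹, 1, c / a, e / b, y * e / b, z, c / (a * d)], funext fun i => ?_⟩
  rw [hr1] at g5
  rw [hq1] at g6
  fin_cases i
  · exact g0
  · exact g1
  · exact g2.trans (one_smul K _).symm
  · exact g3
  · exact g4
  · exact g5
  · exact g6
  · exact g7

end Range

/-! ### Generic points of the circuit variety -/

section Classify

variable {K : Type} [Field K] {γ : Fin 8 → Fin 3 → K}

theorem det3_eq_zero_of_normal {n a b c : Fin 3 → K} (hn : n ≠ 0) (ha : n ⬝ᵥ a = 0)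
    (hb : n ⬝ᵥ b = 0) (hc : n ⬝ᵥ c = 0) : det3 a b c = 0 := by
  obtain ⟨e, f, hef⟩ := exists_span_of_normal hn
  obtain ⟨s, t, rfl⟩ := hef a ha
  obtain ⟨s', t', rfl⟩ := hef b hb
  obtain ⟨s'', t'', rfl⟩ := hef c hc
  simp only [det3_apply, Pi.add_apply, Pi.smul_apply, smul_eq_mul]
  ring

/-- Without parallel points, the points `0`, `1`, `7` are independent. -/
theorem SatMacLane.det3_ne_zero (h : SatMacLane γ) (hr : SpansSpace γ)
    (hpar : ∀ i j, i ≠ j → γ i ⨯₃ γ j ≠ 0) : det3 (γ 0) (γ 1) (γ 7) ≠ 0 := by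
  intro h017
  have n0 : (γ 0 ⨯₃ γ 1) ⬝ᵥ γ 0 = 0 := dot_cross_left
  have n1 : (γ 0 ⨯₃ γ 1) ⬝ᵥ γ 1 = 0 := dot_cross_right
  have n7 := dotProduct_eq_zero_of_det3 n0 n1 (hpar 0 1 (by decide)) h017
  have n2 := dotProduct_eq_zero_of_det3 n0 n1 (hpar 0 1 (by decide)) (h 0 1 2 (by decide))
  have n3 := dotProduct_eq_zero_of_det3 n0 n7 (hpar 0 7 (by decide)) (h 0 7 3 (by decide))
  have n4 := dotProduct_eq_zero_of_det3 n1 n7 (hpar 1 7 (by decide)) (h 1 7 4 (by decide))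
  exact hr.false (hpar 0 1 (by decide)) n0 n1 n2 n3 n4
    (dotProduct_eq_zero_of_det3 n0 n4 (hpar 0 4 (by decide)) (h 0 4 5 (by decide)))
    (dotProduct_eq_zero_of_det3 n2 n7 (hpar 2 7 (by decide)) (h 2 7 6 (by decide))) n7

variable [Algebra ℂ K]

/-- No point vanishes, the points `2` and `7` are parallel, and no antipodal points are. Then
the two other points of each line through `6` are parallel. -/
theorem SatMacLane.mem_range_pencilParam (h : SatMacLane γ) (hd : HasLargeDim γ)
    (hr : SpansSpace γ) (hne : ∀ i, γ i ≠ 0) (hanti : ∀ i, γ i ⨯₃ γ (antipode i) ≠ 0)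
    (h27 : γ 2 ⨯₃ γ 7 = 0) : γ ∈ pencilParam.range K := by
  have h13 : γ 1 ⨯₃ γ 3 ≠ 0 := hanti 1
  have h24 : γ 2 ⨯₃ γ 4 ≠ 0 := hanti 2
  have h75 : γ 7 ⨯₃ γ 5 ≠ 0 := hanti 7
  have h60 : γ 6 ⨯₃ γ 0 ≠ 0 := hanti 6
  have to7 : ∀ i, γ 2 ⨯₃ γ i ≠ 0 → γ 7 ⨯₃ γ i ≠ 0 := fun i hi hc =>
    hi (cross_eq_zero_trans (hne 7) (cross_eq_zero_comm.1 h27) hc)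
  have h25 : γ 2 ⨯₃ γ 5 ≠ 0 := fun hc => h75 (cross_eq_zero_trans (hne 2) h27 hc)
  have h74 := to7 4 h24
  -- the plane of `2, 4, 7` contains `1`, the plane of `2, 5, 7` contains `3`
  have n2 : (γ 2 ⨯₃ γ 4) ⬝ᵥ γ 2 = 0 := dot_cross_left
  have n4 : (γ 2 ⨯₃ γ 4) ⬝ᵥ γ 4 = 0 := dot_cross_right
  have n7 := dotProduct_eq_zero_of_cross (hne 2) n2 h27
  have n1 := dotProduct_eq_zero_of_det3 n7 n4 h74 (h 7 4 1 (by decide))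
  have m2 : (γ 2 ⨯₃ γ 5) ⬝ᵥ γ 2 = 0 := dot_cross_left
  have m5 : (γ 2 ⨯₃ γ 5) ⬝ᵥ γ 5 = 0 := dot_cross_right
  have m7 := dotProduct_eq_zero_of_cross (hne 2) m2 h27
  have m3 := dotProduct_eq_zero_of_det3 m2 m5 h25 (h 2 5 3 (by decide))
  -- if `6` is not on the plane of all the others, its lines consist of parallel points
  have hfin : (γ 2 ⨯₃ γ 4) ⬝ᵥ γ 0 = 0 → (γ 2 ⨯₃ γ 4) ⬝ᵥ γ 3 = 0 → (γ 2 ⨯₃ γ 4) ⬝ᵥ γ 5 = 0 →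
      γ 3 ⨯₃ γ 4 = 0 ∧ γ 1 ⨯₃ γ 5 = 0 ∧ ∀ i, i ≠ 6 → (γ 2 ⨯₃ γ 4) ⬝ᵥ γ i = 0 := by
    intro n0 n3 n5
    have n6 : (γ 2 ⨯₃ γ 4) ⬝ᵥ γ 6 ≠ 0 := fun n6 => hr.false h24 n0 n1 n2 n3 n4 n5 n6 n7
    refine ⟨cross_eq_zero_of_det3 n6 n3 n4 (h 6 3 4 (by decide)),
      cross_eq_zero_of_det3 n6 n1 n5 (h 6 1 5 (by decide)), fun i hi => ?_⟩
    fin_cases i <;> first | assumption | exact absurd rfl hi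
  by_cases h45 : γ 4 ⨯₃ γ 5 = 0
  · exfalso
    have n5 := dotProduct_eq_zero_of_cross (hne 4) n4 h45
    have n3 := dotProduct_eq_zero_of_det3 n2 n5 h25 (h 2 5 3 (by decide))
    have n0 : (γ 2 ⨯₃ γ 4) ⬝ᵥ γ 0 = 0 := by
      by_cases h12 : γ 1 ⨯₃ γ 2 = 0
      · have h73 : γ 7 ⨯₃ γ 3 ≠ 0 := to7 3 fun h23 =>
          h13 (cross_eq_zero_trans (hne 2) (cross_eq_zero_comm.1 h12) h23)
        exact dotProduct_eq_zero_of_det3 n7 n3 h73 (h 7 3 0 (by decide))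
      · exact dotProduct_eq_zero_of_det3 n1 n2 h12 (h 1 2 0 (by decide))
    obtain ⟨h34, h15, -⟩ := hfin n0 n3 n5
    have h14 := cross_eq_zero_trans (hne 5) (cross_eq_zero_comm.1 h15) (cross_eq_zero_comm.1 h45)
    exact h13 (cross_eq_zero_trans (hne 4) (cross_eq_zero_comm.1 h14) (cross_eq_zero_comm.1 h34))
  by_cases h245 : det3 (γ 2) (γ 4) (γ 5) = 0
  · have n5 := dotProduct_eq_zero_of_det3 n2 n4 h24 h245
    obtain ⟨h34, h15, hn⟩ := hfin (dotProduct_eq_zero_of_det3 n4 n5 h45 (h 4 5 0 (by decide)))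
      (dotProduct_eq_zero_of_det3 n2 n5 h25 (h 2 5 3 (by decide))) n5
    exact _root_.mem_range_pencilParam h24 hn (hne 1) (hne 2) (hne 3) h15 h27 h34
  exfalso
  have n5 : (γ 2 ⨯₃ γ 4) ⬝ᵥ γ 5 ≠ 0 := fun n5 => h245 (det3_eq_zero_of_normal h24 n2 n4 n5)
  have m4 : (γ 2 ⨯₃ γ 5) ⬝ᵥ γ 4 ≠ 0 := fun m4 => h245 (det3_eq_zero_of_normal h25 m2 m4 m5)
  have h34 : γ 3 ⨯₃ γ 4 ≠ 0 := fun hc => m4 (dotProduct_eq_zero_of_cross (hne 3) m3 hc)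
  have h15 : γ 1 ⨯₃ γ 5 ≠ 0 := fun hc => n5 (dotProduct_eq_zero_of_cross (hne 1) n1 hc)
  have hind : ∀ n, n ⬝ᵥ γ 2 = 0 → n ⬝ᵥ γ 4 = 0 → n ⬝ᵥ γ 5 = 0 → n = 0 := fun n a b c =>
    by_contra fun hn => h245 (det3_eq_zero_of_normal hn a b c)
  have e := ((((GenBy.empty γ).free 2).par (i := 7) (by decide) (hne 2) h27).free 4).free 5
  by_cases h21 : γ 2 ⨯₃ γ 1 = 0
  · have h23 : γ 2 ⨯₃ γ 3 ≠ 0 := fun h23 => h13 (cross_eq_zero_trans (hne 2) h21 h23)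
    have m0 := dotProduct_eq_zero_of_det3 m7 m3 (to7 3 h23) (h 7 3 0 (by decide))
    have h50 := cross_eq_zero_of_det3 m4 m5 m0 (h 4 5 0 (by decide))
    have hmeet : (γ 3 ⨯₃ γ 4) ⨯₃ (γ 1 ⨯₃ γ 5) ≠ 0 := by
      intro hc
      obtain ⟨r, hr'⟩ := exists_eq_smul_of_cross_eq_zero h34 hc
      refine h15 (hind _ ?_ ?_ dot_cross_right)
      · exact dotProduct_eq_zero_of_cross (hne 1) dot_cross_left (cross_eq_zero_comm.1 h21)
      · rw [hr', smul_dotProduct, dot_cross_right, smul_zero]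
    exact hd.false ((((e.par (i := 1) (j := 2) (by decide) (hne 2) h21).par (i := 0) (j := 5)
      (by decide) (hne 5) h50).span (i := 3) (j := 2) (k := 5) (by decide) (by decide) h25
      (h _ _ _ (by decide))).meet (i := 6) (j := 3) (k := 4) (l := 1) (m := 5) (by decide)
      (by decide) (by decide) (by decide) hmeet (h _ _ _ (by decide)) (h _ _ _ (by decide)))
      (by norm_num) (by decide)
  · have n0 := dotProduct_eq_zero_of_det3 n2 n1 h21 (h 2 1 0 (by decide))
    have h40 := cross_eq_zero_of_det3 n5 n4 n0 (h 5 4 0 (by decide))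
    have m0 : (γ 2 ⨯₃ γ 5) ⬝ᵥ γ 0 ≠ 0 := fun m0 =>
      m4 (dotProduct_eq_zero_of_cross (hne 0) m0 (cross_eq_zero_comm.1 h40))
    have h73 := cross_eq_zero_of_det3 m0 m7 m3 (h 0 7 3 (by decide))
    have h32 := cross_eq_zero_trans (hne 7) h73 (cross_eq_zero_comm.1 h27)
    have hmeet : (γ 3 ⨯₃ γ 4) ⨯₃ (γ 1 ⨯₃ γ 5) ≠ 0 := by
      intro hc
      obtain ⟨r, hr'⟩ := exists_eq_smul_of_cross_eq_zero h15 (cross_eq_zero_comm.1 hc)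
      refine h34 (hind _ ?_ dot_cross_right ?_)
      · exact dotProduct_eq_zero_of_cross (hne 3) dot_cross_left h32
      · rw [hr', smul_dotProduct, dot_cross_right, smul_zero]
    exact hd.false ((((e.par (i := 3) (j := 7) (by decide) (hne 7) h73).par (i := 0) (j := 4)
      (by decide) (hne 4) h40).span (i := 1) (j := 7) (k := 4) (by decide) (by decide) h74
      (h _ _ _ (by decide))).meet (i := 6) (j := 3) (k := 4) (l := 1) (m := 5) (by decide)
      (by decide) (by decide) (by decide) hmeet (h _ _ _ (by decide)) (h _ _ _ (by decide)))
      (by norm_num) (by decide)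

/-- A configuration in which the point `6` vanishes. -/
theorem SatMacLane.classify_of_loop (h : SatMacLane γ) (hd : HasLargeDim γ) (hr : SpansSpace γ)
    (h6 : γ 6 = 0) : γ ∈ twoPlanesParam.range K ∨ γ ∈ loopParam.range K := by
  by_cases h0 : γ 0 = 0
  · exact Or.inl (mem_range_twoPlanesParam h6 h0 (h _ _ _ (by decide)) (h _ _ _ (by decide)))
  right
  have hne : ∀ i, i ≠ 6 → γ i ≠ 0 := by
    intro i hi hi0
    have hi' : i ≠ antipode 6 := fun hc => by
      have hi1 : i = 0 := hc
      exact h0 (hi1 ▸ hi0)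
    obtain ⟨σ, hσ, hlab⟩ := exists_aut 6 i hi hi'
    have s6 : σ 6 = 6 := hlab 6
    have s0 : σ 0 = 0 := hlab 0
    have s1 : σ 1 = i := hlab 1
    exact (h.comp hσ).false_of_two_loops (hd.comp σ) (by simp [s6, h6]) (by simp [s1, hi0])
      (by simp [s0, h0])
  have hpar : ∀ i, i ≠ 6 → i ≠ 0 → γ 0 ⨯₃ γ i ≠ 0 := by
    intro i hi hi0 hc
    obtain ⟨σ, hσ, hlab⟩ := exists_aut 6 i hi hi0
    have s6 : σ 6 = 6 := hlab 6
    have s0 : σ 0 = 0 := hlab 0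
    have s1 : σ 1 = i := hlab 1
    refine (h.comp hσ).false_of_loop_of_par (hd.comp σ) (hr.comp σ) (by simp [s6, h6])
      (fun j hj => hne _ ?_) (by simpa [s0, s1] using hc)
    rw [← s6]; exact σ.injective.ne hj
  have h17 : γ 1 ⨯₃ γ 7 ≠ 0 := fun hc => h.false_of_loop_of_par' hd hr h6 hpar hne hc
  have h23 : γ 2 ⨯₃ γ 3 ≠ 0 := by
    intro hc
    obtain ⟨σ, hσ, hlab⟩ := exists_aut 6 3 (by decide) (by decide)
    have s6 : σ 6 = 6 := hlab 6
    have s0 : σ 0 = 0 := hlab 0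
    have s1 : σ 1 = 3 := hlab 1
    have s7 : σ 7 = 2 := hlab 7
    have hσ6 : ∀ i, i ≠ 6 → σ i ≠ 6 := fun i hi h => hi (σ.injective (h.trans s6.symm))
    have hσ0 : ∀ i, i ≠ 0 → σ i ≠ 0 := fun i hi h => hi (σ.injective (h.trans s0.symm))
    refine (h.comp hσ).false_of_loop_of_par' (hd.comp σ) (hr.comp σ) (by simp [s6, h6])
      (fun i hi hi0 => ?_) (fun i hi => hne _ (hσ6 i hi)) ?_
    · simpa [s0] using hpar (σ i) (hσ6 i hi) (hσ0 i hi0)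
    · simpa [s1, s7] using cross_eq_zero_comm.1 hc
  exact h.mem_range_loopParam h6 h17 (hpar 1 (by decide) (by decide)) (hpar 7 (by decide) (by decide))
    (h.cross_ne_zero_of_loop hr h6 (hpar 2 (by decide) (by decide)) (hpar 3 (by decide) (by decide))
      (hpar 4 (by decide) (by decide)) h23)

/-- A configuration over an extension field of `ℂ` that has the dependencies of the MacLane
configuration and whose coordinates are not generated by `15` elements or fewer is, up to a
symmetry, a value of one of the five parametrizations. -/
theorem SatMacLane.classify (h : SatMacLane γ) (hd : HasLargeDim γ) :
    (∃ t : ℂ, t ^ 2 + t + 1 = 0 ∧ γ ∈ (macLaneParam t).range K) ∨ γ ∈ coplanarParam.range K ∨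
      (∃ σ : Equiv.Perm (Fin 8), IsMacLaneAut σ ∧ (γ ∘ σ ∈ loopParam.range K ∨
        γ ∘ σ ∈ twoPlanesParam.range K ∨ γ ∘ σ ∈ pencilParam.range K)) := by
  by_cases hr : SpansSpace γ
  swap
  · simp only [SpansSpace, not_forall, not_exists, not_not] at hr
    obtain ⟨n, hn, hn'⟩ := hr
    exact Or.inr (Or.inl (mem_range_coplanarParam hn hn'))
  by_cases hloop : ∃ i, γ i = 0
  · obtain ⟨i, hi⟩ := hloop
    obtain ⟨σ, hσ, s6⟩ := exists_aut_six i
    have := (h.comp hσ).classify_of_loop (hd.comp σ) (hr.comp σ) (by simp [s6, hi])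
    exact Or.inr (Or.inr ⟨σ, hσ, by tauto⟩)
  have hne : ∀ i, γ i ≠ 0 := not_exists.1 hloop
  have hanti : ∀ i, γ i ⨯₃ γ (antipode i) ≠ 0 := by
    intro i hi
    obtain ⟨σ, hσ, s6⟩ := exists_aut_six i
    have s0 : σ 0 = antipode i := by rw [← s6, ← hσ.antipode_apply]; rfl
    have hne' : ∀ j, (γ ∘ σ) j ≠ 0 := fun j => hne _
    have h60 : (γ ∘ σ) 6 ⨯₃ (γ ∘ σ) 0 = 0 := by simpa [s6, s0] using hi
    obtain ⟨j, hj6, hj0, hj⟩ :=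
      (h.comp hσ).exists_par_of_antipodal_par (hr.comp σ) h60 hne'
    obtain ⟨τ, hτ, hlab⟩ := exists_aut 6 j hj6 hj0
    have t6 : τ 6 = 6 := hlab 6
    have t0 : τ 0 = 0 := hlab 0
    have t1 : τ 1 = j := hlab 1
    exact ((h.comp hσ).comp hτ).false_of_antipodal_par ((hd.comp σ).comp τ) ((hr.comp σ).comp τ)
      (fun j => hne _) (by simpa [t6, t0] using h60) (by simpa [t6, t1] using hj)
  by_cases hpar : ∀ i j, i ≠ j → γ i ⨯₃ γ j ≠ 0
  · exact Or.inl (h.mem_range_macLaneParam hpar (h.det3_ne_zero hr hpar))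
  push Not at hpar
  obtain ⟨i, j, hij, hc⟩ := hpar
  have hij' : j ≠ antipode i := fun hj => hanti i (hj ▸ hc)
  obtain ⟨a, b, hba, hba', h2, h7⟩ : ∃ a b, b ≠ a ∧ b ≠ antipode a ∧ frameLabel a b 2 = i ∧
      frameLabel a b 7 = j := by
    clear hc; revert i j; decide +kernel
  obtain ⟨σ, hσ, hlab⟩ := exists_aut a b hba hba'
  have s2 : σ 2 = i := (hlab 2).trans h2
  have s7 : σ 7 = j := (hlab 7).trans h7
  refine Or.inr (Or.inr ⟨σ, hσ, Or.inr (Or.inr ?_)⟩)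
  refine (h.comp hσ).mem_range_pencilParam (hd.comp σ) (hr.comp σ) (fun k => hne _) (fun k => ?_)
    (by simpa [s2, s7] using hc)
  simpa [hσ.antipode_apply] using hanti (σ k)

end Classify

/-! ### Linear dependence of few vectors -/

section LinDep

variable {γ : Fin 8 → Fin 3 → ℂ} {i j k : Fin 8}

theorem linearIndepOn_triple_iff (hij : i ≠ j) (hik : i ≠ k) (hjk : j ≠ k) :
    LinearIndepOn ℂ γ {i, j, k} ↔ det3 (γ i) (γ j) (γ k) ≠ 0 := by
  have hinj : Function.Injective ![i, j, k] := by
    intro a b hab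
    fin_cases a <;> fin_cases b <;> simp_all
  have hrange : ({i, j, k} : Set (Fin 8)) = Set.range ![i, j, k] := by
    ext x
    simp only [Set.mem_insert_iff, Set.mem_singleton_iff, Set.mem_range, Fin.exists_fin_succ]
    simp [eq_comm]
  rw [hrange, linearIndepOn_range_iff hinj]
  have hrow : γ ∘ ![i, j, k] = (Matrix.of ![γ i, γ j, γ k]).row := by
    funext a; fin_cases a <;> rfl
  rw [hrow, Matrix.linearIndependent_rows_iff_isUnit, Matrix.isUnit_iff_isUnit_det, isUnit_iff_ne_zero,
    Matrix.det_fin_three, det3_apply]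
  simp only [Matrix.of_apply, Matrix.cons_val]
  refine not_congr (Eq.congr ?_ rfl)
  ring

theorem linearIndepOn_pair_iff_cross (hij : i ≠ j) :
    LinearIndepOn ℂ γ {i, j} ↔ γ i ⨯₃ γ j ≠ 0 := by
  rw [LinearIndepOn.pair_iff _ hij]
  constructor
  · intro h hc
    by_cases hi : γ i = 0
    · exact one_ne_zero (h 1 0 (by simp [hi])).1
    · obtain ⟨c, hc⟩ := exists_eq_smul_of_cross_eq_zero hi hc
      exact one_ne_zero (neg_eq_zero.1 (h c (-1) (by simp [hc])).2)
  · intro h s t hst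
    have hs : s • (γ i ⨯₃ γ j) = (0 : Fin 3 → ℂ) := by
      have := congrArg (fun w => w ⨯₃ γ j) hst
      simpa using this
    have ht : t • (γ i ⨯₃ γ j) = (0 : Fin 3 → ℂ) := by
      have := congrArg (fun w => γ i ⨯₃ w) hst
      simpa using this
    exact ⟨(smul_eq_zero.1 hs).resolve_right h, (smul_eq_zero.1 ht).resolve_right h⟩

theorem ncard_le_three_of_linearIndepOn {S : Set (Fin 8)}
    (h : LinearIndepOn ℂ γ S) : S.ncard ≤ 3 := by
  classical
  have := LinearIndependent.fintype_card_le_finrank (R := ℂ) h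
  rw [Module.finrank_fin_fun] at this
  rwa [← Nat.card_coe_set_eq, Nat.card_eq_fintype_card]

end LinDep

/-! ### Independent sets of the matroids -/

theorem macLane_indep_iff {I : Finset (Fin 8)} :
    macLane.matroid.Indep I ↔ I.card ≤ 3 ∧ (I.card = 3 → I ∉ macLane.lines) := by
  have hcard : ∀ l ∈ macLane.lines, l.card = 3 := by decide +kernel
  have h1 : macLane.matroid.Indep I ↔ macLane.IndepSet I := by
    rw [PointLineConfig.matroid, IndepMatroid.matroid_indep_iff, IndepMatroid.ofFinset_indep]
  rw [h1, PointLineConfig.IndepSet]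
  refine and_congr_right fun _ => forall_congr' fun hI => ⟨fun h hl => h I hl subset_rfl,
    fun h l hl hIl => h ?_⟩
  rwa [Finset.eq_of_subset_of_card_le hIl (by rw [hI, hcard l hl])]

theorem makeLoops_macLane_indep_iff {S : Set (Fin 8)} {I : Finset (Fin 8)} :
    (makeLoops macLane.matroid S).Indep I ↔ macLane.matroid.Indep I ∧ ∀ x ∈ I, x ∉ S := by
  have hE : macLane.matroid.E = Set.univ := rfl
  rw [makeLoops, Matroid.restrict_indep_iff, Matroid.restrict_indep_iff, hE]
  simp only [Set.subset_univ, and_true]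
  refine and_congr_right fun _ => ⟨fun h x hx => (h hx).2, fun h x hx => ⟨trivial, h x hx⟩⟩

theorem uniformMatroid_indep_iff {n d : ℕ} {I : Finset (Fin d)} :
    (uniformMatroid n d).Indep I ↔ I.card ≤ n := by
  rw [uniformMatroid, IndepMatroid.matroid_indep_iff, IndepMatroid.ofFinite_indep,
    Set.ncard_coe_finset]

theorem macLaneRep_eq_iff : ∀ k y z : Fin 8, macLaneRep k y = macLaneRep k z ↔
    y = z ∨ {k, y, z} ∈ macLane.lines := by
  decide +kernel

theorem macLaneRep_eq_self_iff : ∀ k y : Fin 8, macLaneRep k y = k ↔ y = k := by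
  decide +kernel

theorem macLaneB_indep_iff {k : Fin 8} {I : Finset (Fin 8)} : (macLaneB k).Indep I ↔
    (∀ y ∈ I, ∀ z ∈ I, {k, y, z} ∉ macLane.lines) ∧ I.card ≤ 3 ∧ (I.card = 3 → k ∈ I) := by
  have hne : ∀ k y : Fin 8, {k, y, y} ∉ macLane.lines := by
    simp only [mem_lines_iff]; decide +kernel
  rw [macLaneB, Matroid.comap_indep_iff, and_comm, ← Finset.coe_image]
  have h1 : ∀ J : Finset (Fin 8), (lineAvoiding k).matroid.Indep J ↔
      J.card ≤ 3 ∧ (J.card = 3 → k ∈ J) := by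
    intro J
    rw [PointLineConfig.matroid, IndepMatroid.matroid_indep_iff, IndepMatroid.ofFinset_indep,
      PointLineConfig.IndepSet]
    simp [lineAvoiding]
  have h2 : Set.InjOn (macLaneRep k) I ↔ ∀ y ∈ I, ∀ z ∈ I, {k, y, z} ∉ macLane.lines := by
    constructor
    · intro h y hy z hz hl
      have := h hy hz ((macLaneRep_eq_iff k y z).2 (Or.inr hl))
      exact hne k y (this ▸ hl)
    · intro h y hy z hz hyz
      exact ((macLaneRep_eq_iff k y z).1 hyz).resolve_right (h y hy z hz)
  rw [← h2]
  refine and_congr_right fun hinj => ?_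
  rw [h1, Finset.card_image_of_injOn hinj]
  refine and_congr_right fun _ => imp_congr_right fun _ => ?_
  simp only [Finset.mem_image, macLaneRep_eq_self_iff, exists_eq_right]

/-! ### Relabelling configurations -/

/-- Relabelling the vectors of a configuration, as a homeomorphism of the Zariski topology. -/
def VecConfig.relabel {n d : ℕ} (σ : Equiv.Perm (Fin d)) : VecConfig n d ≃ VecConfig n d where
  toFun γ i := γ (σ i)
  invFun γ i := γ (σ.symm i)
  left_inv γ := by funext i; simp
  right_inv γ := by funext i; simp

theorem evalAt_relabel {n d : ℕ} (σ : Equiv.Perm (Fin d)) (γ : VecConfig n d)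
    (p : MvPolynomial (Fin d × Fin n) ℂ) : evalAt (VecConfig.relabel σ γ) p =
      evalAt γ (MvPolynomial.rename (Prod.map σ id) p) := by
  rw [evalAt, evalAt, MvPolynomial.eval_rename]
  rfl

theorem continuous_relabel {n d : ℕ} (σ : Equiv.Perm (Fin d)) :
    Continuous (VecConfig.relabel (n := n) σ) := by
  refine continuous_generateFrom_iff.2 ?_
  rintro _ ⟨p, rfl⟩
  refine TopologicalSpace.isOpen_generateFrom_of_mem
    ⟨MvPolynomial.rename (Prod.map σ id) p, Set.ext fun γ => ?_⟩
  change _ ↔ evalAt (VecConfig.relabel σ γ) p ≠ 0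
  rw [evalAt_relabel]
  rfl

/-- `VecConfig.relabel` as a homeomorphism. -/
def VecConfig.relabelHomeomorph {n d : ℕ} (σ : Equiv.Perm (Fin d)) :
    VecConfig n d ≃ₜ VecConfig n d where
  toEquiv := VecConfig.relabel σ
  continuous_toFun := continuous_relabel σ
  continuous_invFun := continuous_relabel σ.symm

theorem linDep_relabel {n d : ℕ} (σ : Equiv.Perm (Fin d)) (γ : VecConfig n d) (S : Set (Fin d)) :
    LinDep (VecConfig.relabel σ γ) S ↔ LinDep γ (σ '' S) :=
  not_congr (linearIndepOn_equiv σ (f := (γ : Fin d → Fin n → ℂ)))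

/-- A matroid isomorphism carries matroid varieties to matroid varieties. -/
theorem matroidVariety_eq_preimage {n d : ℕ} {N N' : Matroid (Fin d)} {σ : Equiv.Perm (Fin d)}
    (hE : N.E = Set.univ) (hE' : N'.E = Set.univ)
    (h : ∀ I : Finset (Fin d), N'.Indep (I.map σ.toEmbedding : Finset (Fin d)) ↔ N.Indep I) :
    matroidVariety n N' = VecConfig.relabel σ ⁻¹' matroidVariety n N := by
  have hdep : ∀ S, N'.Dep (σ '' S) ↔ N.Dep S := by
    intro S
    have hS := h S.toFinite.toFinset
    rw [Finset.coe_map, Set.Finite.coe_toFinset] at hS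
    rw [Matroid.Dep, Matroid.Dep, hE, hE']
    simpa using not_congr hS
  have h1 : realizationSpace n N' = VecConfig.relabelHomeomorph σ ⁻¹' realizationSpace n N := by
    ext γ
    constructor
    · intro hγ S
      rw [← hdep, ← hγ]
      exact linDep_relabel σ γ S
    · intro hγ S
      have := hγ (σ.symm '' S)
      rw [← hdep] at this
      have h2 := (linDep_relabel σ γ (σ.symm '' S)).symm.trans this
      simpa using h2
  rw [matroidVariety, h1, ← Homeomorph.preimage_closure]
  rfl

theorem IsMacLaneAut.map_mem_lines_iff {σ : Equiv.Perm (Fin 8)} (hσ : IsMacLaneAut σ)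
    (I : Finset (Fin 8)) (hI : I.card = 3) : I.map σ.toEmbedding ∈ macLane.lines ↔
      I ∈ macLane.lines := by
  obtain ⟨i, j, k, -, -, -, rfl⟩ := Finset.card_eq_three.1 hI
  simpa using hσ i j k

theorem IsMacLaneAut.indep_map_iff {σ : Equiv.Perm (Fin 8)} (hσ : IsMacLaneAut σ)
    (I : Finset (Fin 8)) : macLane.matroid.Indep (I.map σ.toEmbedding : Finset (Fin 8)) ↔
      macLane.matroid.Indep I := by
  rw [macLane_indep_iff, macLane_indep_iff, Finset.card_map]
  refine and_congr_right fun _ => forall_congr' fun hI => not_congr (hσ.map_mem_lines_iff I hI)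

theorem matroidVariety_macLane_eq_preimage {σ : Equiv.Perm (Fin 8)} (hσ : IsMacLaneAut σ) :
    matroidVariety 3 macLane.matroid =
      VecConfig.relabel σ ⁻¹' matroidVariety 3 macLane.matroid :=
  matroidVariety_eq_preimage rfl rfl hσ.indep_map_iff

theorem matroidVariety_macLaneLoop_eq_preimage {σ : Equiv.Perm (Fin 8)} (hσ : IsMacLaneAut σ)
    (i : Fin 8) : matroidVariety 3 (macLaneLoop (σ i)) =
      VecConfig.relabel σ ⁻¹' matroidVariety 3 (macLaneLoop i) := by
  refine matroidVariety_eq_preimage rfl rfl fun I => ?_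
  rw [macLaneLoop, macLaneLoop, makeLoops_macLane_indep_iff, makeLoops_macLane_indep_iff,
    hσ.indep_map_iff, Finset.forall_mem_map]
  simp

theorem exists_macLanePair_eq (a : Fin 8) : ∃ i, macLanePair i = {a, antipode a} := by
  fin_cases a
  exacts [⟨3, Set.pair_comm _ _⟩, ⟨0, rfl⟩, ⟨1, rfl⟩, ⟨0, Set.pair_comm _ _⟩,
    ⟨1, Set.pair_comm _ _⟩, ⟨2, rfl⟩, ⟨3, rfl⟩, ⟨2, Set.pair_comm _ _⟩]

theorem matroidVariety_macLaneD_eq_preimage {σ : Equiv.Perm (Fin 8)} (hσ : IsMacLaneAut σ)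
    {i : Fin 4} (hi : macLanePair i = {σ 6, antipode (σ 6)}) : matroidVariety 3 (macLaneD i) =
      VecConfig.relabel σ ⁻¹' matroidVariety 3 (macLaneD 3) := by
  refine matroidVariety_eq_preimage rfl rfl fun I => ?_
  rw [macLaneD, macLaneD, makeLoops_macLane_indep_iff, makeLoops_macLane_indep_iff,
    hσ.indep_map_iff, hi, show macLanePair 3 = {6, antipode 6} from rfl, ← hσ.antipode_apply,
    Finset.forall_mem_map]
  simp

theorem matroidVariety_macLaneB_eq_preimage {σ : Equiv.Perm (Fin 8)} (hσ : IsMacLaneAut σ)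
    (k : Fin 8) : matroidVariety 3 (macLaneB (σ k)) =
      VecConfig.relabel σ ⁻¹' matroidVariety 3 (macLaneB k) := by
  refine matroidVariety_eq_preimage rfl rfl fun I => ?_
  rw [macLaneB_indep_iff, macLaneB_indep_iff, Finset.card_map]
  simp only [Finset.forall_mem_map, Equiv.coe_toEmbedding, hσ k _ _]
  simp

/-! ### Membership in circuit varieties and realization spaces -/

/-- The three indices of each line of the MacLane configuration. -/
def macLaneTriple : Fin 8 → Fin 3 → Fin 8 :=
  ![![6, 3, 4], ![6, 2, 7], ![6, 1, 5], ![2, 3, 5], ![1, 4, 7], ![0, 1, 2], ![0, 3, 7], ![0, 4, 5]]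

theorem satMacLane_iff_triple {K : Type} [Field K] {γ : Fin 8 → Fin 3 → K} : SatMacLane γ ↔
    ∀ a, det3 (γ (macLaneTriple a 0)) (γ (macLaneTriple a 1)) (γ (macLaneTriple a 2)) = 0 := by
  have h1 : ∀ a, {macLaneTriple a 0, macLaneTriple a 1, macLaneTriple a 2} ∈ macLane.lines := by
    decide +kernel
  have h2 : ∀ i j k, {i, j, k} ∈ macLane.lines → ∃ a, (∃ x, i = macLaneTriple a x) ∧
      (∃ x, j = macLaneTriple a x) ∧ ∃ x, k = macLaneTriple a x := by
    simp only [mem_lines_iff]; decide +kernel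
  refine ⟨fun h a => h _ _ _ (h1 a), fun h i j k hl => ?_⟩
  obtain ⟨a, ⟨x, rfl⟩, ⟨y, rfl⟩, ⟨z, rfl⟩⟩ := h2 i j k hl
  obtain ⟨n, hn, n0, n1, n2⟩ := exists_normal_of_det3_eq_zero (h a)
  have key : ∀ x, n ⬝ᵥ γ (macLaneTriple a x) = 0 := by
    intro x
    fin_cases x
    exacts [n0, n1, n2]
  exact det3_eq_zero_of_normal hn (key x) (key y) (key z)

section Membership

variable {N : Matroid (Fin 8)} {γ : VecConfig 3 8}

theorem linDep_singleton_iff {i : Fin 8} :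
    LinDep γ ({i} : Finset (Fin 8)) ↔ γ i = 0 := by
  rw [LinDep, Finset.coe_singleton]
  exact (not_congr (linearIndepOn_singleton_iff ℂ)).trans not_not

theorem linDep_pair_iff {i j : Fin 8} (hij : i ≠ j) :
    LinDep γ ({i, j} : Finset (Fin 8)) ↔ γ i ⨯₃ γ j = 0 := by
  rw [LinDep, Finset.coe_pair]
  exact (not_congr (linearIndepOn_pair_iff_cross hij)).trans not_not

theorem linDep_triple_iff {i j k : Fin 8} (hij : i ≠ j) (hik : i ≠ k) (hjk : j ≠ k) :
    LinDep γ ({i, j, k} : Finset (Fin 8)) ↔ det3 (γ i) (γ j) (γ k) = 0 := by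
  rw [LinDep, Finset.coe_insert, Finset.coe_pair]
  exact (not_congr (linearIndepOn_triple_iff hij hik hjk)).trans not_not

/-- Sets with more than three elements are always linearly dependent, so only sets with at most
three elements matter. -/
theorem mem_circuitVariety_of (h1 : ∀ i, ¬ N.Indep ({i} : Finset (Fin 8)) → γ i = 0)
    (h2 : ∀ i j, i ≠ j → ¬ N.Indep ({i, j} : Finset (Fin 8)) → γ i ⨯₃ γ j = 0)
    (h3 : ∀ i j k, i ≠ j → i ≠ k → j ≠ k → ¬ N.Indep ({i, j, k} : Finset (Fin 8)) →
      det3 (γ i) (γ j) (γ k) = 0) : γ ∈ circuitVariety 3 N := by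
  intro S hS hind
  have hle := ncard_le_three_of_linearIndepOn hind
  obtain ⟨I, rfl⟩ : ∃ I : Finset (Fin 8), (I : Set (Fin 8)) = S := S.toFinite.exists_finset_coe
  rw [Set.ncard_coe_finset] at hle
  have hnot := hS.not_indep
  have hcases : I.card = 0 ∨ I.card = 1 ∨ I.card = 2 ∨ I.card = 3 := by omega
  rcases hcases with h | h | h | h
  · rw [Finset.card_eq_zero.1 h] at hnot
    exact hnot (by simp)
  · obtain ⟨i, rfl⟩ := Finset.card_eq_one.1 h
    exact linDep_singleton_iff.2 (h1 i hnot) hind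
  · obtain ⟨i, j, hij, rfl⟩ := Finset.card_eq_two.1 h
    exact (linDep_pair_iff hij).2 (h2 i j hij hnot) hind
  · obtain ⟨i, j, k, hij, hik, hjk, rfl⟩ := Finset.card_eq_three.1 h
    exact (linDep_triple_iff hij hik hjk).2 (h3 i j k hij hik hjk hnot) hind

theorem mem_realizationSpace_of (hE : N.E = Set.univ)
    (hN : ∀ I : Finset (Fin 8), N.Indep I → I.card ≤ 3)
    (h1 : ∀ i, N.Indep ({i} : Finset (Fin 8)) ↔ γ i ≠ 0)
    (h2 : ∀ i j, i ≠ j → (N.Indep ({i, j} : Finset (Fin 8)) ↔ γ i ⨯₃ γ j ≠ 0))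
    (h3 : ∀ i j k, i ≠ j → i ≠ k → j ≠ k → (N.Indep ({i, j, k} : Finset (Fin 8)) ↔
      det3 (γ i) (γ j) (γ k) ≠ 0)) : γ ∈ realizationSpace 3 N := by
  rw [realizationSpace_eq_inter 3 hE]
  refine ⟨mem_circuitVariety_of (fun i h => ?_) (fun i j hij h => ?_)
    (fun i j k hij hik hjk h => ?_), fun S hS => ?_⟩
  · exact not_not.1 fun h' => h ((h1 i).2 h')
  · exact not_not.1 fun h' => h ((h2 i j hij).2 h')
  · exact not_not.1 fun h' => h ((h3 i j k hij hik hjk).2 h')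
  obtain ⟨I, rfl⟩ : ∃ I : Finset (Fin 8), (I : Set (Fin 8)) = S := S.toFinite.exists_finset_coe
  have hle := hN I hS
  refine not_not.1 fun (hdep : LinDep γ I) => ?_
  have hcases : I.card = 0 ∨ I.card = 1 ∨ I.card = 2 ∨ I.card = 3 := by omega
  rcases hcases with h | h | h | h
  · rw [Finset.card_eq_zero.1 h] at hdep
    exact hdep (Finset.coe_empty ▸ linearIndepOn_empty _ _)
  · obtain ⟨i, rfl⟩ := Finset.card_eq_one.1 h
    exact (h1 i).1 hS (linDep_singleton_iff.1 hdep)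
  · obtain ⟨i, j, hij, rfl⟩ := Finset.card_eq_two.1 h
    exact (h2 i j hij).1 hS ((linDep_pair_iff hij).1 hdep)
  · obtain ⟨i, j, k, hij, hik, hjk, rfl⟩ := Finset.card_eq_three.1 h
    exact (h3 i j k hij hik hjk).1 hS ((linDep_triple_iff hij hik hjk).1 hdep)

theorem indep_iff_of_mem_realizationSpace (hE : N.E = Set.univ) (hγ : γ ∈ realizationSpace 3 N)
    (I : Finset (Fin 8)) : N.Indep I ↔ ¬ LinDep γ I := by
  rw [hγ, Matroid.Dep, hE]
  simp

theorem indep_singleton_iff (hE : N.E = Set.univ) (hγ : γ ∈ realizationSpace 3 N) (i : Fin 8) :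
    N.Indep ({i} : Finset (Fin 8)) ↔ γ i ≠ 0 := by
  rw [indep_iff_of_mem_realizationSpace hE hγ, linDep_singleton_iff]

theorem indep_pair_iff (hE : N.E = Set.univ) (hγ : γ ∈ realizationSpace 3 N) (i j : Fin 8)
    (hij : i ≠ j) : N.Indep ({i, j} : Finset (Fin 8)) ↔ γ i ⨯₃ γ j ≠ 0 := by
  rw [indep_iff_of_mem_realizationSpace hE hγ, linDep_pair_iff hij]

theorem indep_triple_iff (hE : N.E = Set.univ) (hγ : γ ∈ realizationSpace 3 N) (i j k : Fin 8)
    (hij : i ≠ j) (hik : i ≠ k) (hjk : j ≠ k) :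
    N.Indep ({i, j, k} : Finset (Fin 8)) ↔ det3 (γ i) (γ j) (γ k) ≠ 0 := by
  rw [indep_iff_of_mem_realizationSpace hE hγ, linDep_triple_iff hij hik hjk]

/-- A realization over a subring of `ℂ` in which equality is decidable can be checked there. -/
theorem mem_realizationSpace_map {S : Type*} [CommRing S] {f : S →+* ℂ}
    (hf : Function.Injective f) (w : Fin 8 → Fin 3 → S) (hE : N.E = Set.univ)
    (hN : ∀ I : Finset (Fin 8), N.Indep I → I.card ≤ 3)
    (h1 : ∀ i, N.Indep ({i} : Finset (Fin 8)) ↔ w i ≠ 0)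
    (h2 : ∀ i j, i ≠ j → (N.Indep ({i, j} : Finset (Fin 8)) ↔ w i ⨯₃ w j ≠ 0))
    (h3 : ∀ i j k, i ≠ j → i ≠ k → j ≠ k → (N.Indep ({i, j, k} : Finset (Fin 8)) ↔
      det3 (w i) (w j) (w k) ≠ 0)) :
    (fun i j => f (w i j) : VecConfig 3 8) ∈ realizationSpace 3 N := by
  have hzero : ∀ u : Fin 3 → S, (fun k => f (u k)) = 0 ↔ u = 0 := fun u => by
    simp only [funext_iff, Pi.zero_apply, map_eq_zero_iff f hf]
  refine mem_realizationSpace_of hE hN (fun i => ?_) (fun i j hij => ?_)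
    (fun i j k hij hik hjk => ?_)
  · rw [h1]
    exact (not_congr (hzero _)).symm
  · rw [h2 i j hij]
    refine not_congr ?_
    rw [← hzero]
    simp only [map_cross_apply]
  · rw [h3 i j k hij hik hjk]
    refine not_congr ?_
    rw [← map_eq_zero_iff f hf, det3_apply, det3_apply]
    simp only [map_add, map_sub, map_mul]

theorem mem_circuitVariety_macLane_iff :
    γ ∈ circuitVariety 3 macLane.matroid ↔ SatMacLane (γ : Fin 8 → Fin 3 → ℂ) := by
  constructor
  · intro h i j k hl
    have hne : ∀ i j k, {i, j, k} ∈ macLane.lines →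
        i ≠ j ∧ i ≠ k ∧ j ≠ k ∧ ({i, j, k} : Finset (Fin 8)).card = 3 := by
      simp only [mem_lines_iff]; decide +kernel
    obtain ⟨hij, hik, hjk, hc⟩ := hne i j k hl
    refine (linDep_triple_iff hij hik hjk).1 (h _ ⟨fun hI => ?_, Set.subset_univ _⟩)
    exact (macLane_indep_iff.1 hI).2 hc hl
  · intro h
    refine mem_circuitVariety_of (fun i hi => ?_) (fun i j hij hi => ?_)
      (fun i j k hij hik hjk hi => ?_)
    · exact (hi (macLane_indep_iff.2 (by simp))).elim
    · exact (hi (macLane_indep_iff.2 (by simp [Finset.card_pair hij]))).elim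
    · refine h i j k (not_not.1 fun hl => hi (macLane_indep_iff.2 ⟨?_, fun _ => hl⟩))
      exact Finset.card_le_three

theorem mem_circuitVariety_makeLoops {S : Set (Fin 8)} (h : SatMacLane (γ : Fin 8 → Fin 3 → ℂ))
    (hS : ∀ x ∈ S, γ x = 0) : γ ∈ circuitVariety 3 (makeLoops macLane.matroid S) := by
  have hdep : ∀ I : Finset (Fin 8), ¬ (makeLoops macLane.matroid S).Indep I →
      LinDep γ I := by
    intro I hI hind
    rw [makeLoops_macLane_indep_iff] at hI
    refine hI ⟨?_, fun x hx hxS => hind.ne_zero hx (hS x hxS)⟩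
    by_contra hM
    exact mem_circuitVariety_macLane_iff.2 h _ ⟨hM, Set.subset_univ _⟩ hind
  intro T hT
  obtain ⟨I, rfl⟩ : ∃ I : Finset (Fin 8), (I : Set (Fin 8)) = T := T.toFinite.exists_finset_coe
  exact hdep I hT.not_indep

theorem satMacLane_of_mem_realizationSpace_makeLoops {S : Set (Fin 8)}
    (hγ : γ ∈ realizationSpace 3 (makeLoops macLane.matroid S)) :
    SatMacLane (γ : Fin 8 → Fin 3 → ℂ) := by
  refine mem_circuitVariety_macLane_iff.1 fun T hT => (hγ T).2 ⟨fun h => hT.not_indep ?_, hT.2⟩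
  obtain ⟨I, rfl⟩ : ∃ I : Finset (Fin 8), (I : Set (Fin 8)) = T := T.toFinite.exists_finset_coe
  exact (makeLoops_macLane_indep_iff.1 h).1

end Membership

/-- If the realization space is nonempty and contained in the image of a polynomial map into the
circuit variety, then the matroid variety is the closure of this image. -/
theorem matroidVariety_eq_closure_image {n d : ℕ} {α β : Type} (φ : PolyParam n d α β)
    {N : Matroid (Fin d)} (hN : N.E = Set.univ) (hφ : φ.image ⊆ circuitVariety n N)
    (hR : realizationSpace n N ⊆ φ.image) (hne : (realizationSpace n N).Nonempty) :
    matroidVariety n N = closure φ.image := by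
  refine (closure_mono hR).antisymm (φ.closure_image_subset_matroidVariety hN hφ ?_)
  obtain ⟨γ, hγ⟩ := hne
  refine ⟨γ, hR hγ, ?_⟩
  rw [realizationSpace_eq_inter n hN] at hγ
  exact hγ.2

/-! ### Matroid varieties as closures of images of polynomial maps -/

theorem intCast_injective : Function.Injective (Int.castRingHom ℂ) := Int.cast_injective

/-- A configuration of vectors with integer coordinates, as a complex configuration. -/
def intConfig (w : Fin 8 → Fin 3 → ℤ) : VecConfig 3 8 := fun i j => Int.castRingHom ℂ (w i j)

theorem card_le_three_of_macLane_indep {I : Finset (Fin 8)} (h : macLane.matroid.Indep I) :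
    I.card ≤ 3 := (macLane_indep_iff.1 h).1

theorem card_le_three_of_makeLoops_indep {S : Set (Fin 8)} {I : Finset (Fin 8)}
    (h : (makeLoops macLane.matroid S).Indep I) : I.card ≤ 3 :=
  card_le_three_of_macLane_indep (makeLoops_macLane_indep_iff.1 h).1

theorem macLaneLoop_indep_iff {i : Fin 8} {I : Finset (Fin 8)} : (macLaneLoop i).Indep I ↔
    (I.card ≤ 3 ∧ (I.card = 3 → I ∉ macLane.lines)) ∧ i ∉ I := by
  rw [macLaneLoop, makeLoops_macLane_indep_iff, macLane_indep_iff]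
  simp

/-- One point of each of the four pairs of points on no common line. -/
def pairRep : Fin 4 → Fin 8 := ![1, 2, 5, 6]

theorem macLanePair_eq_pairRep (i : Fin 4) :
    macLanePair i = {pairRep i, antipode (pairRep i)} := by
  fin_cases i <;> rfl

theorem macLaneD_indep_iff {i : Fin 4} {I : Finset (Fin 8)} : (macLaneD i).Indep I ↔
    (I.card ≤ 3 ∧ (I.card = 3 → I ∉ macLane.lines)) ∧ pairRep i ∉ I ∧ antipode (pairRep i) ∉ I := by
  rw [macLaneD, makeLoops_macLane_indep_iff, macLane_indep_iff, macLanePair_eq_pairRep]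
  refine and_congr_right fun _ => ⟨fun h => ⟨fun h6 => h _ h6 (by simp), fun h0 => h _ h0
    (by simp)⟩, ?_⟩
  rintro ⟨h6, h0⟩ x hx hx'
  rcases hx' with rfl | rfl
  exacts [h6 hx, h0 hx]

theorem macLaneD_three_indep_iff {I : Finset (Fin 8)} : (macLaneD 3).Indep I ↔
    (I.card ≤ 3 ∧ (I.card = 3 → I ∉ macLane.lines)) ∧ 6 ∉ I ∧ 0 ∉ I :=
  macLaneD_indep_iff

/-! #### Rank two -/

/-- Eight pairwise independent vectors on a plane. -/
def planePoint : Fin 8 → Fin 3 → ℤ :=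
  fun i => ![1, (i : ℕ), 0]

theorem planePoint_mem : intConfig planePoint ∈ realizationSpace 3 (uniformMatroid 2 8) := by
  refine mem_realizationSpace_map intCast_injective planePoint rfl ?_ ?_ ?_ ?_
  · intro I hI
    exact (uniformMatroid_indep_iff.1 hI).trans (by norm_num)
  all_goals simp only [uniformMatroid_indep_iff, det3_apply]; decide +kernel

theorem matroidVariety_uniform : matroidVariety 3 (uniformMatroid 2 8) =
    closure coplanarParam.image := by
  refine matroidVariety_eq_closure_image _ rfl ?_ ?_ ⟨_, planePoint_mem⟩
  · rintro _ ⟨v, s, rfl⟩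
    refine mem_circuitVariety_of (fun i hi => ?_) (fun i j hij hi => ?_)
      (fun i j k hij hik hjk hi => ?_)
    · exact (hi (uniformMatroid_indep_iff.2 (by simp))).elim
    · exact (hi (uniformMatroid_indep_iff.2 Finset.card_le_two)).elim
    · simp only [coplanarParam, det3_apply, Pi.add_apply, Pi.smul_apply, smul_eq_mul]
      ring
  · intro γ hγ
    have hdet : ∀ i, det3 (γ 0) (γ 1) (γ i) = 0 := by
      intro i
      by_cases h0 : i = 0
      · subst h0
        simp only [det3_apply]; ring
      by_cases h1 : i = 1
      · subst h1
        simp only [det3_apply]; ring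
      refine not_not.1 ((indep_triple_iff rfl hγ 0 1 i (by decide) (Ne.symm h0)
        (Ne.symm h1)).not.1 fun h => ?_)
      have := uniformMatroid_indep_iff.1 h
      rw [Finset.card_eq_three.2 ⟨0, 1, i, by decide, Ne.symm h0, Ne.symm h1, rfl⟩] at this
      omega
    have h01 : γ 0 ⨯₃ γ 1 ≠ 0 := (indep_pair_iff rfl hγ 0 1 (by decide)).1
      (uniformMatroid_indep_iff.2 Finset.card_le_two)
    exact mem_range_coplanarParam h01 fun i =>
      dotProduct_eq_zero_of_det3 dot_cross_left dot_cross_right h01 (hdet i)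

/-! #### Two loops -/

/-- Six vectors on two planes, with no further dependencies, and two zero vectors. -/
def twoLoopsPoint : Fin 8 → Fin 3 → ℤ :=
  ![0, ![1, 0, 0], ![0, 0, 1], ![1, 2, 1], ![1, 1, 0], ![1, 2, 2], 0, ![0, 1, 0]]

theorem twoLoopsPoint_mem : intConfig twoLoopsPoint ∈ realizationSpace 3 (macLaneD 3) := by
  refine mem_realizationSpace_map intCast_injective twoLoopsPoint rfl ?_ ?_ ?_ ?_
  · exact fun I => card_le_three_of_makeLoops_indep
  all_goals simp only [macLaneD_three_indep_iff, det3_apply]; decide +kernel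

theorem matroidVariety_macLaneD_three : matroidVariety 3 (macLaneD 3) =
    closure twoPlanesParam.image := by
  refine matroidVariety_eq_closure_image _ rfl ?_ ?_ ⟨_, twoLoopsPoint_mem⟩
  · rintro _ ⟨v, s, rfl⟩
    refine mem_circuitVariety_makeLoops ?_ ?_
    · refine satMacLane_iff_triple.2 fun a => ?_
      fin_cases a <;> simp [macLaneTriple, twoPlanesParam, det3_apply] <;> ring
    · rw [show macLanePair 3 = {6, 0} from rfl]
      rintro x (rfl | rfl) <;> simp [twoPlanesParam]
  · intro γ hγ
    refine mem_range_twoPlanesParam ?_ ?_ ?_ ?_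
    · exact not_not.1 ((indep_singleton_iff rfl hγ 6).not.1 (by
        rw [macLaneD_three_indep_iff]; decide))
    · exact not_not.1 ((indep_singleton_iff rfl hγ 0).not.1 (by
        rw [macLaneD_three_indep_iff]; decide))
    · exact not_not.1 ((indep_triple_iff rfl hγ 1 4 7 (by decide) (by decide) (by decide)).not.1 (by
        rw [macLaneD_three_indep_iff]; decide +kernel))
    · exact not_not.1 ((indep_triple_iff rfl hγ 2 3 5 (by decide) (by decide) (by decide)).not.1 (by
        rw [macLaneD_three_indep_iff]; decide +kernel))

/-! #### One loop -/

/-- An integral realization of the MacLane configuration without the point `6`. -/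
def loopPoint : Fin 8 → Fin 3 → ℤ :=
  ![![1, 0, 0], ![0, 1, 0], ![1, 1, 0], ![1, 0, 2], ![0, 1, 1], ![3, 2, 2], 0, ![0, 0, 1]]

theorem loopPoint_mem : intConfig loopPoint ∈ realizationSpace 3 (macLaneLoop 6) := by
  refine mem_realizationSpace_map intCast_injective loopPoint rfl ?_ ?_ ?_ ?_
  · exact fun I => card_le_three_of_makeLoops_indep
  all_goals simp only [macLaneLoop_indep_iff, det3_apply]; decide +kernel

theorem matroidVariety_macLaneLoop_six : matroidVariety 3 (macLaneLoop 6) =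
    closure loopParam.image := by
  refine matroidVariety_eq_closure_image _ rfl ?_ ?_ ⟨_, loopPoint_mem⟩
  · rintro _ ⟨v, s, rfl⟩
    refine mem_circuitVariety_makeLoops ?_ ?_
    · refine satMacLane_iff_triple.2 fun a => ?_
      fin_cases a <;> simp [macLaneTriple, loopParam, det3_apply, cross_apply] <;> ring
    · rintro x rfl
      simp [loopParam]
  · intro γ hγ
    have hpair : ∀ i j, i ≠ j → i ≠ 6 → j ≠ 6 → γ i ⨯₃ γ j ≠ 0 := by
      have : ∀ i j, i ≠ j → i ≠ 6 → j ≠ 6 → (macLaneLoop 6).Indep ({i, j} : Finset (Fin 8)) := by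
        simp only [macLaneLoop_indep_iff]; decide +kernel
      exact fun i j hij hi hj => (indep_pair_iff rfl hγ i j hij).1 (this i j hij hi hj)
    have hsat : SatMacLane (γ : Fin 8 → Fin 3 → ℂ) :=
      satMacLane_of_mem_realizationSpace_makeLoops hγ
    refine hsat.mem_range_loopParam (not_not.1 ((indep_singleton_iff rfl hγ 6).not.1 (by
        rw [macLaneLoop_indep_iff]; decide))) (hpair _ _ (by decide) (by decide) (by decide))
      (hpair _ _ (by decide) (by decide) (by decide))
      (hpair _ _ (by decide) (by decide) (by decide)) ?_
    have h042 : det3 (γ 0) (γ 4) (γ 2) ≠ 0 :=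
      (indep_triple_iff rfl hγ 0 4 2 (by decide) (by decide) (by decide)).1 (by
        rw [macLaneLoop_indep_iff]; decide +kernel)
    have h23 := hpair 2 3 (by decide) (by decide) (by decide)
    -- otherwise the plane of `2` and `3` coincides with that of `0` and `4`
    intro hc
    obtain ⟨c, hc⟩ := exists_eq_smul_of_cross_eq_zero h23 (cross_eq_zero_comm.1 hc)
    rw [det3_rotate, det3_rotate] at h042
    apply h042
    rw [det3, hc, dotProduct_smul, dot_self_cross, smul_zero]

/-! #### Parallel points -/

/-- Three double vectors and a simple one on a plane, and a vector off it. -/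
def pencilPoint : Fin 8 → Fin 3 → ℤ :=
  ![![1, 2, 0], ![1, 1, 0], ![1, 0, 0], ![0, 1, 0], ![0, 1, 0], ![1, 1, 0], ![0, 0, 1], ![1, 0, 0]]

theorem pencilPoint_mem : intConfig pencilPoint ∈ realizationSpace 3 (macLaneB 6) := by
  refine mem_realizationSpace_map intCast_injective pencilPoint rfl ?_ ?_ ?_ ?_
  · exact fun I hI => (macLaneB_indep_iff.1 hI).2.1
  all_goals simp only [macLaneB_indep_iff, det3_apply]; decide +kernel

theorem pencilParam_cross {A : Type} [CommRing A] [Algebra ℂ A] (v : Fin 3 → Fin 3 → A)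
    (s : Fin 8 × Fin 3 → A) (i j : Fin 8) (h : {6, i, j} ∈ macLane.lines) :
    pencilParam.map A v s i ⨯₃ pencilParam.map A v s j = 0 := by
  have hl : ∀ i j, {6, i, j} ∈ macLane.lines → i ≠ 6 ∧ j ≠ 6 ∧ pencilRep i = pencilRep j := by
    simp only [mem_lines_iff]; decide +kernel
  obtain ⟨hi, hj, hij⟩ := hl i j h
  simp only [pencilParam, hi, hj, hij, if_false]
  rw [LinearMap.map_smul₂, LinearMap.map_smul, cross_self, smul_zero, smul_zero]

theorem matroidVariety_macLaneB_six : matroidVariety 3 (macLaneB 6) =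
    closure pencilParam.image := by
  refine matroidVariety_eq_closure_image _ rfl ?_ ?_ ⟨_, pencilPoint_mem⟩
  · rintro _ ⟨v, s, rfl⟩
    have hpar := pencilParam_cross v s
    refine mem_circuitVariety_of (fun i hi => ?_) (fun i j hij hi => ?_)
      (fun i j k hij hik hjk hi => ?_)
    · have : ∀ i, (macLaneB 6).Indep ({i} : Finset (Fin 8)) := by
        simp only [macLaneB_indep_iff]; decide +kernel
      exact (hi (this i)).elim
    · have : ∀ i j, ¬ (macLaneB 6).Indep ({i, j} : Finset (Fin 8)) → {6, i, j} ∈ macLane.lines := by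
        simp only [macLaneB_indep_iff]; decide +kernel
      exact hpar i j (this i j hi)
    · have : ∀ i j k, ¬ (macLaneB 6).Indep ({i, j, k} : Finset (Fin 8)) →
          {6, i, j} ∈ macLane.lines ∨ {6, j, k} ∈ macLane.lines ∨ {6, k, i} ∈ macLane.lines ∨
            i ≠ 6 ∧ j ≠ 6 ∧ k ≠ 6 := by
        simp only [macLaneB_indep_iff]; decide +kernel
      rcases this i j k hi with h | h | h | ⟨h1, h2, h3⟩
      · rw [det3_rotate, det3_rotate, det3, hpar _ _ h, dotProduct_zero]
      · rw [det3, hpar _ _ h, dotProduct_zero]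
      · rw [det3_rotate, det3, hpar _ _ h, dotProduct_zero]
      · simp only [pencilParam, h1, h2, h3, if_false, det3_apply, Pi.add_apply, Pi.smul_apply,
          smul_eq_mul]
        ring
  · intro γ hγ
    have h23 : γ 2 ⨯₃ γ 3 ≠ 0 := (indep_pair_iff rfl hγ 2 3 (by decide)).1 (by
      rw [macLaneB_indep_iff]; decide +kernel)
    have hne : ∀ i, γ i ≠ 0 := by
      have : ∀ i, (macLaneB 6).Indep ({i} : Finset (Fin 8)) := by
        simp only [macLaneB_indep_iff]; decide +kernel
      exact fun i => (indep_singleton_iff rfl hγ i).1 (this i)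
    have hpar : ∀ i j, {6, i, j} ∈ macLane.lines → γ i ⨯₃ γ j = 0 := by
      have : ∀ i j, {6, i, j} ∈ macLane.lines →
          i ≠ j ∧ ¬ (macLaneB 6).Indep ({i, j} : Finset (Fin 8)) := by
        simp only [macLaneB_indep_iff]; decide +kernel
      exact fun i j h => not_not.1 ((indep_pair_iff rfl hγ i j (this i j h).1).not.1 (this i j h).2)
    have hdet : ∀ i, i ≠ 6 → det3 (γ 2) (γ 3) (γ i) = 0 := by
      intro i h6
      by_cases h2 : i = 2
      · subst h2
        simp only [det3_apply]; ring
      by_cases h3 : i = 3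
      · subst h3
        simp only [det3_apply]; ring
      have : ∀ i, i ≠ 6 → i ≠ 2 → i ≠ 3 →
          ¬ (macLaneB 6).Indep ({2, 3, i} : Finset (Fin 8)) := by
        simp only [macLaneB_indep_iff]; decide +kernel
      exact not_not.1 ((indep_triple_iff rfl hγ 2 3 i (by decide) (Ne.symm h2)
        (Ne.symm h3)).not.1 (this i h6 h2 h3))
    exact mem_range_pencilParam h23 (fun i hi =>
        dotProduct_eq_zero_of_det3 dot_cross_left dot_cross_right h23 (hdet i hi))
      (hne 1) (hne 2) (hne 3) (hpar 1 5 (by decide +kernel)) (hpar 2 7 (by decide +kernel))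
      (hpar 3 4 (by decide +kernel))

/-! #### The MacLane matroid -/

/-- The Eisenstein integers embed into `ℂ` by each root of `t ^ 2 + t + 1`. -/
theorem exists_eisenstein_hom {t : ℂ} (ht : t ^ 2 + t + 1 = 0) :
    ∃ f : QuadraticAlgebra ℤ (-1) (-1) →+* ℂ, Function.Injective f ∧ f ⟨0, 1⟩ = t := by
  have h : t * t = (-1 : ℤ) • (1 : ℂ) + (-1 : ℤ) • t := by
    simp only [neg_smul, one_smul]
    linear_combination ht
  refine ⟨(QuadraticAlgebra.lift ⟨t, h⟩ : QuadraticAlgebra ℤ (-1) (-1) →ₐ[ℤ] ℂ).toRingHom, ?_, ?_⟩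
  · rw [injective_iff_map_eq_zero]
    rintro ⟨p, q⟩ hpq
    have h1 : (p : ℂ) + q * t = 0 := by
      simpa [QuadraticAlgebra.lift] using hpq
    have h2 : ((p ^ 2 - p * q + q ^ 2 : ℤ) : ℂ) = 0 := by
      push_cast
      linear_combination (p + q * (-1 - t)) * h1 + q ^ 2 * ht
    have h3 : p ^ 2 - p * q + q ^ 2 = 0 := by exact_mod_cast h2
    have hq : q = 0 := by nlinarith [sq_nonneg (2 * p - q), sq_nonneg q]
    have hp : p = 0 := by nlinarith
    rw [hp, hq]
    rfl
  · simp [QuadraticAlgebra.lift]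

theorem macLaneParam_map_standard (t : ℂ) : (fun i j => macLaneVec t
    ![![1, 0, 0], ![0, 1, 0], ![0, 0, 1]] i j : VecConfig 3 8) ∈ (macLaneParam t).image :=
  ⟨![![1, 0, 0], ![0, 1, 0], ![0, 0, 1]], fun _ => 1, by simp [macLaneParam]⟩

theorem macLaneParam_standard_mem {t : ℂ} (ht : t ^ 2 + t + 1 = 0) : (fun i j => macLaneVec t
    ![![1, 0, 0], ![0, 1, 0], ![0, 0, 1]] i j : VecConfig 3 8) ∈
      realizationSpace 3 macLane.matroid := by
  obtain ⟨f, hf, hft⟩ := exists_eisenstein_hom ht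
  have := mem_realizationSpace_map hf (N := macLane.matroid)
    (macLaneVec ⟨0, 1⟩ ![![1, 0, 0], ![0, 1, 0], ![0, 0, 1]]) rfl
    (fun I => card_le_three_of_macLane_indep) (by simp only [macLane_indep_iff]; decide +kernel)
    (by simp only [macLane_indep_iff]; decide +kernel)
    (by simp only [macLane_indep_iff, det3_apply]; decide +kernel)
  convert this using 3 with i j
  fin_cases i <;> fin_cases j <;> simp [macLaneVec, hft]

theorem macLaneParam_image_subset {t : ℂ} (ht : t ^ 2 + t + 1 = 0) :
    (macLaneParam t).image ⊆ circuitVariety 3 macLane.matroid := by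
  rintro _ ⟨v, s, rfl⟩
  refine mem_circuitVariety_macLane_iff.2 (satMacLane_iff_triple.2 fun a => ?_)
  have h2 : det3 ((macLaneParam t).map ℂ v s 6) ((macLaneParam t).map ℂ v s 1)
      ((macLaneParam t).map ℂ v s 5) =
        -(s 6 * s 1 * s 5 * det3 (v 0) (v 1) (v 2)) * (t ^ 2 + t + 1) := by
    simp [macLaneParam, macLaneVec, det3_apply]
    ring
  by_cases h : a = 2
  · subst h
    exact h2.trans (by rw [ht, mul_zero])
  fin_cases a
  all_goals first | exact (h rfl).elim | skip
  all_goals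
    simp [macLaneTriple, macLaneParam, macLaneVec, det3_apply]
    ring

theorem realizationSpace_macLane_subset {t : ℂ} (ht : t ^ 2 + t + 1 = 0) :
    realizationSpace 3 macLane.matroid ⊆
      (macLaneParam t).image ∪ (macLaneParam (-1 - t)).image := by
  intro γ hγ
  have hsat : SatMacLane (γ : Fin 8 → Fin 3 → ℂ) :=
    mem_circuitVariety_macLane_iff.1 fun S hS => (hγ S).2 hS
  obtain ⟨u, hu, hmem⟩ := hsat.mem_range_macLaneParam
    (fun i j hij => (indep_pair_iff rfl hγ i j hij).1 (macLane_indep_iff.2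
      ⟨Finset.card_le_two.trans (by norm_num), fun h => by
        have := Finset.card_le_two (a := i) (b := j); omega⟩))
    ((indep_triple_iff rfl hγ 0 1 7 (by decide) (by decide) (by decide)).1 (by
      rw [macLane_indep_iff]; decide +kernel))
  have hprod : (u - t) * (u - (-1 - t)) = 0 := by linear_combination hu - ht
  rcases mul_eq_zero.1 hprod with h | h
  · rw [sub_eq_zero.1 h] at hmem
    exact Or.inl hmem
  · rw [sub_eq_zero.1 h] at hmem
    exact Or.inr hmem

/-- The realization space of the MacLane matroid is covered by two irreducible sets, one for each
root of `t ^ 2 + t + 1`. -/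
theorem matroidVariety_macLane {t : ℂ} (ht : t ^ 2 + t + 1 = 0) :
    matroidVariety 3 macLane.matroid =
      closure (macLaneParam t).image ∪ closure (macLaneParam (-1 - t)).image := by
  have key : ∀ u : ℂ, u ^ 2 + u + 1 = 0 →
      closure (macLaneParam u).image ⊆ matroidVariety 3 macLane.matroid := by
    intro u hu
    refine (macLaneParam u).closure_image_subset_matroidVariety rfl (macLaneParam_image_subset hu)
      ⟨_, macLaneParam_map_standard u, ?_⟩
    have := macLaneParam_standard_mem hu
    rw [realizationSpace_eq_inter 3 rfl] at this
    exact this.2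
  refine Set.Subset.antisymm ?_ (Set.union_subset (key t ht) (key _ (by linear_combination ht)))
  rw [← closure_union]
  exact closure_mono (realizationSpace_macLane_subset ht)

/-! ### The components do not contain one another -/

theorem matroidVariety_subset_circuitVariety (n : ℕ) {d : ℕ} (N : Matroid (Fin d)) :
    matroidVariety n N ⊆ circuitVariety n N :=
  closure_minimal (fun _ hγ S hS => (hγ S).2 hS) (isClosed_circuitVariety n N)

theorem indep_of_mem_circuitVariety {n d : ℕ} {N N' : Matroid (Fin d)} {γ : VecConfig n d}
    (hE : N'.E = Set.univ) (hγ : γ ∈ realizationSpace n N) (hγ' : γ ∈ circuitVariety n N')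
    {S : Set (Fin d)} (hS : N.Indep S) : N'.Indep S := by
  by_contra hS'
  have hdep : N'.Dep S := ⟨hS', hE ▸ Set.subset_univ S⟩
  exact ((hγ S).1 (hγ' S hdep)).not_indep hS

namespace IsPolyFun

variable {n d : ℕ} {u v w : VecConfig n d → Fin 3 → ℂ}

theorem cross (hu : ∀ k, IsPolyFun fun γ => u γ k) (hv : ∀ k, IsPolyFun fun γ => v γ k)
    (k : Fin 3) : IsPolyFun fun γ => (u γ ⨯₃ v γ) k := by
  simp only [cross_apply]
  fin_cases k
  exacts [((hu _).mul (hv _)).sub ((hu _).mul (hv _)), ((hu _).mul (hv _)).sub ((hu _).mul (hv _)),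
    ((hu _).mul (hv _)).sub ((hu _).mul (hv _))]

theorem det3 (hu : ∀ k, IsPolyFun fun γ => u γ k) (hv : ∀ k, IsPolyFun fun γ => v γ k)
    (hw : ∀ k, IsPolyFun fun γ => w γ k) : IsPolyFun fun γ => _root_.det3 (u γ) (v γ) (w γ) := by
  simp only [_root_.det3, dotProduct]
  exact sum _ fun k => (hu k).mul (cross hv hw k)

theorem bracket (i j k : Fin d) :
    IsPolyFun fun γ : VecConfig 3 d => _root_.det3 (γ i) (γ j) (γ k) :=
  det3 (coord i) (coord j) (coord k)

end IsPolyFun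

theorem eq_zero_of_mem_matroidVariety {n d : ℕ} {N : Matroid (Fin d)} {F : VecConfig n d → ℂ}
    (hF : IsPolyFun F) (h : ∀ γ ∈ realizationSpace n N, F γ = 0) {γ : VecConfig n d}
    (hγ : γ ∈ matroidVariety n N) : F γ = 0 :=
  closure_minimal h hF.isClosed_eq hγ

/-- The lines `{0, 1, 2}`, `{0, 3, 7}` and `{0, 4, 5}` stay concurrent when `6` moves to the origin,
but not when `0` does. -/
theorem concurrent_of_satMacLane {γ : Fin 8 → Fin 3 → ℂ} (h : SatMacLane γ) (h0 : γ 0 ≠ 0) :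
    det3 (γ 1 ⨯₃ γ 2) (γ 7 ⨯₃ γ 3) (γ 4 ⨯₃ γ 5) = 0 :=
  det3_eq_zero_of_normal h0 (h 0 1 2 (by decide +kernel)) (h 0 7 3 (by decide +kernel))
    (h 0 4 5 (by decide +kernel))

theorem isPolyFun_concurrent : IsPolyFun fun γ : VecConfig 3 8 =>
    det3 (γ 1 ⨯₃ γ 2) (γ 7 ⨯₃ γ 3) (γ 4 ⨯₃ γ 5) :=
  .det3 (.cross (.coord 1) (.coord 2)) (.cross (.coord 7) (.coord 3)) (.cross (.coord 4) (.coord 5))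

theorem concurrent_twoLoopsPoint : det3 (intConfig twoLoopsPoint 1 ⨯₃ intConfig twoLoopsPoint 2)
    (intConfig twoLoopsPoint 7 ⨯₃ intConfig twoLoopsPoint 3)
    (intConfig twoLoopsPoint 4 ⨯₃ intConfig twoLoopsPoint 5) ≠ 0 := by
  simp [det3_apply, cross_apply, intConfig, twoLoopsPoint]
  norm_num

theorem not_macLaneD_three_subset_macLaneLoop_six :
    ¬ matroidVariety 3 (macLaneD 3) ⊆ matroidVariety 3 (macLaneLoop 6) := fun h =>
  concurrent_twoLoopsPoint (eq_zero_of_mem_matroidVariety isPolyFun_concurrent (fun γ hγ =>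
    concurrent_of_satMacLane (satMacLane_of_mem_realizationSpace_makeLoops hγ)
      ((indep_singleton_iff rfl hγ 0).1 ((macLaneLoop_indep_iff (i := 6)).2 (by decide))))
    (h (subset_closure twoLoopsPoint_mem)))

theorem not_macLaneD_three_subset_macLane :
    ¬ matroidVariety 3 (macLaneD 3) ⊆ matroidVariety 3 macLane.matroid := fun h =>
  concurrent_twoLoopsPoint (eq_zero_of_mem_matroidVariety isPolyFun_concurrent (fun γ hγ =>
    concurrent_of_satMacLane (mem_circuitVariety_macLane_iff.1 fun S hS => (hγ S).2 hS)
      ((indep_singleton_iff rfl hγ 0).1 (macLane_indep_iff.2 (by simp))))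
    (h (subset_closure twoLoopsPoint_mem)))

/-- A polynomial vanishing for both roots `t` on the images of the two parametrizations vanishes on
the matroid variety. -/
theorem eq_zero_of_mem_matroidVariety_macLane {F : VecConfig 3 8 → ℂ} (hF : IsPolyFun F)
    (h : ∀ t : ℂ, t ^ 2 + t + 1 = 0 → ∀ v s, F ((macLaneParam t).map ℂ v s) = 0)
    {γ : VecConfig 3 8} (hγ : γ ∈ matroidVariety 3 macLane.matroid) : F γ = 0 := by
  obtain ⟨t, ht⟩ := exists_sq_add_self_add_one_eq_zero
  refine eq_zero_of_mem_matroidVariety hF (fun γ hγ => ?_) hγ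
  rcases realizationSpace_macLane_subset ht hγ with ⟨v, s, rfl⟩ | ⟨v, s, rfl⟩
  · exact h t ht v s
  · exact h _ (by linear_combination ht) v s

/-- Numerator of the cross ratio of the lines from `1` to the points `0`, `5`, `7`, `3`. -/
def crossRatioNum (γ : VecConfig 3 8) : ℂ := det3 (γ 1) (γ 0) (γ 7) * det3 (γ 1) (γ 5) (γ 3)

/-- Denominator of the cross ratio of the lines from `1` to the points `0`, `5`, `7`, `3`. -/
def crossRatioDen (γ : VecConfig 3 8) : ℂ := det3 (γ 1) (γ 0) (γ 5) * det3 (γ 1) (γ 7) (γ 3)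

theorem isPolyFun_crossRatioNum : IsPolyFun crossRatioNum :=
  (IsPolyFun.bracket _ _ _).mul (.bracket _ _ _)

theorem isPolyFun_crossRatioDen : IsPolyFun crossRatioDen :=
  (IsPolyFun.bracket _ _ _).mul (.bracket _ _ _)

/-- The cross ratio distinguishes the two families of realizations. -/
theorem crossRatioDen_map (t : ℂ) (v s) : crossRatioDen ((macLaneParam t).map ℂ v s) =
    -t * crossRatioNum ((macLaneParam t).map ℂ v s) := by
  simp [crossRatioNum, crossRatioDen, macLaneParam, macLaneVec, det3_apply]
  ring

theorem not_closure_macLaneParam_subset {t u : ℂ} (hut : u ≠ t) :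
    ¬ closure (macLaneParam u).image ⊆ closure (macLaneParam t).image := by
  intro h
  have hF : IsPolyFun fun γ => crossRatioDen γ + t * crossRatioNum γ :=
    isPolyFun_crossRatioDen.add ((IsPolyFun.const t).mul isPolyFun_crossRatioNum)
  have hsub : closure (macLaneParam t).image ⊆ {γ | crossRatioDen γ + t * crossRatioNum γ = 0} := by
    refine closure_minimal ?_ hF.isClosed_eq
    rintro _ ⟨v, s, rfl⟩
    change _ + _ = _
    rw [crossRatioDen_map]
    ring
  have h0 : crossRatioDen _ + t * crossRatioNum _ = 0 :=
    hsub (h (subset_closure (macLaneParam_map_standard u)))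
  have h1 : u = t := by
    simp [crossRatioNum, crossRatioDen, macLaneVec, det3_apply] at h0
    linear_combination -h0
  exact hut h1

theorem not_macLaneLoop_six_subset_macLane :
    ¬ matroidVariety 3 (macLaneLoop 6) ⊆ matroidVariety 3 macLane.matroid := by
  intro h
  have hX := isPolyFun_crossRatioNum
  have hY := isPolyFun_crossRatioDen
  have h0 := eq_zero_of_mem_matroidVariety_macLane (((hX.mul hX).sub (hX.mul hY)).add (hY.mul hY))
    (fun t ht v s => by
      rw [crossRatioDen_map]
      linear_combination (crossRatioNum ((macLaneParam t).map ℂ v s)) ^ 2 * ht)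
    (h (subset_closure loopPoint_mem))
  simp [crossRatioNum, crossRatioDen, det3_apply, intConfig, loopPoint] at h0
  norm_num at h0

/-- In every realization of the MacLane matroid the cross ratio of the three lines through `6` and
the join of `6` with its antipode `0` is a primitive sixth root of unity. -/
theorem not_macLaneB_six_subset_macLane :
    ¬ matroidVariety 3 (macLaneB 6) ⊆ matroidVariety 3 macLane.matroid := by
  intro h
  have hX := (IsPolyFun.bracket (d := 8) 6 2 3).mul (.bracket 6 1 0)
  have hY := (IsPolyFun.bracket (d := 8) 6 2 1).mul (.bracket 6 3 0)
  have h0 := eq_zero_of_mem_matroidVariety_macLane (((hX.mul hX).sub (hX.mul hY)).add (hY.mul hY))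
    (fun t ht v s => by
      obtain ⟨c, hc⟩ : ∃ c, c = s 6 ^ 2 * s 2 * s 3 * s 1 * s 0 * det3 (v 0) (v 1) (v 2) ^ 2 :=
        ⟨_, rfl⟩
      have h1 : det3 ((macLaneParam t).map ℂ v s 6) ((macLaneParam t).map ℂ v s 2)
          ((macLaneParam t).map ℂ v s 3) * det3 ((macLaneParam t).map ℂ v s 6)
          ((macLaneParam t).map ℂ v s 1) ((macLaneParam t).map ℂ v s 0) = c * (1 + t) ^ 2 := by
        rw [hc]
        simp [macLaneParam, macLaneVec, det3_apply]
        ring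
      have h2 : det3 ((macLaneParam t).map ℂ v s 6) ((macLaneParam t).map ℂ v s 2)
          ((macLaneParam t).map ℂ v s 1) * det3 ((macLaneParam t).map ℂ v s 6)
          ((macLaneParam t).map ℂ v s 3) ((macLaneParam t).map ℂ v s 0) = c * (1 + t) := by
        rw [hc]
        simp [macLaneParam, macLaneVec, det3_apply]
        ring
      rw [h1, h2]
      linear_combination c ^ 2 * (1 + t) ^ 2 * ht)
    (h (subset_closure pencilPoint_mem))
  simp [det3_apply, intConfig, pencilPoint] at h0
  norm_num at h0

/-- In every realization of the MacLane matroid, the minors formed from the first two coordinates of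
pairs of points on the lines `{0, 1, 2}`, `{1, 4, 7}`, `{0, 3, 7}` determine `t`. Eliminating `t`
gives a relation that is not satisfied by all configurations on a plane. -/
theorem not_uniform_subset_macLane :
    ¬ matroidVariety 3 (uniformMatroid 2 8) ⊆ matroidVariety 3 macLane.matroid := by
  intro h
  let m (i j : Fin 8) (γ : VecConfig 3 8) : ℂ := γ i 0 * γ j 1 - γ i 1 * γ j 0
  have hm : ∀ i j, IsPolyFun (m i j) := fun i j =>
    ((IsPolyFun.coord i 0).mul (.coord j 1)).sub ((IsPolyFun.coord i 1).mul (.coord j 0))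
  have hX := ((hm 0 2).mul (hm 1 4)).mul (hm 7 3)
  have hY := ((hm 2 1).mul (hm 4 7)).mul (hm 3 0)
  have h0 := eq_zero_of_mem_matroidVariety_macLane (((hX.mul hX).add (hX.mul hY)).add (hY.mul hY))
    (fun t ht v s => by
      have hXY : m 0 2 ((macLaneParam t).map ℂ v s) * m 1 4 ((macLaneParam t).map ℂ v s) *
          m 7 3 ((macLaneParam t).map ℂ v s) = t * (m 2 1 ((macLaneParam t).map ℂ v s) *
          m 4 7 ((macLaneParam t).map ℂ v s) * m 3 0 ((macLaneParam t).map ℂ v s)) := by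
        simp [m, macLaneParam, macLaneVec]
        ring
      rw [hXY]
      linear_combination (m 2 1 ((macLaneParam t).map ℂ v s) *
          m 4 7 ((macLaneParam t).map ℂ v s) * m 3 0 ((macLaneParam t).map ℂ v s)) ^ 2 * ht)
    (h (subset_closure planePoint_mem))
  simp [m, intConfig, planePoint] at h0
  norm_num at h0

/-! ### Covering the circuit variety -/

section Generic

/-- The configuration of generic points of the subscheme defined by a prime ideal. -/
noncomputable def genericConfig {n d : ℕ} (P : Ideal (MvPolynomial (Fin d × Fin n) ℂ)) :
    Fin d → Fin n → FractionRing (MvPolynomial (Fin d × Fin n) ℂ ⧸ P) := fun i j =>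
  algebraMap _ _ (Ideal.Quotient.mk P (MvPolynomial.X (i, j)))

variable {n d : ℕ} {P : Ideal (MvPolynomial (Fin d × Fin n) ℂ)}

theorem aeval_genericConfig (p : MvPolynomial (Fin d × Fin n) ℂ) :
    MvPolynomial.aeval (fun ij => genericConfig P ij.1 ij.2) p =
      algebraMap _ _ (Ideal.Quotient.mk P p) := by
  have : (MvPolynomial.aeval fun ij => genericConfig P ij.1 ij.2) =
      (IsScalarTower.toAlgHom ℂ (MvPolynomial (Fin d × Fin n) ℂ ⧸ P)
        (FractionRing (MvPolynomial (Fin d × Fin n) ℂ ⧸ P))).comp (Ideal.Quotient.mkₐ ℂ P) := by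
    refine MvPolynomial.algHom_ext fun ij => ?_
    rw [MvPolynomial.aeval_X]
    rfl
  rw [this]
  rfl

/-- If the generic point of a subscheme lies in the image of a polynomial map, then all its points
lie in the closure of this image. -/
theorem mem_closure_image_of_genericConfig {α β : Type} (φ : PolyParam n d α β) [P.IsPrime]
    (σ : Equiv.Perm (Fin d)) (h : genericConfig P ∘ σ ∈ φ.range _) {γ : VecConfig n d}
    (hγ : ∀ p ∈ P, evalAt γ p = 0) : VecConfig.relabel σ γ ∈ closure φ.image := by
  refine mem_closure_iff_evalAt.2 fun p hp => ?_
  have h0 := φ.aeval_eq_zero_of_mem_range hp h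
  rw [evalAt_relabel]
  refine hγ _ (Ideal.Quotient.eq_zero_iff_mem.1 ?_)
  refine IsFractionRing.injective (MvPolynomial (Fin d × Fin n) ℂ ⧸ P)
    (FractionRing (MvPolynomial (Fin d × Fin n) ℂ ⧸ P)) ?_
  rw [← aeval_genericConfig, MvPolynomial.aeval_rename, map_zero]
  exact h0

end Generic

theorem map_det3 {A B : Type*} [CommRing A] [CommRing B] (f : A →+* B) (u v w : Fin 3 → A) :
    f (det3 u v w) = det3 (fun k => f (u k)) (fun k => f (v k)) (fun k => f (w k)) := by
  simp only [det3_apply, map_add, map_sub, map_mul]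

/-- The determinants of the eight lines of the MacLane configuration. -/
noncomputable def macLanePoly (a : Fin 8) : MvPolynomial (Fin 8 × Fin 3) ℂ :=
  det3 (fun k => MvPolynomial.X (macLaneTriple a 0, k))
    (fun k => MvPolynomial.X (macLaneTriple a 1, k))
    (fun k => MvPolynomial.X (macLaneTriple a 2, k))

theorem exists_genericConfig {γ : VecConfig 3 8} (hγ : γ ∈ circuitVariety 3 macLane.matroid) :
    ∃ (P : Ideal (MvPolynomial (Fin 8 × Fin 3) ℂ)) (_ : P.IsPrime),
      (∀ p ∈ P, evalAt γ p = 0) ∧ SatMacLane (genericConfig P) ∧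
        HasLargeDim (genericConfig P) := by
  classical
  let s : Finset (MvPolynomial (Fin 8 × Fin 3) ℂ) := Finset.univ.image macLanePoly
  let m : Ideal (MvPolynomial (Fin 8 × Fin 3) ℂ) :=
    RingHom.ker (MvPolynomial.eval fun ij : Fin 8 × Fin 3 => γ ij.1 ij.2)
  have hm : m.IsPrime := RingHom.ker_isPrime _
  have hs : Ideal.span (s : Set (MvPolynomial (Fin 8 × Fin 3) ℂ)) ≤ m := by
    refine Ideal.span_le.2 fun p hp => ?_
    obtain ⟨a, -, rfl⟩ := Finset.mem_image.1 hp
    change MvPolynomial.eval _ _ = 0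
    rw [macLanePoly, map_det3]
    simpa using satMacLane_iff_triple.1 (mem_circuitVariety_macLane_iff.1 hγ) a
  obtain ⟨P, hP, hPm⟩ := Ideal.exists_minimalPrimes_le hs
  have hprime : P.IsPrime := hP.1.1
  refine ⟨P, hprime, fun p hp => hPm hp, satMacLane_iff_triple.2 fun a => ?_, ?_⟩
  · have hmem : macLanePoly a ∈ P := hP.1.2 (Ideal.subset_span (Finset.mem_coe.2
      (Finset.mem_image_of_mem _ (Finset.mem_univ a))))
    have := map_det3 ((algebraMap _ (FractionRing (MvPolynomial (Fin 8 × Fin 3) ℂ ⧸ P))).comp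
      (Ideal.Quotient.mk P)) (fun k => MvPolynomial.X (macLaneTriple a 0, k))
        (fun k => MvPolynomial.X (macLaneTriple a 1, k))
        (fun k => MvPolynomial.X (macLaneTriple a 2, k))
    refine this.symm.trans ?_
    change algebraMap _ (FractionRing (MvPolynomial (Fin 8 × Fin 3) ℂ ⧸ P))
      (Ideal.Quotient.mk P (macLanePoly a)) = _
    rw [Ideal.Quotient.eq_zero_iff_mem.2 hmem, map_zero]
  · rintro n ⟨T, hT, hgen⟩
    have hcard := MvPolynomial.card_le_of_mem_minimalPrimes hP s rfl T
      fun ij => hgen ij.1 (Finset.mem_univ _) ij.2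
    have hs8 : s.card ≤ 8 := Finset.card_image_le.trans (by simp)
    simp only [Nat.card_eq_fintype_card, Fintype.card_prod, Fintype.card_fin] at hcard
    omega

/-- Every point of the circuit variety lies in the closure of one of the parametrized sets, up to an
automorphism. -/
theorem cover_circuitVariety {γ : VecConfig 3 8} (hγ : γ ∈ circuitVariety 3 macLane.matroid) :
    γ ∈ matroidVariety 3 macLane.matroid ∨ γ ∈ matroidVariety 3 (uniformMatroid 2 8) ∨
      (∃ i, γ ∈ matroidVariety 3 (macLaneLoop i)) ∨ (∃ i, γ ∈ matroidVariety 3 (macLaneD i)) ∨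
        ∃ k, γ ∈ matroidVariety 3 (macLaneB k) := by
  obtain ⟨P, hP, hvan, hsat, hdim⟩ := exists_genericConfig hγ
  rcases hsat.classify hdim with ⟨t, ht, h⟩ | h | ⟨σ, hσ, h | h | h⟩
  · rw [matroidVariety_macLane ht]
    exact Or.inl (Or.inl (mem_closure_image_of_genericConfig (macLaneParam t) 1 h hvan))
  · rw [matroidVariety_uniform]
    exact Or.inr (Or.inl (mem_closure_image_of_genericConfig coplanarParam 1 h hvan))
  · refine Or.inr (Or.inr (Or.inl ⟨σ 6, ?_⟩))
    rw [matroidVariety_macLaneLoop_eq_preimage hσ, matroidVariety_macLaneLoop_six]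
    exact mem_closure_image_of_genericConfig loopParam σ h hvan
  · obtain ⟨i, hi⟩ := exists_macLanePair_eq (σ 6)
    refine Or.inr (Or.inr (Or.inr (Or.inl ⟨i, ?_⟩)))
    rw [matroidVariety_macLaneD_eq_preimage hσ hi, matroidVariety_macLaneD_three]
    exact mem_closure_image_of_genericConfig twoPlanesParam σ h hvan
  · refine Or.inr (Or.inr (Or.inr (Or.inr ⟨σ 6, ?_⟩)))
    rw [matroidVariety_macLaneB_eq_preimage hσ, matroidVariety_macLaneB_six]
    exact mem_closure_image_of_genericConfig pencilParam σ h hvan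

/-! ### The twenty-three components -/

/-- Indices of the components other than the two in the matroid variety of the MacLane matroid: for
`U_{2,8}`, the `M(i)`, the `D_i` and the `B_k`. -/
abbrev DegenerateIndex : Type := Unit ⊕ Fin 8 ⊕ Fin 4 ⊕ Fin 8

/-- The matroids of the components other than the two in the matroid variety of the MacLane
matroid. -/
def degenerateMatroid : DegenerateIndex → Matroid (Fin 8) :=
  Sum.elim (fun _ => uniformMatroid 2 8) (Sum.elim macLaneLoop (Sum.elim macLaneD macLaneB))

theorem degenerateMatroid_ground (k : DegenerateIndex) : (degenerateMatroid k).E = Set.univ := by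
  rcases k with _ | i | i | i <;> rfl

/-- Independence in the degenerate matroids, as a computable function. -/
def degenerateIndep (k : DegenerateIndex) (I : Finset (Fin 8)) : Bool :=
  match k with
  | Sum.inl _ => I.card ≤ 2
  | Sum.inr (Sum.inl i) => (I.card ≤ 3 ∧ (I.card = 3 → I ∉ macLane.lines)) ∧ i ∉ I
  | Sum.inr (Sum.inr (Sum.inl i)) => (I.card ≤ 3 ∧ (I.card = 3 → I ∉ macLane.lines)) ∧
      pairRep i ∉ I ∧ antipode (pairRep i) ∉ I
  | Sum.inr (Sum.inr (Sum.inr i)) => (∀ y ∈ I, ∀ z ∈ I, {i, y, z} ∉ macLane.lines) ∧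
      I.card ≤ 3 ∧ (I.card = 3 → i ∈ I)

theorem degenerateMatroid_indep_iff (k : DegenerateIndex) (I : Finset (Fin 8)) :
    (degenerateMatroid k).Indep I ↔ degenerateIndep k I = true := by
  rcases k with _ | i | i | i
  · exact uniformMatroid_indep_iff.trans decide_eq_true_iff.symm
  · exact macLaneLoop_indep_iff.trans decide_eq_true_iff.symm
  · exact macLaneD_indep_iff.trans decide_eq_true_iff.symm
  · exact macLaneB_indep_iff.trans decide_eq_true_iff.symm

/-- The degenerate matroids can be told apart from the MacLane matroid by an independent set of the
latter. -/
theorem exists_indep_not_indep_degenerate (k : DegenerateIndex) : ∃ I : Finset (Fin 8),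
    macLane.matroid.Indep I ∧ ¬ (degenerateMatroid k).Indep I := by
  have key : ∀ k, ∃ x y z : Fin 8, ((({x, y, z} : Finset (Fin 8)).card ≤ 3 ∧
      (({x, y, z} : Finset (Fin 8)).card = 3 → ({x, y, z} : Finset (Fin 8)) ∉ macLane.lines)) ∧
      ¬ degenerateIndep k {x, y, z} = true) := by
    decide +kernel
  obtain ⟨x, y, z, h⟩ := key k
  exact ⟨{x, y, z}, by rwa [macLane_indep_iff, degenerateMatroid_indep_iff]⟩

/-- Whether `k` stands for some `D_i`, and `l` for `M(b)` with `b` a loop of `D_i`. -/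
def isPairOverLoop (k l : DegenerateIndex) : Bool :=
  match k, l with
  | Sum.inr (Sum.inr (Sum.inl i)), Sum.inr (Sum.inl b) => pairRep i = b ∨ antipode (pairRep i) = b
  | _, _ => false

/-- Two degenerate matroids can be told apart by an independent set, except that all dependencies
of `M(b)` are dependencies of the `D_i` in which `b` is a loop. -/
theorem exists_indep_not_indep (k l : DegenerateIndex) (hkl : k ≠ l)
    (hD : isPairOverLoop k l = false) : ∃ I : Finset (Fin 8),
    (degenerateMatroid k).Indep I ∧ ¬ (degenerateMatroid l).Indep I := by
  have key : ∀ k l, k ≠ l → isPairOverLoop k l = false → ∃ x y z : Fin 8,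
      degenerateIndep k {x, y, z} = true ∧ ¬ degenerateIndep l {x, y, z} = true := by
    decide +kernel
  obtain ⟨x, y, z, h⟩ := key k l hkl hD
  exact ⟨{x, y, z}, by rwa [degenerateMatroid_indep_iff, degenerateMatroid_indep_iff]⟩

theorem preimage_relabel_subset_iff {n d : ℕ} (σ : Equiv.Perm (Fin d)) {X Y : Set (VecConfig n d)} :
    VecConfig.relabel σ ⁻¹' X ⊆ VecConfig.relabel σ ⁻¹' Y ↔ X ⊆ Y :=
  Set.preimage_subset_preimage_iff (by simp [(VecConfig.relabel σ).surjective.range_eq])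

/-- By symmetry every matroid variety of a degenerate matroid is that of a chosen one in its orbit,
relabelled. -/
theorem exists_matroidVariety_degenerate_eq (k : DegenerateIndex) :
    ∃ (α β : Type) (φ : PolyParam 3 8 α β) (σ : Equiv.Perm (Fin 8)), IsMacLaneAut σ ∧
      matroidVariety 3 (degenerateMatroid k) = VecConfig.relabel σ ⁻¹' closure φ.image ∧
        ¬ closure φ.image ⊆ matroidVariety 3 macLane.matroid := by
  rcases k with _ | i | i | i
  · refine ⟨_, _, coplanarParam, 1, fun i j k => Iff.rfl, matroidVariety_uniform, ?_⟩
    rw [← matroidVariety_uniform]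
    exact not_uniform_subset_macLane
  · obtain ⟨σ, hσ, rfl⟩ := exists_aut_six i
    refine ⟨_, _, loopParam, σ, hσ, ?_⟩
    rw [← matroidVariety_macLaneLoop_six]
    exact ⟨matroidVariety_macLaneLoop_eq_preimage hσ 6, not_macLaneLoop_six_subset_macLane⟩
  · obtain ⟨σ, hσ, h6⟩ := exists_aut_six (pairRep i)
    refine ⟨_, _, twoPlanesParam, σ, hσ, ?_⟩
    rw [← matroidVariety_macLaneD_three]
    exact ⟨matroidVariety_macLaneD_eq_preimage hσ (by rw [h6, macLanePair_eq_pairRep]),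
      not_macLaneD_three_subset_macLane⟩
  · obtain ⟨σ, hσ, rfl⟩ := exists_aut_six i
    refine ⟨_, _, pencilParam, σ, hσ, ?_⟩
    rw [← matroidVariety_macLaneB_six]
    exact ⟨matroidVariety_macLaneB_eq_preimage hσ 6, not_macLaneB_six_subset_macLane⟩

theorem isIrreducible_matroidVariety_degenerate (k : DegenerateIndex) :
    IsIrreducible (matroidVariety 3 (degenerateMatroid k)) := by
  obtain ⟨α, β, φ, σ, -, h, -⟩ := exists_matroidVariety_degenerate_eq k
  have hsymm : matroidVariety 3 (degenerateMatroid k) =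
      VecConfig.relabel σ.symm '' closure φ.image := by
    rw [h]
    exact (Equiv.image_symm_eq_preimage (VecConfig.relabel σ) _).symm
  rw [hsymm]
  exact φ.isIrreducible_image.closure.image _ (continuous_relabel _).continuousOn

theorem not_degenerate_subset_macLane (k : DegenerateIndex) :
    ¬ matroidVariety 3 (degenerateMatroid k) ⊆ matroidVariety 3 macLane.matroid := by
  obtain ⟨α, β, φ, σ, hσ, h, hnot⟩ := exists_matroidVariety_degenerate_eq k
  rw [h, matroidVariety_macLane_eq_preimage hσ, preimage_relabel_subset_iff]
  exact hnot

theorem exists_mem_realizationSpace_degenerate (k : DegenerateIndex) :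
    (realizationSpace 3 (degenerateMatroid k)).Nonempty := by
  rw [← closure_nonempty_iff]
  exact (isIrreducible_matroidVariety_degenerate k).nonempty

theorem not_macLaneD_subset_macLaneLoop (i : Fin 4) (b : Fin 8)
    (h : pairRep i = b ∨ antipode (pairRep i) = b) :
    ¬ matroidVariety 3 (macLaneD i) ⊆ matroidVariety 3 (macLaneLoop b) := by
  have hpair : macLanePair i = {b, antipode b} := by
    rw [macLanePair_eq_pairRep]
    have key : ∀ a, antipode (antipode a) = a := by decide
    rcases h with rfl | rfl
    · rfl
    · rw [key, Set.pair_comm]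
  obtain ⟨σ, hσ, rfl⟩ := exists_aut_six b
  rw [matroidVariety_macLaneD_eq_preimage hσ hpair, matroidVariety_macLaneLoop_eq_preimage hσ,
    preimage_relabel_subset_iff]
  exact not_macLaneD_three_subset_macLaneLoop_six

theorem eq_of_degenerate_subset {k l : DegenerateIndex} (h : matroidVariety 3 (degenerateMatroid k) ⊆
    matroidVariety 3 (degenerateMatroid l)) : k = l := by
  by_contra hkl
  obtain ⟨γ, hγ⟩ := exists_mem_realizationSpace_degenerate k
  have hD : isPairOverLoop k l = false := by
    rw [Bool.eq_false_iff]
    intro hD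
    rcases k with _ | i | i | i <;> rcases l with _ | b | b | b <;>
      first | exact Bool.false_ne_true hD | skip
    exact not_macLaneD_subset_macLaneLoop i b (of_decide_eq_true hD) h
  obtain ⟨I, hI, hI'⟩ := exists_indep_not_indep k l hkl hD
  exact hI' (indep_of_mem_circuitVariety (degenerateMatroid_ground l) hγ
    (matroidVariety_subset_circuitVariety 3 _ (h (subset_closure hγ))) hI)

theorem not_closure_macLaneParam_subset_degenerate {t : ℂ} (ht : t ^ 2 + t + 1 = 0)
    (k : DegenerateIndex) :
    ¬ closure (macLaneParam t).image ⊆ matroidVariety 3 (degenerateMatroid k) := by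
  intro h
  obtain ⟨I, hI, hI'⟩ := exists_indep_not_indep_degenerate k
  exact hI' (indep_of_mem_circuitVariety (degenerateMatroid_ground k) (macLaneParam_standard_mem ht)
    (matroidVariety_subset_circuitVariety 3 _ (h (subset_closure (macLaneParam_map_standard t)))) hI)

theorem matroidVariety_degenerate_subset_circuitVariety (k : DegenerateIndex) :
    matroidVariety 3 (degenerateMatroid k) ⊆ circuitVariety 3 macLane.matroid := by
  refine (matroidVariety_subset_circuitVariety 3 _).trans fun γ hγ S hS => hγ S
    ⟨fun hind => hS.not_indep ?_, (degenerateMatroid_ground k).symm ▸ Set.subset_univ S⟩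
  obtain ⟨I, rfl⟩ : ∃ I : Finset (Fin 8), (I : Set (Fin 8)) = S := S.toFinite.exists_finset_coe
  rcases k with _ | i | i | i
  · have h2 : I.card ≤ 2 := uniformMatroid_indep_iff.1 hind
    exact macLane_indep_iff.2 ⟨by omega, by omega⟩
  · exact (makeLoops_macLane_indep_iff.1 hind).1
  · exact (makeLoops_macLane_indep_iff.1 hind).1
  · obtain ⟨hpar, hle, hmem⟩ := macLaneB_indep_iff.1 hind
    refine macLane_indep_iff.2 ⟨hle, fun h3 hl => ?_⟩
    -- a line of three independent points would consist of `i` and two parallel points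
    have hi := hmem h3
    obtain ⟨y, z, hyz⟩ := Finset.card_eq_two.1 (show (I.erase i).card = 2 by
      rw [Finset.card_erase_of_mem hi, h3])
    have hI : I = {i, y, z} := by rw [← hyz.2, Finset.insert_erase hi]
    rw [hI] at hl hpar
    exact hpar y (by simp) z (by simp) hl

/-- The components of the circuit variety. -/
noncomputable def component (t : ℂ) : Bool ⊕ DegenerateIndex → Set (VecConfig 3 8) :=
  Sum.elim (fun b => closure (macLaneParam (bif b then t else -1 - t)).image)
    fun k => matroidVariety 3 (degenerateMatroid k)

section Component

variable {t : ℂ}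

theorem root_bif (ht : t ^ 2 + t + 1 = 0) (b : Bool) :
    (bif b then t else -1 - t) ^ 2 + (bif b then t else -1 - t) + 1 = 0 := by
  cases b
  · change (-1 - t) ^ 2 + (-1 - t) + 1 = 0
    linear_combination ht
  · exact ht

theorem conj_root_ne (ht : t ^ 2 + t + 1 = 0) : -1 - t ≠ t := by
  intro h
  have h2 : t = -1 / 2 := by linear_combination -h / 2
  rw [h2] at ht
  norm_num at ht

theorem matroidVariety_macLane_eq_iUnion (ht : t ^ 2 + t + 1 = 0) :
    matroidVariety 3 macLane.matroid = ⋃ b, component t (Sum.inl b) := by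
  rw [matroidVariety_macLane ht, Set.union_eq_iUnion]
  refine Set.iUnion_congr fun b => ?_
  cases b <;> rfl

theorem eq_of_component_subset (ht : t ^ 2 + t + 1 = 0) (i j)
    (h : component t i ⊆ component t j) : i = j := by
  have hroot := root_bif ht
  rcases i with b | k <;> rcases j with c | l
  · refine congrArg Sum.inl ?_
    by_contra hbc
    refine not_closure_macLaneParam_subset ?_ h
    cases b <;> cases c
    exacts [(hbc rfl).elim, conj_root_ne ht, (conj_root_ne ht).symm, (hbc rfl).elim]
  · exact (not_closure_macLaneParam_subset_degenerate (hroot b) l h).elim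
  · refine (not_degenerate_subset_macLane k (h.trans ?_)).elim
    rw [matroidVariety_macLane_eq_iUnion ht]
    exact Set.subset_iUnion (fun b => component t (Sum.inl b)) c
  · exact congrArg Sum.inr (eq_of_degenerate_subset h)

theorem circuitVariety_eq_iUnion (ht : t ^ 2 + t + 1 = 0) :
    circuitVariety 3 macLane.matroid = ⋃ j, component t j := by
  refine Set.Subset.antisymm (fun γ hγ => ?_) (Set.iUnion_subset fun j => ?_)
  · rcases cover_circuitVariety hγ with h | h | ⟨i, h⟩ | ⟨i, h⟩ | ⟨i, h⟩
    · rw [matroidVariety_macLane_eq_iUnion ht] at h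
      obtain ⟨b, hb⟩ := Set.mem_iUnion.1 h
      exact Set.mem_iUnion.2 ⟨_, hb⟩
    · exact Set.mem_iUnion.2 ⟨Sum.inr (Sum.inl ()), h⟩
    · exact Set.mem_iUnion.2 ⟨Sum.inr (Sum.inr (Sum.inl i)), h⟩
    · exact Set.mem_iUnion.2 ⟨Sum.inr (Sum.inr (Sum.inr (Sum.inl i))), h⟩
    · exact Set.mem_iUnion.2 ⟨Sum.inr (Sum.inr (Sum.inr (Sum.inr i))), h⟩
  · rcases j with b | k
    · refine Set.Subset.trans ?_ (matroidVariety_subset_circuitVariety 3 _)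
      rw [matroidVariety_macLane_eq_iUnion ht]
      exact Set.subset_iUnion (fun b => component t (Sum.inl b)) b
    · exact matroidVariety_degenerate_subset_circuitVariety k

end Component

theorem isIrreducible_component (t : ℂ) (j) : IsIrreducible (component t j) := by
  rcases j with b | k
  · exact (PolyParam.isIrreducible_image _).closure
  · exact isIrreducible_matroidVariety_degenerate k

theorem isClosed_component (t : ℂ) (j) : IsClosed (component t j) := by
  rcases j with b | k <;> exact isClosed_closure

theorem mainTheorem7 :
    ∃ Vplus Vminus : Set (VecConfig 3 8),
      Vplus ≠ Vminus ∧
      irredComponentsOf (matroidVariety 3 macLane.matroid) = {Vplus, Vminus} ∧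
      circuitVariety 3 macLane.matroid =
        Vplus ∪ Vminus ∪ matroidVariety 3 (uniformMatroid 2 8)
          ∪ (⋃ i : Fin 8, matroidVariety 3 (macLaneLoop i))
          ∪ (⋃ i : Fin 4, matroidVariety 3 (macLaneD i))
          ∪ (⋃ k : Fin 8, matroidVariety 3 (macLaneB k)) ∧
      irredComponentsOf (circuitVariety 3 macLane.matroid) =
        {Vplus, Vminus, matroidVariety 3 (uniformMatroid 2 8)}
          ∪ Set.range (fun i : Fin 8 => matroidVariety 3 (macLaneLoop i))
          ∪ Set.range (fun i : Fin 4 => matroidVariety 3 (macLaneD i))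
          ∪ Set.range (fun k : Fin 8 => matroidVariety 3 (macLaneB k)) ∧
      (irredComponentsOf (circuitVariety 3 macLane.matroid)).ncard = 23 := by
  obtain ⟨t, ht⟩ := exists_sq_add_self_add_one_eq_zero
  have hinj : Function.Injective (component t) := fun i j h => eq_of_component_subset ht i j h.subset
  have hM : irredComponentsOf (matroidVariety 3 macLane.matroid) =
      Set.range fun b => component t (Sum.inl b) := by
    rw [matroidVariety_macLane_eq_iUnion ht]
    exact irredComponentsOf_iUnion _ (fun b => isIrreducible_component t _)
      (fun b => isClosed_component t _)
      fun b c h => Sum.inl_injective (eq_of_component_subset ht _ _ h)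
  have hX : irredComponentsOf (circuitVariety 3 macLane.matroid) = Set.range (component t) := by
    rw [circuitVariety_eq_iUnion ht]
    exact irredComponentsOf_iUnion _ (isIrreducible_component t) (isClosed_component t)
      (eq_of_component_subset ht)
  refine ⟨component t (Sum.inl true), component t (Sum.inl false),
    fun h => by simpa using hinj h, ?_, ?_, ?_, ?_⟩
  · rw [hM, Bool.range_eq, Set.pair_comm]
  · rw [circuitVariety_eq_iUnion ht]
    ext γ
    simp only [Set.mem_iUnion, Set.mem_union, Sum.exists, Bool.exists_bool, component,
      degenerateMatroid, Sum.elim_inl, Sum.elim_inr, exists_const]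
    tauto
  · rw [hX]
    ext Z
    simp only [Set.mem_range, Set.mem_union, Set.mem_insert_iff, Set.mem_singleton_iff, Sum.exists,
      Bool.exists_bool, component, degenerateMatroid, Sum.elim_inl, Sum.elim_inr, exists_const,
      eq_comm (a := Z)]
    tauto
  · rw [hX, ← Set.image_univ, Set.ncard_image_of_injective _ hinj, Set.ncard_univ]
    simp
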